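/- Conventions. Spaces are compactly generated and weakly Hausdorff. Let $\hat\otimes$ be the maximal or the minimal $C^*$-tensor product or, more generally, any associative, symmetric and functorial $C^*$-tensor product: $A\hat\otimes B$ is the separated completion of the algebraic tensor product in a $C^*$-seminorm with $\|a\otimes b\|\le\|a\|\,\|b\|$, the tensor product $f\otimes g$ of $*$-homomorphisms is contractive, the flip and the associativity isomorphism are contractive, and $\|1\otimes a\|=\|a\|$ in $\mathbb C\hat\otimes A$. Then $(\mathtt{C^*},\hat\otimes,\mathbb C)$, the category of $C^*$-algebras and $*$-homomorphisms, is symmetric monoidal; its morphism sets carry the point-norm topology. A unital separable $C^*$-algebra $\mathcal D\ne 0,\mathbb C$ is strongly self-absorbing if there are an isomorphism $\varphi:\mathcal D\to\mathcal D\hat\otimes\mathcal D$ and unitaries $w_n\in\mathcal D\hat\otimes\mathcal D$ with $w_n\varphi(d)w_n^*\to d\otimes 1$ for all $d\in\mathcal D$. The strongly self-absorbing $\mathcal D$-operad has as its $j$-th space ($j\ge 0$) the space $\mathcal D(j)=\mathrm{Hom}_1(\mathcal D^{\hat\otimes j},\mathcal D)$ of unital $*$-homomorphisms with the point-norm topology;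 $\Sigma_j$ acts by permuting the tensor factors, the unit is $\mathrm{id}_{\mathcal D}\in\mathcal D(1)$, and the composition is $\gamma(\alpha;\beta_1,\dots,\beta_k)=\alpha\circ(\beta_1\otimes\cdots\otimes\beta_k)$. Let $\mathcal C$ be a symmetric monoidal category with a faithful strong symmetric monoidal functor to $(\mathtt{C^*},\hat\otimes,\mathbb C)$ (for instance a symmetric monoidal subcategory), which we suppress from the notation; its morphism sets carry the topology induced by the point-norm topology, made compactly generated. Let $\mathcal D\in\mathcal C$ be a strongly self-absorbing $C^*$-algebra such that all elements of $\mathcal D(j)$, $j\ge0$, are morphisms of $\mathcal C$ (for instance, $\mathcal C$ is the full subcategory of separable, or of separable nuclear, $C^*$-algebras). Let $(\mathcal B,\wedge,\mathbf 1_{\mathcal B})$ be a symmetric monoidal pointed topological category (enriched over pointed spaces, the base point of $\mathrm{Map}_{\mathcal B}(X,Y)$ being the zero morphism, with $\wedge$ enriched) with a closed action of pointed spaces. That is, there is a functor $(K,X)\mapsto K\wedge X$ from pairs of a pointed space and an object of $\mathcal B$ to $\mathcal B$, such that $(-)\wedge X$ is enriched left adjoint to $\mathrm{Map}_{\mathcal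 B}(X,-)$, each $K\wedge(-)$ has an enriched right adjoint $(-)^K$, and there are coherent natural isomorphisms $(K\wedge L)\wedge X\cong K\wedge(L\wedge X)$ and $S^0\wedge X\cong X$. Algebras and modules. For an operad $C$ in spaces with composition $\gamma$ and unit $1\in C(1)$, a morphism $\theta:C(j)_+\wedge X\to Y$ amounts to a pointed map $C(j)_+\to\mathrm{Map}_{\mathcal B}(X,Y)$, and $\theta(c):X\to Y$ denotes its value at $c\in C(j)$. A $C$-algebra structure on $X\in\mathcal B$ consists of morphisms $\theta_j:C(j)_+\wedge X^{\wedge j}\to X$, $j\ge0$, such that (unitality) $\theta_1(1)$ is the canonical isomorphism $X^{\wedge1}\cong X$; (associativity) $\theta(\gamma(c;d_1,\dots,d_k))=\theta_k(c)\circ(\theta(d_1)\wedge\cdots\wedge\theta(d_k))$; (equivariance) $\theta_j(c\sigma)=\theta_j(c)\circ\sigma$ for $\sigma\in\Sigma_j$ acting on $X^{\wedge j}$ by permuting the factors. A module structure over $X$ on $M\in\mathcal B$ consists of morphisms $\lambda_j:C(j)_+\wedge(X^{\wedge(j-1)}\wedge M)\to M$, $j\ge1$, such that $\lambda_1(1)$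 is the canonical isomorphism, $\lambda(\gamma(c;d_1,\dots,d_k))=\lambda_k(c)\circ(\theta(d_1)\wedge\cdots\wedge\theta(d_{k-1})\wedge\lambda(d_k))$ for $k\ge1$ and $d_k\in C(j_k)$ with $j_k\ge1$, and $\lambda_j(c\sigma)=\lambda_j(c)\circ(\sigma\wedge\mathrm{id}_M)$ for $\sigma\in\Sigma_{j-1}\subset\Sigma_j$. Theorem. Let $F:\mathcal C\to\mathcal B$ be a lax symmetric monoidal functor which is enriched, i.e. the maps $\mathrm{Map}_{\mathcal C}(A,A')\to\mathrm{Map}_{\mathcal B}(F(A),F(A'))$ are continuous, and let $\kappa$ denote its structure morphisms. Then: (1) $F(\mathcal D)$ is an algebra over the strongly self-absorbing $\mathcal D$-operad, with $\theta_j(f)$ equal to the composite $F(\mathcal D)^{\wedge j}\xrightarrow{\kappa}F(\mathcal D^{\hat\otimes j})\xrightarrow{F(f)}F(\mathcal D)$ for all $f\in\mathcal D(j)$. (2) For every $A\in\mathcal C$, the object $F(\mathcal D\hat\otimes A)$ is a module over the algebra $F(\mathcal D)$, with $\lambda_j(f)$ equal to the composite $F(\mathcal D)^{\wedge(j-1)}\wedge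 F(\mathcal D\hat\otimes A)\to F(\mathcal D^{\hat\otimes(j-1)})\wedge F(\mathcal D\hat\otimes A)\xrightarrow{\kappa} F(\mathcal D^{\hat\otimes(j-1)}\hat\otimes(\mathcal D\hat\otimes A))\cong F(\mathcal D^{\hat\otimes j}\hat\otimes A)\xrightarrow{F(f\otimes\mathrm{id})}F(\mathcal D\hat\otimes A)$ for all $f\in\mathcal D(j)$; and $F(A\hat\otimes\mathcal D)$ is a module over $F(\mathcal D)$ such that the isomorphism $F(A\hat\otimes\mathcal D)\cong F(\mathcal D\hat\otimes A)$ induced by the flip is an isomorphism of modules. -/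

import Mathlib

open CategoryTheory MonoidalCategory TopologicalSpace
open scoped TensorProduct

universe u v w w' w₁ w₂

set_option linter.unusedSectionVars false
set_option linter.unusedVariables false
set_option linter.style.whitespace false

noncomputable section

/-! ### C*-seminorms and their C*-completions -/

section DenseMul

variable {R E : Type u} [NonUnitalSeminormedRing R] [NormedSpace ℂ R] [IsScalarTower ℂ R R]
  [SMulCommClass ℂ R R] [NormedAddCommGroup E] [NormedSpace ℂ E] [CompleteSpace E]

/-- Left multiplication by `x`, extended along a dense isometric inclusion `i`. -/
def denseMulLeft (i : R →ₗᵢ[ℂ] E) (x : R) : E →L[ℂ] E :=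
  LinearMap.extendOfNorm (i.toLinearMap ∘ₗ LinearMap.mulLeft ℂ x) i.toLinearMap

lemma denseMulLeft_bound (i : R →ₗᵢ[ℂ] E) (x y : R) :
    ‖(i.toLinearMap ∘ₗ LinearMap.mulLeft ℂ x) y‖ ≤ ‖x‖ * ‖i.toLinearMap y‖ := by
  simpa using norm_mul_le x y

lemma denseMulLeft_coe {i : R →ₗᵢ[ℂ] E} (hi : DenseRange i) (x y : R) :
    denseMulLeft i x (i y) = i (x * y) :=
  LinearMap.extendOfNorm_eq (e := i.toLinearMap) hi ⟨‖x‖, denseMulLeft_bound i x⟩ y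

lemma norm_denseMulLeft_le {i : R →ₗᵢ[ℂ] E} (hi : DenseRange i) (x : R) :
    ‖denseMulLeft i x‖ ≤ ‖x‖ :=
  LinearMap.opNorm_extendOfNorm_le (e := i.toLinearMap) hi (norm_nonneg x)
    (denseMulLeft_bound i x)

/-- `x ↦` (left multiplication by `x`), as a linear map. -/
def denseMulLeftLin {i : R →ₗᵢ[ℂ] E} (hi : DenseRange i) : R →ₗ[ℂ] E →L[ℂ] E where
  toFun := denseMulLeft i
  map_add' x y := by
    ext z
    refine hi.induction_on z (isClosed_eq (by fun_prop) (by fun_prop)) (fun z => ?_)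
    simp [denseMulLeft_coe hi, add_mul]
  map_smul' c x := by
    ext z
    refine hi.induction_on z (isClosed_eq (by fun_prop) (by fun_prop)) (fun z => ?_)
    simp [denseMulLeft_coe hi, smul_mul_assoc]

/-- The multiplication of `R`, extended along a dense isometric inclusion. -/
def denseMul {i : R →ₗᵢ[ℂ] E} (hi : DenseRange i) : E →L[ℂ] E →L[ℂ] E :=
  LinearMap.extendOfNorm (denseMulLeftLin hi) i.toLinearMap

lemma denseMulLin_bound {i : R →ₗᵢ[ℂ] E} (hi : DenseRange i) (x : R) :
    ‖denseMulLeftLin hi x‖ ≤ 1 * ‖i.toLinearMap x‖ := by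
  rw [one_mul]
  exact (norm_denseMulLeft_le hi x).trans_eq (i.norm_map x).symm

lemma denseMul_coe {i : R →ₗᵢ[ℂ] E} (hi : DenseRange i) (x y : R) :
    denseMul hi (i x) (i y) = i (x * y) := by
  have h : denseMul hi (i x) = denseMulLeftLin hi x :=
    LinearMap.extendOfNorm_eq (e := i.toLinearMap) hi ⟨1, denseMulLin_bound hi⟩ x
  rw [h]
  exact denseMulLeft_coe hi x y

lemma norm_denseMul_le {i : R →ₗᵢ[ℂ] E} (hi : DenseRange i) (x y : E) :
    ‖denseMul hi x y‖ ≤ ‖x‖ * ‖y‖ := by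
  have h : ‖denseMul hi‖ ≤ 1 :=
    LinearMap.opNorm_extendOfNorm_le (e := i.toLinearMap) hi zero_le_one (denseMulLin_bound hi)
  refine (ContinuousLinearMap.le_opNorm₂ _ x y).trans ?_
  nlinarith [mul_nonneg (norm_nonneg x) (norm_nonneg y)]

end DenseMul

/-- A C*-seminorm on a complex `*`-algebra. -/
structure CStarSeminorm (R : Type u) [NonUnitalRing R] [StarRing R] [Module ℂ R] extends
    Seminorm ℂ R where
  mul_le' : ∀ x y, toFun (x * y) ≤ toFun x * toFun y
  star_mul_self' : ∀ x, toFun x * toFun x ≤ toFun (star x * x)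

namespace CStarSeminorm

variable {R : Type u} [NonUnitalRing R] [StarRing R] [Module ℂ R] (p : CStarSeminorm R)

instance : CoeFun (CStarSeminorm R) (fun _ => R → ℝ) := ⟨fun p => p.toFun⟩

lemma nonneg (x : R) : 0 ≤ p x := apply_nonneg p.toSeminorm x
lemma add_le (x y : R) : p (x + y) ≤ p x + p y := p.add_le' x y
lemma mul_le (x y : R) : p (x * y) ≤ p x * p y := p.mul_le' x y
lemma smul_eq (c : ℂ) (x : R) : p (c • x) = ‖c‖ * p x := p.smul' c x
lemma zero_eq : p 0 = 0 := map_zero p.toSeminorm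
lemma neg_eq (x : R) : p (-x) = p x := p.neg' x

lemma le_star (x : R) : p x ≤ p (star x) := by
  have h := (p.star_mul_self' x).trans (p.mul_le' (star x) x)
  rcases (p.nonneg x).eq_or_lt with h0 | h0
  · rw [← h0]; exact p.nonneg _
  · exact le_of_mul_le_mul_right h h0

lemma star_eq (x : R) : p (star x) = p x :=
  le_antisymm (by simpa using p.le_star (star x)) (p.le_star x)

lemma star_mul_self (x : R) : p (star x * x) = p x * p x :=
  le_antisymm ((p.mul_le _ _).trans_eq (by rw [p.star_eq])) (p.star_mul_self' x)

/-- The `*`-algebra `R`, regarded as a seminormed space through the C*-seminorm `p`. -/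
def Pre (_p : CStarSeminorm R) : Type u := R

instance : NonUnitalRing p.Pre := inferInstanceAs (NonUnitalRing R)
instance : StarRing p.Pre := inferInstanceAs (StarRing R)
instance : Module ℂ p.Pre := inferInstanceAs (Module ℂ R)
instance [IsScalarTower ℂ R R] : IsScalarTower ℂ p.Pre p.Pre :=
  inferInstanceAs (IsScalarTower ℂ R R)
instance [SMulCommClass ℂ R R] : SMulCommClass ℂ p.Pre p.Pre :=
  inferInstanceAs (SMulCommClass ℂ R R)
instance [StarModule ℂ R] : StarModule ℂ p.Pre := inferInstanceAs (StarModule ℂ R)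

instance : NonUnitalSeminormedRing p.Pre :=
  { (inferInstance : NonUnitalRing p.Pre),
    AddGroupSeminorm.toSeminormedAddCommGroup p.toSeminorm.toAddGroupSeminorm with
    norm_mul_le := fun x y => p.mul_le' x y }

lemma norm_pre (x : p.Pre) : ‖x‖ = p x := rfl

instance : NormedSpace ℂ p.Pre where
  norm_smul_le c x := (p.smul' c x).le

/-- The C*-algebra obtained from `(R, p)` by separation and completion. -/
def Compl (p : CStarSeminorm R) : Type u := UniformSpace.Completion p.Pre

instance : NormedAddCommGroup p.Compl :=
  inferInstanceAs (NormedAddCommGroup (UniformSpace.Completion p.Pre))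
instance : CompleteSpace p.Compl :=
  inferInstanceAs (CompleteSpace (UniformSpace.Completion p.Pre))
instance : NormedSpace ℂ p.Compl :=
  inferInstanceAs (NormedSpace ℂ (UniformSpace.Completion p.Pre))

/-- The canonical map from `R` to its completion, as a linear isometry. -/
def toComplL : p.Pre →ₗᵢ[ℂ] p.Compl := UniformSpace.Completion.toComplₗᵢ

lemma denseRange_toComplL : DenseRange p.toComplL := UniformSpace.Completion.denseRange_coe

lemma induction₁ {P : p.Compl → Prop} (hc : IsClosed {x | P x}) (h : ∀ x, P (p.toComplL x))
    (x : p.Compl) : P x :=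
  p.denseRange_toComplL.induction_on x hc h

variable [IsScalarTower ℂ R R] [SMulCommClass ℂ R R] [StarModule ℂ R]

instance : Mul p.Compl := ⟨fun x y => denseMul p.denseRange_toComplL x y⟩

lemma compl_mul_def (x y : p.Compl) : x * y = denseMul p.denseRange_toComplL x y := rfl

lemma coe_mul (x y : p.Pre) : p.toComplL (x * y) = p.toComplL x * p.toComplL y :=
  (denseMul_coe _ _ _).symm

instance : NonUnitalNormedRing p.Compl :=
  { (inferInstance : NormedAddCommGroup p.Compl) with
    mul := (· * ·)
    left_distrib := fun x y z => by simp [compl_mul_def]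
    right_distrib := fun x y z => by simp [compl_mul_def]
    zero_mul := fun x => by simp [compl_mul_def]
    mul_zero := fun x => by simp [compl_mul_def]
    mul_assoc := fun x y z => by
      simp only [compl_mul_def]
      induction x using p.induction₁ with
      | hc => exact isClosed_eq (by fun_prop) (by fun_prop)
      | h x =>
      induction y using p.induction₁ with
      | hc => exact isClosed_eq (by fun_prop) (by fun_prop)
      | h y =>
      induction z using p.induction₁ with
      | hc => exact isClosed_eq (by fun_prop) (by fun_prop)
      | h z =>
      simp only [denseMul_coe, mul_assoc]
    norm_mul_le := fun x y => norm_denseMul_le _ x y }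

/-- The involution of the completion. -/
def starC (p : CStarSeminorm R) : p.Compl → p.Compl :=
  UniformSpace.Completion.map (star : p.Pre → p.Pre)

lemma pre_norm_star (x : p.Pre) : ‖star x‖ = ‖x‖ := p.star_eq x

lemma pre_star_isometry : Isometry (star : p.Pre → p.Pre) := by
  refine Isometry.of_dist_eq fun x y => ?_
  rw [dist_eq_norm, dist_eq_norm, ← star_sub, pre_norm_star]

lemma starC_coe (x : p.Pre) : p.starC (p.toComplL x) = p.toComplL (star x) :=
  UniformSpace.Completion.map_coe p.pre_star_isometry.uniformContinuous x

lemma continuous_starC : Continuous p.starC := UniformSpace.Completion.continuous_map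

instance : Star p.Compl := ⟨p.starC⟩

lemma compl_star_def (x : p.Compl) : star x = p.starC x := rfl

lemma coe_star (x : p.Pre) : p.toComplL (star x) = star (p.toComplL x) := (p.starC_coe x).symm

instance : ContinuousStar p.Compl := ⟨p.continuous_starC⟩

instance : StarRing p.Compl where
  star_involutive x := by
    induction x using p.induction₁ with
    | hc => exact isClosed_eq (by fun_prop) (by fun_prop)
    | h x =>
    simp [← coe_star]
  star_mul x y := by
    induction x using p.induction₁ with
    | hc => exact isClosed_eq (by fun_prop) (by fun_prop)
    | h x =>
    induction y using p.induction₁ with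
    | hc => exact isClosed_eq (by fun_prop) (by fun_prop)
    | h y =>
    simp [← coe_star, ← coe_mul]
  star_add x y := by
    induction x using p.induction₁ with
    | hc => exact isClosed_eq (by fun_prop) (by fun_prop)
    | h x =>
    induction y using p.induction₁ with
    | hc => exact isClosed_eq (by fun_prop) (by fun_prop)
    | h y =>
    simp [← coe_star, ← map_add]

lemma compl_smul_mul (c : ℂ) (x y : p.Compl) : (c • x) * y = c • (x * y) := by
  simp [compl_mul_def]

lemma compl_mul_smul (c : ℂ) (x y : p.Compl) : x * (c • y) = c • (x * y) := by
  simp [compl_mul_def]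

instance : IsScalarTower ℂ p.Compl p.Compl := ⟨p.compl_smul_mul⟩

instance : SMulCommClass ℂ p.Compl p.Compl := ⟨fun c x y => (p.compl_mul_smul c x y).symm⟩

lemma compl_star_smul (c : ℂ) (x : p.Compl) : star (c • x) = star c • star x := by
  induction x using p.induction₁ with
  | hc =>
    exact isClosed_eq (continuous_star.comp (continuous_const_smul c))
      ((continuous_const_smul (star c)).comp continuous_star)
  | h x =>
    have h1 : star (c • x) = star c • star x := star_smul c x
    rw [← p.toComplL.map_smul, ← coe_star, h1, p.toComplL.map_smul, coe_star]

instance : StarModule ℂ p.Compl := ⟨p.compl_star_smul⟩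

instance : CStarRing p.Compl where
  norm_mul_self_le x := by
    induction x using p.induction₁ with
    | hc => exact isClosed_le (by fun_prop) (by fun_prop)
    | h x =>
    rw [← coe_star, ← coe_mul, LinearIsometry.norm_map, LinearIsometry.norm_map]
    exact p.star_mul_self' x

instance : NonUnitalCStarAlgebra p.Compl where

/-- The canonical `*`-homomorphism from `R` to its completion. -/
def toCompl : R →⋆ₙₐ[ℂ] p.Compl :=
  let f : p.Pre →⋆ₙₐ[ℂ] p.Compl :=
    { toFun := p.toComplL
      map_smul' := p.toComplL.map_smul
      map_zero' := p.toComplL.map_zero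
      map_add' := p.toComplL.map_add
      map_mul' := p.coe_mul
      map_star' := p.coe_star }
  f

lemma norm_toCompl (x : R) : ‖p.toCompl x‖ = p x := p.toComplL.norm_map x

lemma denseRange_toCompl : DenseRange p.toCompl := p.denseRange_toComplL

end CStarSeminorm

lemma starHom_continuous {A B : Type u} [NonUnitalCStarAlgebra A] [NonUnitalCStarAlgebra B]
    (f : A →⋆ₙₐ[ℂ] B) : Continuous f :=
  AddMonoidHomClass.continuous_of_bound f 1
    (by simpa only [one_mul] using NonUnitalStarAlgHom.norm_apply_le f)

section Extend

variable {R : Type u} [AddCommGroup R] [Module ℂ R]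
  {E E' : Type u} [NonUnitalCStarAlgebra E] [NonUnitalCStarAlgebra E']

/-- Extension of a linear map `j` along a linear map `i` with dense range, both multiplicative and
`*`-preserving for the same operations of `R`, given `‖j x‖ ≤ ‖i x‖`. -/
def extendHom (i : R →ₗ[ℂ] E) (hi : DenseRange i) (j : R →ₗ[ℂ] E') (h : ∀ x, ‖j x‖ ≤ ‖i x‖)
    (hm : ∀ x y, ∃ z, i z = i x * i y ∧ j z = j x * j y)
    (hs : ∀ x, ∃ z, i z = star (i x) ∧ j z = star (j x)) : E →⋆ₙₐ[ℂ] E' :=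
  have hx (x : R) : j.extendOfNorm i (i x) = j x :=
    LinearMap.extendOfNorm_eq hi ⟨1, fun x => by rw [one_mul]; exact h x⟩ x
  { toFun := j.extendOfNorm i
    map_smul' := fun c x => map_smul _ c x
    map_zero' := map_zero _
    map_add' := fun x y => map_add _ x y
    map_mul' := fun x y => by
      refine hi.induction_on₂ (p := fun x y => j.extendOfNorm i (x * y) =
          j.extendOfNorm i x * j.extendOfNorm i y)
        (isClosed_eq (by fun_prop) (by fun_prop)) (fun x y => ?_) x y
      obtain ⟨z, hz, hz'⟩ := hm x y
      rw [← hz, hx, hx, hx, hz']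
    map_star' := fun x => by
      refine hi.induction_on (p := fun x => j.extendOfNorm i (star x) =
          star (j.extendOfNorm i x)) x
        (isClosed_eq (by fun_prop) (by fun_prop)) (fun x => ?_)
      obtain ⟨z, hz, hz'⟩ := hs x
      rw [← hz, hx, hx, hz'] }

lemma extendHom_apply (i : R →ₗ[ℂ] E) (hi : DenseRange i) (j : R →ₗ[ℂ] E')
    (h : ∀ x, ‖j x‖ ≤ ‖i x‖) (hm : ∀ x y, ∃ z, i z = i x * i y ∧ j z = j x * j y)
    (hs : ∀ x, ∃ z, i z = star (i x) ∧ j z = star (j x)) (x : R) :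
    extendHom i hi j h hm hs (i x) = j x :=
  LinearMap.extendOfNorm_eq hi ⟨1, fun x => by rw [one_mul]; exact h x⟩ x

end Extend

/-! ### C*-tensor products -/

section AlgebraicTensor

variable {A B C A' B' E : Type u} [NonUnitalCStarAlgebra A] [NonUnitalCStarAlgebra B]
  [NonUnitalCStarAlgebra C] [NonUnitalCStarAlgebra A'] [NonUnitalCStarAlgebra B']

lemma star_map_of_tmul {R S : Type u} [AddCommGroup R] [StarAddMonoid R] [Module ℂ R]
    [StarModule ℂ R] [AddCommGroup S] [StarAddMonoid S] [Module ℂ S] [StarModule ℂ S]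
    {E : Type u} [AddCommGroup E] [StarAddMonoid E] [Module ℂ E]
    (f : R ⊗[ℂ] S →ₗ[ℂ] E) (h : ∀ r s, f (star (r ⊗ₜ s)) = star (f (r ⊗ₜ s)))
    (x : R ⊗[ℂ] S) : f (star x) = star (f x) := by
  induction x with
  | zero => simp
  | tmul r s => exact h r s
  | add x y hx hy => simp only [star_add, map_add, hx, hy]

lemma mul_map_of_tmul {R S E : Type u} [NonUnitalRing R] [Module ℂ R] [SMulCommClass ℂ R R]
    [IsScalarTower ℂ R R] [NonUnitalRing S] [Module ℂ S] [SMulCommClass ℂ S S]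
    [IsScalarTower ℂ S S] [NonUnitalRing E] [Module ℂ E] (f g h : R ⊗[ℂ] S →ₗ[ℂ] E)
    (H : ∀ r s r' s', h ((r * r') ⊗ₜ (s * s')) = f (r ⊗ₜ s) * g (r' ⊗ₜ s'))
    (x y : R ⊗[ℂ] S) : h (x * y) = f x * g y := by
  induction x with
  | zero => simp
  | add x x' hx hx' => simp only [add_mul, map_add, hx, hx']
  | tmul r s =>
    induction y with
    | zero => simp
    | add y y' hy hy' => simp only [mul_add, map_add, hy, hy']
    | tmul r' s' => simpa using H r s r' s'

/-- The tensor product of two `*`-homomorphisms, on the algebraic tensor products. -/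
def algMap {R S R' S' : Type u} [NonUnitalRing R] [StarRing R] [Module ℂ R] [StarModule ℂ R]
    [SMulCommClass ℂ R R] [IsScalarTower ℂ R R]
    [NonUnitalRing S] [StarRing S] [Module ℂ S] [StarModule ℂ S]
    [SMulCommClass ℂ S S] [IsScalarTower ℂ S S]
    [NonUnitalRing R'] [StarRing R'] [Module ℂ R'] [StarModule ℂ R']
    [SMulCommClass ℂ R' R'] [IsScalarTower ℂ R' R']
    [NonUnitalRing S'] [StarRing S'] [Module ℂ S'] [StarModule ℂ S']
    [SMulCommClass ℂ S' S'] [IsScalarTower ℂ S' S']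
    (f : R →⋆ₙₐ[ℂ] R') (g : S →⋆ₙₐ[ℂ] S') : R ⊗[ℂ] S →⋆ₙₐ[ℂ] R' ⊗[ℂ] S' :=
  let φ := TensorProduct.map (f : R →ₗ[ℂ] R') (g : S →ₗ[ℂ] S')
  { toFun := φ
    map_smul' := φ.map_smul
    map_zero' := φ.map_zero
    map_add' := φ.map_add
    map_mul' := mul_map_of_tmul φ φ φ (fun r s r' s' => by simp [φ])
    map_star' := star_map_of_tmul φ (fun r s => by simp [φ, map_star]) }

/-- The flip of the algebraic tensor product. -/
def algComm (R S : Type u) [NonUnitalRing R] [StarRing R] [Module ℂ R] [StarModule ℂ R]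
    [SMulCommClass ℂ R R] [IsScalarTower ℂ R R]
    [NonUnitalRing S] [StarRing S] [Module ℂ S] [StarModule ℂ S]
    [SMulCommClass ℂ S S] [IsScalarTower ℂ S S] : R ⊗[ℂ] S →⋆ₙₐ[ℂ] S ⊗[ℂ] R :=
  let φ := (TensorProduct.comm ℂ R S).toLinearMap
  { toFun := φ
    map_smul' := φ.map_smul
    map_zero' := φ.map_zero
    map_add' := φ.map_add
    map_mul' := mul_map_of_tmul φ φ φ (fun r s r' s' => by simp [φ])
    map_star' := star_map_of_tmul φ (fun r s => by simp [φ]) }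

/-- The associativity isomorphism of the algebraic tensor product. -/
def algAssoc (A B C : Type u) [NonUnitalCStarAlgebra A] [NonUnitalCStarAlgebra B]
    [NonUnitalCStarAlgebra C] : (A ⊗[ℂ] B) ⊗[ℂ] C →⋆ₙₐ[ℂ] A ⊗[ℂ] (B ⊗[ℂ] C) :=
  let φ := (TensorProduct.assoc ℂ A B C).toLinearMap
  { toFun := φ
    map_smul' := φ.map_smul
    map_zero' := φ.map_zero
    map_add' := φ.map_add
    map_mul' := mul_map_of_tmul (R := A ⊗[ℂ] B) (S := C) (E := A ⊗[ℂ] (B ⊗[ℂ] C)) φ φ φ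
      (fun r c r' c' => by
        let ψ (c : C) : A ⊗[ℂ] B →ₗ[ℂ] A ⊗[ℂ] (B ⊗[ℂ] C) :=
          LinearMap.comp φ ((TensorProduct.mk ℂ (A ⊗[ℂ] B) C).flip c)
        exact mul_map_of_tmul (R := A) (S := B) (E := A ⊗[ℂ] (B ⊗[ℂ] C)) (ψ c) (ψ c')
          (ψ (c * c')) (fun a b a' b' => by simp [φ, ψ]) r r')
    map_star' := star_map_of_tmul φ (fun r c => by
      induction r with
      | zero => simp
      | add x x' hx hx' => simp only [TensorProduct.add_tmul, star_add, map_add, hx, hx']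
      | tmul a b => simp [φ]) }

@[simp] lemma algAssoc_tmul (a : A) (b : B) (c : C) :
    algAssoc A B C ((a ⊗ₜ b) ⊗ₜ c) = a ⊗ₜ (b ⊗ₜ c) := rfl

end AlgebraicTensor

@[simp] lemma algMap_tmul {R S R' S' : Type u} [NonUnitalRing R] [StarRing R] [Module ℂ R]
    [StarModule ℂ R] [SMulCommClass ℂ R R] [IsScalarTower ℂ R R]
    [NonUnitalRing S] [StarRing S] [Module ℂ S] [StarModule ℂ S]
    [SMulCommClass ℂ S S] [IsScalarTower ℂ S S]
    [NonUnitalRing R'] [StarRing R'] [Module ℂ R'] [StarModule ℂ R']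
    [SMulCommClass ℂ R' R'] [IsScalarTower ℂ R' R']
    [NonUnitalRing S'] [StarRing S'] [Module ℂ S'] [StarModule ℂ S']
    [SMulCommClass ℂ S' S'] [IsScalarTower ℂ S' S']
    (f : R →⋆ₙₐ[ℂ] R') (g : S →⋆ₙₐ[ℂ] S') (r : R) (s : S) :
    algMap f g (r ⊗ₜ s) = f r ⊗ₜ g s := rfl

@[simp] lemma algComm_tmul {R S : Type u} [NonUnitalRing R] [StarRing R] [Module ℂ R]
    [StarModule ℂ R] [SMulCommClass ℂ R R] [IsScalarTower ℂ R R]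
    [NonUnitalRing S] [StarRing S] [Module ℂ S] [StarModule ℂ S]
    [SMulCommClass ℂ S S] [IsScalarTower ℂ S S] (r : R) (s : S) :
    algComm R S (r ⊗ₜ s) = s ⊗ₜ r := rfl

instance : StarRing (ULift.{u} ℂ) where
  star x := ⟨star x.down⟩
  star_involutive x := by ext1; simp
  star_mul x y := by ext1; simp [mul_comm]
  star_add x y := by ext1; simp

/-- The field of complex numbers as a C*-algebra in an arbitrary universe. -/
instance : NonUnitalCStarAlgebra (ULift.{u} ℂ) where
  norm_mul_self_le x := (CStarRing.norm_star_mul_self (x := x.down)).ge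
  star_smul c x := by ext1; exact star_smul c x.down
  smul_assoc c x y := by ext1; exact smul_assoc c x.down y.down
  smul_comm c x y := by ext1; exact smul_comm c x.down y.down

/-- A C*-tensor product: a choice, for all C*-algebras `A` and `B`, of a C*-seminorm on the
algebraic tensor product, with `‖a ⊗ b‖ ≤ ‖a‖ ‖b‖` and `‖1 ⊗ a‖ = ‖a‖` for `1 ∈ ℂ`, which is
functorial for `*`-homomorphisms and symmetric. The C*-tensor product of `A` and `B` is the
completion. -/
structure CStarTensorData where
  nrm : ∀ (A B : Type u) [NonUnitalCStarAlgebra A] [NonUnitalCStarAlgebra B],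
    CStarSeminorm (A ⊗[ℂ] B)
  tmul_le : ∀ {A B : Type u} [NonUnitalCStarAlgebra A] [NonUnitalCStarAlgebra B] (a : A) (b : B),
    nrm A B (a ⊗ₜ b) ≤ ‖a‖ * ‖b‖
  le_one_tmul : ∀ {A : Type u} [NonUnitalCStarAlgebra A] (a : A),
    ‖a‖ ≤ nrm (ULift.{u} ℂ) A (⟨1⟩ ⊗ₜ a)
  map_le : ∀ {A B A' B' : Type u} [NonUnitalCStarAlgebra A] [NonUnitalCStarAlgebra B]
    [NonUnitalCStarAlgebra A'] [NonUnitalCStarAlgebra B'] (f : A →⋆ₙₐ[ℂ] A') (g : B →⋆ₙₐ[ℂ] B')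
    (x : A ⊗[ℂ] B), nrm A' B' (algMap f g x) ≤ nrm A B x
  comm_le : ∀ {A B : Type u} [NonUnitalCStarAlgebra A] [NonUnitalCStarAlgebra B] (x : A ⊗[ℂ] B),
    nrm B A (algComm A B x) ≤ nrm A B x

namespace CStarTensorData

variable (κ : CStarTensorData.{u})

/-- The C*-tensor product of two C*-algebras: the completion of the algebraic tensor product. -/
def Tensor (A B : Type u) [NonUnitalCStarAlgebra A] [NonUnitalCStarAlgebra B] : Type u :=
  (κ.nrm A B).Compl

variable {A B C A' B' E : Type u} [NonUnitalCStarAlgebra A] [NonUnitalCStarAlgebra B]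
  [NonUnitalCStarAlgebra C] [NonUnitalCStarAlgebra A'] [NonUnitalCStarAlgebra B']
  [NonUnitalCStarAlgebra E]

instance : NonUnitalCStarAlgebra (κ.Tensor A B) :=
  inferInstanceAs (NonUnitalCStarAlgebra (κ.nrm A B).Compl)

variable (A B) in
/-- The canonical map from the algebraic tensor product to the C*-tensor product. -/
def ι : A ⊗[ℂ] B →⋆ₙₐ[ℂ] κ.Tensor A B := (κ.nrm A B).toCompl

lemma norm_ι (x : A ⊗[ℂ] B) : ‖κ.ι A B x‖ = κ.nrm A B x := (κ.nrm A B).norm_toCompl x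

lemma denseRange_ι : DenseRange (κ.ι A B) := (κ.nrm A B).denseRange_toCompl

/-- The elementary tensors. -/
def tmul (a : A) (b : B) : κ.Tensor A B := κ.ι A B (a ⊗ₜ b)

lemma norm_tmul_le (a : A) (b : B) : ‖κ.tmul a b‖ ≤ ‖a‖ * ‖b‖ :=
  (κ.norm_ι _).trans_le (κ.tmul_le a b)

/-- The elementary tensors, as a continuous bilinear map. -/
def tmulL : A →L[ℂ] B →L[ℂ] κ.Tensor A B :=
  LinearMap.mkContinuous₂
    ((TensorProduct.mk ℂ A B).compr₂ (κ.ι A B : A ⊗[ℂ] B →ₗ[ℂ] κ.Tensor A B)) 1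
    (fun a b => by rw [one_mul]; exact κ.norm_tmul_le a b)

lemma tmulL_apply (a : A) (b : B) : κ.tmulL a b = κ.tmul a b := rfl

@[fun_prop]
lemma continuous_tmul {X : Type*} [TopologicalSpace X] {f : X → A} {g : X → B}
    (hf : Continuous f) (hg : Continuous g) : Continuous fun x => κ.tmul (f x) (g x) := by
  simp only [← tmulL_apply]
  fun_prop

lemma tmul_add_left (a a' : A) (b : B) : κ.tmul (a + a') b = κ.tmul a b + κ.tmul a' b := by
  simp [← tmulL_apply]

lemma tmul_add_right (a : A) (b b' : B) : κ.tmul a (b + b') = κ.tmul a b + κ.tmul a b' := by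
  simp [← tmulL_apply]

lemma tmul_smul_left (c : ℂ) (a : A) (b : B) : κ.tmul (c • a) b = c • κ.tmul a b := by
  simp [← tmulL_apply]

lemma tmul_smul_right (c : ℂ) (a : A) (b : B) : κ.tmul a (c • b) = c • κ.tmul a b := by
  simp [← tmulL_apply]

lemma tmul_mul (a a' : A) (b b' : B) :
    κ.tmul a b * κ.tmul a' b' = κ.tmul (a * a') (b * b') := by
  simp only [tmul, ← map_mul, Algebra.TensorProduct.tmul_mul_tmul]

lemma star_tmul (a : A) (b : B) : star (κ.tmul a b) = κ.tmul (star a) (star b) := by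
  simp only [tmul, ← map_star, TensorProduct.star_tmul]

/-- A closed additive property of elementary tensors holds for all elements. -/
lemma induction {P : κ.Tensor A B → Prop} (hc : IsClosed {x | P x})
    (hadd : ∀ x y, P x → P y → P (x + y)) (h : ∀ a b, P (κ.tmul a b)) (x : κ.Tensor A B) : P x := by
  refine κ.denseRange_ι.induction_on x hc (fun x => ?_)
  induction x with
  | zero => simpa [tmul] using h 0 0
  | tmul a b => exact h a b
  | add x y hx hy => rw [map_add]; exact hadd _ _ hx hy

lemma hom_ext {f g : κ.Tensor A B →⋆ₙₐ[ℂ] E} (h : ∀ a b, f (κ.tmul a b) = g (κ.tmul a b)) :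
    f = g := by
  ext x
  refine κ.induction (P := fun x => f x = g x)
    (isClosed_eq (starHom_continuous f) (starHom_continuous g)) (fun x y hx hy => ?_) h x
  rw [map_add, map_add, hx, hy]

lemma hom_ext₃ {f g : κ.Tensor (κ.Tensor A B) C →⋆ₙₐ[ℂ] E}
    (h : ∀ a b c, f (κ.tmul (κ.tmul a b) c) = g (κ.tmul (κ.tmul a b) c)) : f = g := by
  refine κ.hom_ext fun t c => ?_
  refine κ.induction (P := fun t => f (κ.tmul t c) = g (κ.tmul t c))
    (isClosed_eq ((starHom_continuous f).comp (by fun_prop)) ((starHom_continuous g).comp (by fun_prop)))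
    (fun x y hx hy => ?_) (fun a b => h a b c) t
  rw [tmul_add_left, map_add, map_add, hx, hy]

lemma hom_ext₄ {D : Type u} [NonUnitalCStarAlgebra D]
    {f g : κ.Tensor (κ.Tensor (κ.Tensor A B) C) D →⋆ₙₐ[ℂ] E}
    (h : ∀ a b c d, f (κ.tmul (κ.tmul (κ.tmul a b) c) d) =
      g (κ.tmul (κ.tmul (κ.tmul a b) c) d)) : f = g := by
  refine κ.hom_ext₃ fun t c d => ?_
  refine κ.induction (P := fun t => f (κ.tmul (κ.tmul t c) d) = g (κ.tmul (κ.tmul t c) d))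
    (isClosed_eq ((starHom_continuous f).comp (by fun_prop)) ((starHom_continuous g).comp (by fun_prop)))
    (fun x y hx hy => ?_) (fun a b => h a b c d) t
  rw [tmul_add_left, tmul_add_left, map_add, map_add, hx, hy]

/-- The tensor product of two `*`-homomorphisms. -/
def map (f : A →⋆ₙₐ[ℂ] A') (g : B →⋆ₙₐ[ℂ] B') : κ.Tensor A B →⋆ₙₐ[ℂ] κ.Tensor A' B' :=
  extendHom (κ.ι A B : A ⊗[ℂ] B →ₗ[ℂ] κ.Tensor A B) κ.denseRange_ι
    ((κ.ι A' B').comp (algMap f g) : A ⊗[ℂ] B →ₗ[ℂ] κ.Tensor A' B')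
    (fun x => (κ.norm_ι _).trans_le ((κ.map_le f g x).trans_eq (κ.norm_ι x).symm))
    (fun x y => ⟨x * y, map_mul (κ.ι A B) x y, map_mul ((κ.ι A' B').comp (algMap f g)) x y⟩)
    (fun x => ⟨star x, map_star (κ.ι A B) x, map_star ((κ.ι A' B').comp (algMap f g)) x⟩)

@[simp] lemma map_tmul (f : A →⋆ₙₐ[ℂ] A') (g : B →⋆ₙₐ[ℂ] B') (a : A) (b : B) :
    κ.map f g (κ.tmul a b) = κ.tmul (f a) (g b) :=
  extendHom_apply _ _ _ _ _ _ (a ⊗ₜ b)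

variable (A B) in
/-- The flip of the C*-tensor product. -/
def comm : κ.Tensor A B →⋆ₙₐ[ℂ] κ.Tensor B A :=
  extendHom (κ.ι A B : A ⊗[ℂ] B →ₗ[ℂ] κ.Tensor A B) κ.denseRange_ι
    ((κ.ι B A).comp (algComm A B) : A ⊗[ℂ] B →ₗ[ℂ] κ.Tensor B A)
    (fun x => (κ.norm_ι _).trans_le ((κ.comm_le x).trans_eq (κ.norm_ι x).symm))
    (fun x y => ⟨x * y, map_mul (κ.ι A B) x y, map_mul ((κ.ι B A).comp (algComm A B)) x y⟩)
    (fun x => ⟨star x, map_star (κ.ι A B) x, map_star ((κ.ι B A).comp (algComm A B)) x⟩)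

@[simp] lemma comm_tmul (a : A) (b : B) : κ.comm A B (κ.tmul a b) = κ.tmul b a :=
  extendHom_apply _ _ _ _ _ _ (a ⊗ₜ b)

variable (A B C) in
/-- The map from the algebraic triple tensor product, with the brackets to the left. -/
def ι₃ : (A ⊗[ℂ] B) ⊗[ℂ] C →⋆ₙₐ[ℂ] κ.Tensor (κ.Tensor A B) C :=
  (κ.ι (κ.Tensor A B) C).comp (algMap (κ.ι A B) (NonUnitalStarAlgHom.id ℂ C))

variable (A B C) in
/-- The map from the algebraic triple tensor product, with the brackets to the right. -/
def ι₃' : (A ⊗[ℂ] B) ⊗[ℂ] C →⋆ₙₐ[ℂ] κ.Tensor A (κ.Tensor B C) :=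
  ((κ.ι A (κ.Tensor B C)).comp (algMap (NonUnitalStarAlgHom.id ℂ A) (κ.ι B C))).comp
    (algAssoc A B C)

lemma ι₃_tmul (a : A) (b : B) (c : C) :
    κ.ι₃ A B C ((a ⊗ₜ b) ⊗ₜ c) = κ.tmul (κ.tmul a b) c := rfl

lemma ι₃'_tmul (a : A) (b : B) (c : C) :
    κ.ι₃' A B C ((a ⊗ₜ b) ⊗ₜ c) = κ.tmul a (κ.tmul b c) := rfl

lemma denseRange_ι₃ : DenseRange (κ.ι₃ A B C) := by
  intro x
  let S : AddSubgroup (κ.Tensor (κ.Tensor A B) C) :=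
    (AddMonoidHom.range (AddMonoidHomClass.toAddMonoidHom (κ.ι₃ A B C))).topologicalClosure
  have hS : IsClosed (S : Set (κ.Tensor (κ.Tensor A B) C)) :=
    AddSubgroup.isClosed_topologicalClosure _
  have hx : x ∈ S := by
    refine κ.induction (P := fun x => x ∈ S) hS (fun x y hx hy => S.add_mem hx hy)
      (fun t c => ?_) x
    refine κ.induction (P := fun t => κ.tmul t c ∈ S) (hS.preimage (by fun_prop))
      (fun x y hx hy => ?_) (fun a b => ?_) t
    · rw [tmul_add_left]; exact S.add_mem hx hy
    · exact AddSubgroup.le_topologicalClosure _ ⟨(a ⊗ₜ b) ⊗ₜ c, rfl⟩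
  exact hx

end CStarTensorData

/-- An associative C*-tensor product: the associativity isomorphism of the algebraic tensor
products is contractive for the C*-seminorms. The standard examples are the maximal C*-tensor
product (constructed below as `maxTensor`) and the minimal one. -/
structure CStarTensor extends CStarTensorData.{u} where
  assoc_le : ∀ {A B C : Type u} [NonUnitalCStarAlgebra A] [NonUnitalCStarAlgebra B]
    [NonUnitalCStarAlgebra C] (x : (A ⊗[ℂ] B) ⊗[ℂ] C),
    ‖toCStarTensorData.ι₃' A B C x‖ ≤ ‖toCStarTensorData.ι₃ A B C x‖

namespace CStarTensor

variable (κ : CStarTensor.{u})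

variable {A B C A' B' E : Type u} [NonUnitalCStarAlgebra A] [NonUnitalCStarAlgebra B]
  [NonUnitalCStarAlgebra C] [NonUnitalCStarAlgebra A'] [NonUnitalCStarAlgebra B']
  [NonUnitalCStarAlgebra E]

variable (A B C) in
/-- The map `ι₃` as a linear map. -/
def ι₃L : (A ⊗[ℂ] B) ⊗[ℂ] C →ₗ[ℂ] κ.Tensor (κ.Tensor A B) C where
  toFun := κ.ι₃ A B C
  map_add' := map_add (κ.ι₃ A B C)
  map_smul' := map_smul (κ.ι₃ A B C)

variable (A B C) in
/-- The map `ι₃'` as a linear map. -/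
def ι₃L' : (A ⊗[ℂ] B) ⊗[ℂ] C →ₗ[ℂ] κ.Tensor A (κ.Tensor B C) where
  toFun := κ.ι₃' A B C
  map_add' := map_add (κ.ι₃' A B C)
  map_smul' := map_smul (κ.ι₃' A B C)

variable (A B C) in
/-- The associativity isomorphism of the C*-tensor product. -/
def assoc : κ.Tensor (κ.Tensor A B) C →⋆ₙₐ[ℂ] κ.Tensor A (κ.Tensor B C) :=
  extendHom (κ.ι₃L A B C) κ.denseRange_ι₃ (κ.ι₃L' A B C) κ.assoc_le
    (fun x y => ⟨x * y, map_mul (κ.ι₃ A B C) x y, map_mul (κ.ι₃' A B C) x y⟩)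
    (fun x => ⟨star x, map_star (κ.ι₃ A B C) x, map_star (κ.ι₃' A B C) x⟩)

@[simp] lemma assoc_tmul (a : A) (b : B) (c : C) :
    κ.assoc A B C (κ.tmul (κ.tmul a b) c) = κ.tmul a (κ.tmul b c) :=
  extendHom_apply (κ.ι₃L A B C) _ _ _ _ _ ((a ⊗ₜ b) ⊗ₜ c)

variable (A B C) in
/-- The inverse associativity isomorphism of the C*-tensor product. -/
def assocInv : κ.Tensor A (κ.Tensor B C) →⋆ₙₐ[ℂ] κ.Tensor (κ.Tensor A B) C :=
  ((κ.comm C (κ.Tensor A B)).comp (κ.map (.id ℂ C) (κ.comm B A))).comp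
    ((κ.assoc C B A).comp ((κ.map (κ.comm B C) (.id ℂ A)).comp (κ.comm A (κ.Tensor B C))))

@[simp] lemma assocInv_tmul (a : A) (b : B) (c : C) :
    κ.assocInv A B C (κ.tmul a (κ.tmul b c)) = κ.tmul (κ.tmul a b) c := by
  simp [assocInv]

variable (A) in
/-- The left unit isomorphism of the algebraic tensor product. -/
def algLid : (ULift.{u} ℂ) ⊗[ℂ] A →⋆ₙₐ[ℂ] A :=
  let φ : (ULift.{u} ℂ) ⊗[ℂ] A →ₗ[ℂ] A := TensorProduct.lift
    ((LinearMap.lsmul ℂ A).comp (ULift.moduleEquiv (R := ℂ) (M := ℂ)).toLinearMap)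
  { toFun := φ
    map_smul' := φ.map_smul
    map_zero' := φ.map_zero
    map_add' := φ.map_add
    map_mul' := mul_map_of_tmul φ φ φ (fun c a c' a' => by
      simp [φ, smul_mul_smul_comm])
    map_star' := star_map_of_tmul φ (fun c a => by simp [φ]; rfl) }

lemma norm_algLid_le (x : (ULift.{u} ℂ) ⊗[ℂ] A) : ‖algLid A x‖ ≤ ‖κ.ι (ULift.{u} ℂ) A x‖ := by
  have hx : ∃ a : A, x = ⟨1⟩ ⊗ₜ a := by
    induction x with
    | zero => exact ⟨0, by simp⟩
    | tmul c a =>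
      refine ⟨c.down • a, ?_⟩
      rw [← TensorProduct.smul_tmul]
      congr 1
      ext1
      simp
    | add x y hx hy =>
      obtain ⟨a, rfl⟩ := hx
      obtain ⟨b, rfl⟩ := hy
      exact ⟨a + b, (TensorProduct.tmul_add _ _ _).symm⟩
  obtain ⟨a, rfl⟩ := hx
  have h : algLid A (⟨1⟩ ⊗ₜ a) = a := one_smul ℂ a
  rw [h]
  exact (κ.le_one_tmul a).trans_eq (κ.norm_ι _).symm

variable (A) in
/-- The left unit isomorphism of the C*-tensor product. -/
def lid : κ.Tensor (ULift.{u} ℂ) A →⋆ₙₐ[ℂ] A :=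
  extendHom (κ.ι (ULift.{u} ℂ) A : (ULift.{u} ℂ) ⊗[ℂ] A →ₗ[ℂ] κ.Tensor (ULift.{u} ℂ) A)
    κ.denseRange_ι (algLid A : (ULift.{u} ℂ) ⊗[ℂ] A →ₗ[ℂ] A) κ.norm_algLid_le
    (fun x y => ⟨x * y, map_mul (κ.ι (ULift.{u} ℂ) A) x y, map_mul (algLid A) x y⟩)
    (fun x => ⟨star x, map_star (κ.ι (ULift.{u} ℂ) A) x, map_star (algLid A) x⟩)

@[simp] lemma lid_tmul (c : ULift.{u} ℂ) (a : A) : κ.lid A (κ.tmul c a) = c.down • a :=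
  extendHom_apply _ _ _ _ _ _ (c ⊗ₜ a)

variable (A) in
/-- The inverse of the left unit isomorphism. -/
def lidInv : A →⋆ₙₐ[ℂ] κ.Tensor (ULift.{u} ℂ) A where
  toFun a := κ.tmul ⟨1⟩ a
  map_smul' c a := κ.tmul_smul_right c _ a
  map_zero' := by simpa using κ.tmul_smul_right 0 (⟨1⟩ : ULift.{u} ℂ) (0 : A)
  map_add' := κ.tmul_add_right _
  map_mul' a b := by
    rw [κ.tmul_mul]; congr 1; ext1; simp
  map_star' a := by
    rw [κ.star_tmul]; congr 1; ext1; exact (star_one ℂ).symm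

@[simp] lemma lidInv_apply (a : A) : κ.lidInv A a = κ.tmul ⟨1⟩ a := rfl

end CStarTensor

/-! ### The maximal C*-tensor product -/

namespace MaxTensor

variable {A B C : Type u} [NonUnitalCStarAlgebra A] [NonUnitalCStarAlgebra B]
  [NonUnitalCStarAlgebra C]

/-- The C*-seminorms with `p (a ⊗ b) ≤ ‖a‖ ‖b‖`. -/
def Sub (A B : Type u) [NonUnitalCStarAlgebra A] [NonUnitalCStarAlgebra B] : Type u :=
  {p : CStarSeminorm (A ⊗[ℂ] B) // ∀ a b, p (a ⊗ₜ b) ≤ ‖a‖ * ‖b‖}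

/-- The zero seminorm. -/
def zeroSub : Sub A B :=
  ⟨{ (0 : Seminorm ℂ (A ⊗[ℂ] B)) with
      mul_le' := fun x y => (zero_mul (0 : ℝ)).ge
      star_mul_self' := fun x => (zero_mul (0 : ℝ)).le }, fun a b => by
        change (0 : ℝ) ≤ _
        positivity⟩

instance : Nonempty (Sub A B) := ⟨zeroSub⟩

lemma bdd (x : A ⊗[ℂ] B) : BddAbove (Set.range fun p : Sub A B => p.1 x) := by
  induction x with
  | zero =>
    refine ⟨0, ?_⟩
    rintro _ ⟨p, rfl⟩
    exact p.1.zero_eq.le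
  | tmul a b =>
    refine ⟨‖a‖ * ‖b‖, ?_⟩
    rintro _ ⟨p, rfl⟩
    exact p.2 a b
  | add x y hx hy =>
    obtain ⟨M, hM⟩ := hx
    obtain ⟨N, hN⟩ := hy
    refine ⟨M + N, ?_⟩
    rintro _ ⟨p, rfl⟩
    exact (p.1.add_le x y).trans (add_le_add (hM ⟨p, rfl⟩) (hN ⟨p, rfl⟩))

/-- The supremum of all these C*-seminorms. -/
def sup (x : A ⊗[ℂ] B) : ℝ := ⨆ p : Sub A B, p.1 x

lemma le_sup (p : Sub A B) (x : A ⊗[ℂ] B) : p.1 x ≤ sup x := le_ciSup (bdd x) p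

lemma sup_le {x : A ⊗[ℂ] B} {c : ℝ} (h : ∀ p : Sub A B, p.1 x ≤ c) : sup x ≤ c := ciSup_le h

lemma sup_nonneg (x : A ⊗[ℂ] B) : 0 ≤ sup x := (zeroSub.1.nonneg x).trans (le_sup zeroSub x)

variable (A B) in
/-- The maximal C*-norm. -/
def nrm : CStarSeminorm (A ⊗[ℂ] B) where
  toFun := sup
  map_zero' := le_antisymm (sup_le fun p => p.1.zero_eq.le) (sup_nonneg 0)
  add_le' x y := sup_le fun p => (p.1.add_le x y).trans (add_le_add (le_sup p x) (le_sup p y))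
  neg' x := by
    simp only [sup]
    congr 1
    funext p
    exact p.1.neg_eq x
  smul' c x := by
    simp only [sup]
    rw [Real.mul_iSup_of_nonneg (norm_nonneg c)]
    congr 1
    funext p
    exact p.1.smul_eq c x
  mul_le' x y := sup_le fun p => (p.1.mul_le x y).trans
    (mul_le_mul (le_sup p x) (le_sup p y) (p.1.nonneg y) (sup_nonneg x))
  star_mul_self' x := by
    have h : sup x ≤ √(sup (star x * x)) := sup_le fun p => by
      refine Real.le_sqrt_of_sq_le ?_
      rw [sq]
      exact (p.1.star_mul_self' x).trans (le_sup p _)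
    calc sup x * sup x ≤ √(sup (star x * x)) * √(sup (star x * x)) :=
          mul_self_le_mul_self (sup_nonneg x) h
      _ = sup (star x * x) := Real.mul_self_sqrt (sup_nonneg _)

/-- The norm of a C*-algebra, pulled back along a `*`-homomorphism. -/
def comap {R E : Type u} [NonUnitalRing R] [StarRing R] [Module ℂ R] [NonUnitalCStarAlgebra E]
    (f : R →⋆ₙₐ[ℂ] E) : CStarSeminorm R where
  toFun x := ‖f x‖
  map_zero' := by simp
  add_le' x y := by rw [map_add]; exact norm_add_le _ _
  neg' x := by rw [map_neg, norm_neg]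
  smul' c x := by rw [map_smul, norm_smul]
  mul_le' x y := by rw [map_mul]; exact norm_mul_le _ _
  star_mul_self' x := by rw [map_mul, map_star, CStarRing.norm_star_mul_self]

lemma norm_le_sup {E : Type u} [NonUnitalCStarAlgebra E] (f : A ⊗[ℂ] B →⋆ₙₐ[ℂ] E)
    (h : ∀ a b, ‖f (a ⊗ₜ b)‖ ≤ ‖a‖ * ‖b‖) (x : A ⊗[ℂ] B) : ‖f x‖ ≤ nrm A B x :=
  le_sup ⟨comap f, h⟩ x

/-- The left unit isomorphism of the algebraic tensor product. -/
def algLid' (A : Type u) [NonUnitalCStarAlgebra A] : (ULift.{u} ℂ) ⊗[ℂ] A →⋆ₙₐ[ℂ] A :=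
  let φ : (ULift.{u} ℂ) ⊗[ℂ] A →ₗ[ℂ] A := TensorProduct.lift
    ((LinearMap.lsmul ℂ A).comp (ULift.moduleEquiv (R := ℂ) (M := ℂ)).toLinearMap)
  { toFun := φ
    map_smul' := φ.map_smul
    map_zero' := φ.map_zero
    map_add' := φ.map_add
    map_mul' := mul_map_of_tmul φ φ φ (fun c a c' a' => by
      simp [φ, smul_mul_smul_comm])
    map_star' := star_map_of_tmul φ (fun c a => by simp [φ]; rfl) }

lemma algLid'_tmul (c : ULift.{u} ℂ) (a : A) : algLid' A (c ⊗ₜ a) = c.down • a := rfl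

lemma nrm_tmul_le (a : A) (b : B) : nrm A B (a ⊗ₜ b) ≤ ‖a‖ * ‖b‖ := sup_le fun p => p.2 a b

/-- The maximal tensor product. -/
def data : CStarTensorData.{u} where
  nrm A B := nrm A B
  tmul_le := nrm_tmul_le
  le_one_tmul {A} _ a := by
    have := norm_le_sup (algLid' A) (fun c a => by
      rw [algLid'_tmul, norm_smul]; exact le_rfl) (⟨1⟩ ⊗ₜ a)
    rwa [algLid'_tmul, one_smul] at this
  map_le {A B A' B'} _ _ _ _ f g x := by
    refine (norm_le_sup ((nrm A' B').toCompl.comp (algMap f g)) (fun a b => ?_) x).trans' ?_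
    · refine ((nrm A' B').norm_toCompl (f a ⊗ₜ g b)).trans_le ((nrm_tmul_le _ _).trans ?_)
      exact mul_le_mul (NonUnitalStarAlgHom.norm_apply_le f a)
        (NonUnitalStarAlgHom.norm_apply_le g b) (norm_nonneg _) (norm_nonneg _)
    · exact ((nrm A' B').norm_toCompl (algMap f g x)).ge
  comm_le {A B} _ _ x := by
    refine (norm_le_sup ((nrm B A).toCompl.comp (algComm A B)) (fun a b => ?_) x).trans' ?_
    · refine ((nrm B A).norm_toCompl (b ⊗ₜ a)).trans_le ((nrm_tmul_le _ _).trans ?_)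
      rw [mul_comm]
    · exact ((nrm B A).norm_toCompl (algComm A B x)).ge

lemma exists_approxUnit (C : Type u) [NonUnitalCStarAlgebra C] : ∃ l : Filter C, l.NeBot ∧
    (∀ᶠ x in l, ‖x‖ ≤ 1) ∧ ∀ c : C, Filter.Tendsto (· * c) l (nhds c) := by
  let _ := CStarAlgebra.spectralOrder C
  have _ := CStarAlgebra.spectralOrderedRing C
  have h := CStarAlgebra.increasingApproximateUnit C
  exact ⟨_, h.neBot, h.eventually_norm, h.tendsto_mul_right⟩

section Assoc

variable {E : Type u} [NonUnitalCStarAlgebra E]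

/-- The bound on elementary tensors for a `*`-homomorphism on a triple tensor product. -/
def Cross (Φ : (A ⊗[ℂ] B) ⊗[ℂ] C →⋆ₙₐ[ℂ] E) : Prop :=
  ∀ a b c, ‖Φ ((a ⊗ₜ b) ⊗ₜ c)‖ ≤ ‖a‖ * ‖b‖ * ‖c‖

variable (Φ : (A ⊗[ℂ] B) ⊗[ℂ] C →⋆ₙₐ[ℂ] E)

/-- `t ⊗ c`, for `t` in the algebraic tensor product. -/
def tc (Φ : (A ⊗[ℂ] B) ⊗[ℂ] C →⋆ₙₐ[ℂ] E) (t : A ⊗[ℂ] B) (c : C) : E := Φ (t ⊗ₜ c)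

lemma tc_add (t t' : A ⊗[ℂ] B) (c : C) : tc Φ (t + t') c = tc Φ t c + tc Φ t' c := by
  rw [tc, TensorProduct.add_tmul]; exact map_add Φ _ _

lemma tc_add' (t : A ⊗[ℂ] B) (c c' : C) : tc Φ t (c + c') = tc Φ t c + tc Φ t c' := by
  rw [tc, TensorProduct.tmul_add]; exact map_add Φ _ _

lemma tc_smul (r : ℂ) (t : A ⊗[ℂ] B) (c : C) : tc Φ (r • t) c = r • tc Φ t c :=
  map_smul Φ r (t ⊗ₜ c)

lemma tc_smul' (r : ℂ) (t : A ⊗[ℂ] B) (c : C) : tc Φ t (r • c) = r • tc Φ t c := by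
  rw [tc, TensorProduct.tmul_smul]; exact map_smul Φ r _

lemma tc_mul (t t' : A ⊗[ℂ] B) (c c' : C) : tc Φ t c * tc Φ t' c' = tc Φ (t * t') (c * c') :=
  ((map_mul Φ (t ⊗ₜ c) (t' ⊗ₜ c')).symm).trans
    (congrArg Φ (Algebra.TensorProduct.tmul_mul_tmul t t' c c'))

lemma tc_star (t : A ⊗[ℂ] B) (c : C) : star (tc Φ t c) = tc Φ (star t) (star c) :=
  (map_star Φ (t ⊗ₜ c)).symm

lemma tc_bound (hΦ : Cross Φ) (t : A ⊗[ℂ] B) : ∃ M : ℝ, ∀ c, ‖tc Φ t c‖ ≤ M * ‖c‖ := by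
  induction t with
  | zero => exact ⟨0, fun c => by
      have := tc_smul Φ 0 (0 : A ⊗[ℂ] B) c
      rw [zero_smul, zero_smul] at this
      rw [this]; simp⟩
  | tmul a b => exact ⟨‖a‖ * ‖b‖, fun c => hΦ a b c⟩
  | add x y hx hy =>
    obtain ⟨M, hM⟩ := hx
    obtain ⟨N, hN⟩ := hy
    refine ⟨M + N, fun c => ?_⟩
    rw [tc_add, add_mul]
    exact (norm_add_le _ _).trans (add_le_add (hM c) (hN c))

/-- The supremum of `‖Φ (t ⊗ c)‖` over the unit ball. -/
def q (Φ : (A ⊗[ℂ] B) ⊗[ℂ] C →⋆ₙₐ[ℂ] E) (t : A ⊗[ℂ] B) : ℝ :=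
  ⨆ c : {c : C // ‖c‖ ≤ 1}, ‖tc Φ t c.1‖

instance : Nonempty {c : C // ‖c‖ ≤ 1} := ⟨⟨0, by simp⟩⟩

lemma le_q (hΦ : Cross Φ) (t : A ⊗[ℂ] B) {c : C} (hc : ‖c‖ ≤ 1) : ‖tc Φ t c‖ ≤ q Φ t := by
  obtain ⟨M, hM⟩ := tc_bound Φ hΦ t
  refine le_ciSup (f := fun c : {c : C // ‖c‖ ≤ 1} => ‖tc Φ t c.1‖) ⟨|M|, ?_⟩ ⟨c, hc⟩
  rintro _ ⟨c, rfl⟩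
  refine (hM c).trans ((le_abs_self _).trans ?_)
  rw [abs_mul, abs_norm]
  exact mul_le_of_le_one_right (abs_nonneg M) c.2

lemma q_le {t : A ⊗[ℂ] B} {r : ℝ} (h : ∀ c : C, ‖c‖ ≤ 1 → ‖tc Φ t c‖ ≤ r) : q Φ t ≤ r :=
  ciSup_le fun c => h c.1 c.2

lemma q_nonneg (t : A ⊗[ℂ] B) : 0 ≤ q Φ t := Real.iSup_nonneg fun _ => norm_nonneg _

lemma tc_continuous (hΦ : Cross Φ) (t : A ⊗[ℂ] B) : Continuous (tc Φ t) := by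
  obtain ⟨M, hM⟩ := tc_bound Φ hΦ t
  let L : C →ₗ[ℂ] E := ⟨⟨tc Φ t, tc_add' Φ t⟩, fun r c => tc_smul' Φ r t c⟩
  exact AddMonoidHomClass.continuous_of_bound L M hM

/-- The C*-seminorm `q`. -/
def qSemi (hΦ : Cross Φ) : CStarSeminorm (A ⊗[ℂ] B) where
  toFun := q Φ
  map_zero' := by
    refine le_antisymm (q_le Φ fun c _ => ?_) (q_nonneg Φ _)
    have := tc_smul Φ 0 (0 : A ⊗[ℂ] B) c
    rw [zero_smul, zero_smul] at this
    rw [this]; simp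
  add_le' x y := q_le Φ fun c hc => by
    rw [tc_add]
    exact (norm_add_le _ _).trans (add_le_add (le_q Φ hΦ x hc) (le_q Φ hΦ y hc))
  neg' x := by
    simp only [q]
    congr 1
    funext c
    have := tc_smul Φ (-1) x c.1
    rw [neg_one_smul, neg_one_smul] at this
    rw [this, norm_neg]
  smul' r x := by
    simp only [q]
    rw [Real.mul_iSup_of_nonneg (norm_nonneg r)]
    congr 1
    funext c
    rw [tc_smul, norm_smul]
  mul_le' x y := q_le Φ fun c hc => by
    obtain ⟨l, hl, hb, ht⟩ := exists_approxUnit C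
    have h1 := ((tc_continuous Φ hΦ (x * y)).tendsto c).comp (ht c)
    refine le_of_tendsto h1.norm ?_
    filter_upwards [hb] with e he
    change ‖tc Φ (x * y) (e * c)‖ ≤ _
    rw [← tc_mul]
    exact (norm_mul_le _ _).trans (mul_le_mul (le_q Φ hΦ x he) (le_q Φ hΦ y hc) (norm_nonneg _)
      (q_nonneg Φ x))
  star_mul_self' x := by
    have h : q Φ x ≤ √(q Φ (star x * x)) := q_le Φ fun c hc => by
      refine Real.le_sqrt_of_sq_le ?_
      rw [sq, ← CStarRing.norm_star_mul_self, tc_star, tc_mul]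
      refine le_q Φ hΦ _ ?_
      rw [CStarRing.norm_star_mul_self]
      exact mul_le_one₀ hc (norm_nonneg _) hc
    calc q Φ x * q Φ x ≤ √(q Φ (star x * x)) * √(q Φ (star x * x)) :=
          mul_self_le_mul_self (q_nonneg Φ x) h
      _ = q Φ (star x * x) := Real.mul_self_sqrt (q_nonneg Φ _)

lemma norm_tc_le (hΦ : Cross Φ) (t : A ⊗[ℂ] B) (c : C) : ‖tc Φ t c‖ ≤ ‖c‖ * nrm A B t := by
  have hq : q Φ t ≤ nrm A B t := le_sup ⟨qSemi Φ hΦ, fun a b => q_le Φ fun c hc => by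
    refine (hΦ a b c).trans (mul_le_of_le_one_right (by positivity) hc)⟩ t
  rcases eq_or_ne c 0 with rfl | hc
  · have := tc_smul' Φ 0 t (0 : C)
    rw [zero_smul, zero_smul] at this
    rw [this]; simp
  · have h0 : ‖c‖ ≠ 0 := norm_ne_zero_iff.2 hc
    have h1 : c = (‖c‖ : ℂ) • ((‖c‖⁻¹ : ℂ) • c) := by
      rw [smul_smul, mul_inv_cancel₀ (by exact_mod_cast h0), one_smul]
    rw [h1, tc_smul', norm_smul, ← h1]
    simp only [Complex.norm_real, norm_norm]
    refine mul_le_mul_of_nonneg_left ((le_q Φ hΦ t ?_).trans hq) (norm_nonneg _)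
    rw [norm_smul]
    simp [h0]

/-- `t ↦ Φ (t ⊗ c)`, extended to the maximal tensor product of `A` and `B`. -/
def ext (Φ : (A ⊗[ℂ] B) ⊗[ℂ] C →⋆ₙₐ[ℂ] E) (c : C) : data.Tensor A B →L[ℂ] E :=
  LinearMap.extendOfNorm (⟨⟨fun t => tc Φ t c, fun t t' => tc_add Φ t t' c⟩,
    fun r t => tc_smul Φ r t c⟩ : A ⊗[ℂ] B →ₗ[ℂ] E)
    (data.ι A B : A ⊗[ℂ] B →ₗ[ℂ] data.Tensor A B)

lemma ext_ι (hΦ : Cross Φ) (c : C) (t : A ⊗[ℂ] B) : ext Φ c (data.ι A B t) = tc Φ t c :=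
  LinearMap.extendOfNorm_eq (e := (data.ι A B : A ⊗[ℂ] B →ₗ[ℂ] data.Tensor A B))
    data.denseRange_ι ⟨‖c‖, fun t => (norm_tc_le Φ hΦ t c).trans_eq
      (congrArg (‖c‖ * ·) (data.norm_ι t).symm)⟩ t

lemma norm_ext_le (hΦ : Cross Φ) (c : C) (t : data.Tensor A B) : ‖ext Φ c t‖ ≤ ‖t‖ * ‖c‖ := by
  refine data.denseRange_ι.induction_on (p := fun t => ‖ext Φ c t‖ ≤ ‖t‖ * ‖c‖) t
    (isClosed_le (by fun_prop) (by fun_prop)) fun t => ?_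
  rw [ext_ι Φ hΦ, mul_comm]
  exact (norm_tc_le Φ hΦ t c).trans_eq (congrArg (‖c‖ * ·) (data.norm_ι t).symm)

/-- `Φ`, extended to the algebraic tensor product of the maximal tensor product and `C`. -/
def extL (hΦ : Cross Φ) :
    data.Tensor A B ⊗[ℂ] C →ₗ[ℂ] E :=
  TensorProduct.lift (LinearMap.mk₂ ℂ (fun t c => ext Φ c t)
    (fun t t' c => map_add _ t t') (fun r t c => map_smul _ r t)
    (fun t c c' => by
      refine data.denseRange_ι.induction_on (p := fun t => ext Φ (c + c') t =
        ext Φ c t + ext Φ c' t) t (isClosed_eq (by fun_prop) (by fun_prop)) fun t => ?_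
      rw [ext_ι Φ hΦ, ext_ι Φ hΦ, ext_ι Φ hΦ, tc_add'])
    (fun r t c => by
      refine data.denseRange_ι.induction_on (p := fun t => ext Φ (r • c) t =
        r • ext Φ c t) t (isClosed_eq (by fun_prop) (by fun_prop)) fun t => ?_
      rw [ext_ι Φ hΦ, ext_ι Φ hΦ, tc_smul']))

/-- `extL` as a `*`-homomorphism. -/
def extHom (hΦ : Cross Φ) :
    data.Tensor A B ⊗[ℂ] C →⋆ₙₐ[ℂ] E where
  toFun := extL Φ hΦ
  map_smul' := (extL Φ hΦ).map_smul
  map_zero' := (extL Φ hΦ).map_zero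
  map_add' := (extL Φ hΦ).map_add
  map_mul' := mul_map_of_tmul _ _ _ fun t c t' c' => by
    change ext Φ (c * c') (t * t') = ext Φ c t * ext Φ c' t'
    refine data.denseRange_ι.induction_on₂ (p := fun t t' => ext Φ (c * c') (t * t') =
      ext Φ c t * ext Φ c' t') (isClosed_eq (by fun_prop) (by fun_prop)) (fun t t' => ?_) t t'
    rw [← map_mul, ext_ι Φ hΦ, ext_ι Φ hΦ, ext_ι Φ hΦ, tc_mul]
  map_star' := star_map_of_tmul _ fun t c => by
    change ext Φ (star c) (star t) = star (ext Φ c t)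
    refine data.denseRange_ι.induction_on (p := fun t => ext Φ (star c) (star t) =
      star (ext Φ c t)) t (isClosed_eq (by fun_prop) (by fun_prop)) (fun t => ?_)
    rw [← map_star, ext_ι Φ hΦ, ext_ι Φ hΦ, tc_star]

end Assoc

end MaxTensor

/-- The maximal C*-tensor product: the norm is the supremum of all C*-seminorms `p` on the
algebraic tensor product with `p (a ⊗ b) ≤ ‖a‖ ‖b‖`. -/
def maxTensor : CStarTensor.{u} where
  toCStarTensorData := MaxTensor.data
  assoc_le {A B C} _ _ _ x := by
    let κ := MaxTensor.data.{u}
    have hΦ (a : A) (b : B) (c : C) :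
        ‖κ.ι₃' A B C ((a ⊗ₜ b) ⊗ₜ c)‖ ≤ ‖a‖ * ‖b‖ * ‖c‖ := by
      rw [CStarTensorData.ι₃'_tmul, mul_assoc]
      exact (κ.norm_tmul_le _ _).trans
        (mul_le_mul_of_nonneg_left (κ.norm_tmul_le _ _) (norm_nonneg _))
    have h1 := MaxTensor.norm_le_sup (MaxTensor.extHom (κ.ι₃' A B C) hΦ)
      (fun t c => MaxTensor.norm_ext_le _ hΦ c t) (algMap (κ.ι A B) (NonUnitalStarAlgHom.id ℂ C) x)
    let f := algMap (κ.ι A B) (NonUnitalStarAlgHom.id ℂ C)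
    let g := MaxTensor.extHom (κ.ι₃' A B C) hΦ
    let L : (A ⊗[ℂ] B) ⊗[ℂ] C →ₗ[ℂ] κ.Tensor A (κ.Tensor B C) :=
      ⟨⟨fun x => g (f x), fun x y => (congrArg g (map_add f x y)).trans (map_add g _ _)⟩,
        fun r x => (congrArg g (map_smul f r x)).trans (map_smul g r _)⟩
    let L' : (A ⊗[ℂ] B) ⊗[ℂ] C →ₗ[ℂ] κ.Tensor A (κ.Tensor B C) :=
      ⟨⟨κ.ι₃' A B C, map_add (κ.ι₃' A B C)⟩, map_smul (κ.ι₃' A B C)⟩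
    have h2 : L = L' := TensorProduct.ext' fun t c => MaxTensor.ext_ι (κ.ι₃' A B C) hΦ c t
    have h3 : g (f x) = κ.ι₃' A B C x := LinearMap.congr_fun h2 x
    exact ((congrArg norm h3).symm.trans_le h1).trans_eq (κ.norm_ι _).symm

/-! ### The symmetric monoidal category of C*-algebras -/

/-- The category of (not necessarily unital) C*-algebras and `*`-homomorphisms; the C*-tensor
product `κ` serves as the monoidal structure. -/
structure CStarAlg (_κ : CStarTensor.{u}) where
  carrier : Type u
  [inst : NonUnitalCStarAlgebra carrier]

namespace CStarAlg

variable {κ : CStarTensor.{u}}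

instance : CoeSort (CStarAlg κ) (Type u) := ⟨CStarAlg.carrier⟩

instance (A : CStarAlg κ) : NonUnitalCStarAlgebra A := A.inst

/-- Morphisms of C*-algebras. -/
@[ext] structure Hom (A B : CStarAlg κ) where
  hom : A →⋆ₙₐ[ℂ] B

instance : Category (CStarAlg κ) where
  Hom A B := Hom A B
  id A := ⟨.id ℂ A⟩
  comp f g := ⟨g.hom.comp f.hom⟩

instance (A B : CStarAlg κ) : FunLike (A ⟶ B) A B where
  coe f := f.hom
  coe_injective f g h := Hom.ext (DFunLike.coe_injective h)

lemma hom_apply {A B : CStarAlg κ} (f : A ⟶ B) (a : A) : f a = f.hom a := rfl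

@[simp] lemma id_apply {A : CStarAlg κ} (a : A) : (𝟙 A : A ⟶ A) a = a := rfl
@[simp] lemma comp_apply {A B C : CStarAlg κ} (f : A ⟶ B) (g : B ⟶ C) (a : A) :
    (f ≫ g) a = g (f a) := rfl

@[ext] lemma hom_ext' {A B : CStarAlg κ} {f g : A ⟶ B} (h : ∀ a, f a = g a) : f = g :=
  DFunLike.ext _ _ h

/-- The tensor product of C*-algebras. -/
def tens (A B : CStarAlg κ) : CStarAlg κ := ⟨κ.Tensor A B⟩

/-- The complex numbers. -/
def unit : CStarAlg κ := ⟨ULift.{u} ℂ⟩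

/-- The complex number underlying an element of `unit`. -/
def uscal (c : (unit : CStarAlg κ)) : ℂ := ULift.down.{u} c

/-- The unit of the complex numbers, as an element of `unit`. -/
def uone' : (unit : CStarAlg κ) := (⟨1⟩ : ULift.{u} ℂ)

/-- The elementary tensors. -/
def tm {A B : CStarAlg κ} (a : A) (b : B) : tens A B := κ.tmul a b

/-- The tensor product of morphisms. -/
def tensHom {A B A' B' : CStarAlg κ} (f : A ⟶ A') (g : B ⟶ B') : tens A B ⟶ tens A' B' :=
  ⟨κ.map f.hom g.hom⟩

/-- The flip. -/
def flip (A B : CStarAlg κ) : tens A B ⟶ tens B A := ⟨κ.comm A B⟩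

/-- The associativity morphism. -/
def assocHom (A B C : CStarAlg κ) : tens (tens A B) C ⟶ tens A (tens B C) := ⟨κ.assoc A B C⟩
/-- The inverse associativity morphism. -/
def assocInv (A B C : CStarAlg κ) : tens A (tens B C) ⟶ tens (tens A B) C := ⟨κ.assocInv A B C⟩
/-- The left unit morphism. -/
def lidHom (A : CStarAlg κ) : tens unit A ⟶ A := ⟨κ.lid A⟩
/-- The inverse left unit morphism. -/
def lidInv (A : CStarAlg κ) : A ⟶ tens unit A := ⟨κ.lidInv A⟩

@[simp] lemma tensHom_tm {A B A' B' : CStarAlg κ} (f : A ⟶ A') (g : B ⟶ B') (a : A) (b : B) :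
    tensHom f g (tm a b) = tm (f a) (g b) := κ.map_tmul _ _ _ _
@[simp] lemma flip_tm {A B : CStarAlg κ} (a : A) (b : B) : flip A B (tm a b) = tm b a :=
  κ.comm_tmul _ _
@[simp] lemma assocHom_tm {A B C : CStarAlg κ} (a : A) (b : B) (c : C) :
    assocHom A B C (tm (tm a b) c) = tm a (tm b c) := κ.assoc_tmul _ _ _
@[simp] lemma assocInv_tm {A B C : CStarAlg κ} (a : A) (b : B) (c : C) :
    assocInv A B C (tm a (tm b c)) = tm (tm a b) c := κ.assocInv_tmul _ _ _
@[simp] lemma lidHom_tm {A : CStarAlg κ} (c : (unit : CStarAlg κ)) (a : A) :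
    lidHom A (tm c a) = uscal c • a := κ.lid_tmul _ _
@[simp] lemma lidInv_apply {A : CStarAlg κ} (a : A) :
    lidInv A a = tm uone' a := rfl

lemma tens_ext {A B C : CStarAlg κ} {f g : tens A B ⟶ C} (h : ∀ a b, f (tm a b) = g (tm a b)) :
    f = g :=
  Hom.ext (κ.hom_ext h)

lemma tens_ext₃ {A B C D : CStarAlg κ} {f g : tens (tens A B) C ⟶ D}
    (h : ∀ a b c, f (tm (tm a b) c) = g (tm (tm a b) c)) : f = g :=
  Hom.ext (κ.hom_ext₃ h)

lemma tens_ext₄ {A B C D E : CStarAlg κ} {f g : tens (tens (tens A B) C) D ⟶ E}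
    (h : ∀ a b c d, f (tm (tm (tm a b) c) d) = g (tm (tm (tm a b) c) d)) : f = g :=
  Hom.ext (κ.hom_ext₄ h)

lemma assoc_inv_hom (A B C : CStarAlg κ) : assocHom A B C ≫ assocInv A B C = 𝟙 _ :=
  tens_ext₃ fun a b c => by simp

lemma flip_flip (A B : CStarAlg κ) : flip A B ≫ flip B A = 𝟙 _ :=
  tens_ext fun a b => by simp

lemma flip_nat {A B A' B' : CStarAlg κ} (f : A ⟶ A') (g : B ⟶ B') :
    tensHom f g ≫ flip A' B' = flip A B ≫ tensHom g f :=
  tens_ext fun a b => by simp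

lemma flip_epi {A B C : CStarAlg κ} {f g : tens A B ⟶ C}
    (h : flip B A ≫ f = flip B A ≫ g) : f = g := by
  rw [← Category.id_comp f, ← flip_flip, Category.assoc, h, ← Category.assoc, flip_flip,
    Category.id_comp]

lemma tens_ext₃' {A B C D : CStarAlg κ} {f g : tens A (tens B C) ⟶ D}
    (h : ∀ a b c, f (tm a (tm b c)) = g (tm a (tm b c))) : f = g := by
  apply flip_epi
  exact tens_ext₃ fun b c a => by simpa using h a b c

lemma assocInv_hom (A B C : CStarAlg κ) : assocInv A B C ≫ assocHom A B C = 𝟙 _ :=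
  tens_ext₃' fun a b c => by simp

lemma smul_tm {A B : CStarAlg κ} (c : ℂ) (a : A) (b : B) : tm (c • a) b = c • tm a b :=
  κ.tmul_smul_left c a b

lemma tm_smul {A B : CStarAlg κ} (c : ℂ) (a : A) (b : B) : tm a (c • b) = c • tm a b :=
  κ.tmul_smul_right c a b

@[simp] lemma hom_smul {A B : CStarAlg κ} (f : A ⟶ B) (c : ℂ) (a : A) : f (c • a) = c • f a :=
  map_smul f.hom c a

lemma unit_eq (c : (unit : CStarAlg κ)) : uscal c • uone' = c :=
  ULift.ext _ _ (mul_one _)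

lemma lid_hom_inv (A : CStarAlg κ) : lidHom A ≫ lidInv A = 𝟙 _ :=
  tens_ext fun c a => by
    rw [comp_apply, lidHom_tm, hom_smul, lidInv_apply, id_apply, ← smul_tm]
    exact congrArg (fun c => tm c a) (unit_eq c)

lemma lid_inv_hom (A : CStarAlg κ) : lidInv A ≫ lidHom A = 𝟙 _ :=
  hom_ext' fun a => by
    exact (lidHom_tm (A := A) _ a).trans (one_smul ℂ a)

instance : MonoidalCategoryStruct (CStarAlg κ) where
  tensorObj A B := tens A B
  whiskerLeft A _ _ f := tensHom (𝟙 A) f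
  whiskerRight f B := tensHom f (𝟙 B)
  tensorHom f g := tensHom f g
  tensorUnit := unit
  associator A B C := ⟨assocHom A B C, assocInv A B C, assoc_inv_hom A B C, assocInv_hom A B C⟩
  leftUnitor A := ⟨lidHom A, lidInv A, lid_hom_inv A, lid_inv_hom A⟩
  rightUnitor A := ⟨flip A unit ≫ lidHom A, lidInv A ≫ flip unit A,
    by rw [Category.assoc, ← Category.assoc (lidHom A), lid_hom_inv, Category.id_comp, flip_flip],
    by rw [Category.assoc, ← Category.assoc (flip unit A), flip_flip, Category.id_comp,
        lid_inv_hom]⟩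

/-- The elementary tensors, for the monoidal structure. -/
def tmul {A B : CStarAlg κ} (a : A) (b : B) : (A ⊗ B : CStarAlg κ) := κ.tmul a b

@[simp] lemma tensorHom_tmul {A B A' B' : CStarAlg κ} (f : A ⟶ A') (g : B ⟶ B') (a : A) (b : B) :
    (f ⊗ₘ g) (tmul a b) = tmul (f a) (g b) := κ.map_tmul _ _ _ _
@[simp] lemma whiskerLeft_tmul {A B B' : CStarAlg κ} (g : B ⟶ B') (a : A) (b : B) :
    (A ◁ g) (tmul a b) = tmul a (g b) := κ.map_tmul _ _ _ _
@[simp] lemma whiskerRight_tmul {A B A' : CStarAlg κ} (f : A ⟶ A') (a : A) (b : B) :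
    (f ▷ B) (tmul a b) = tmul (f a) b := κ.map_tmul _ _ _ _
@[simp] lemma associator_tmul {A B C : CStarAlg κ} (a : A) (b : B) (c : C) :
    (α_ A B C).hom (tmul (tmul a b) c) = tmul a (tmul b c) := κ.assoc_tmul _ _ _
@[simp] lemma associator_inv_tmul {A B C : CStarAlg κ} (a : A) (b : B) (c : C) :
    (α_ A B C).inv (tmul a (tmul b c)) = tmul (tmul a b) c := κ.assocInv_tmul _ _ _

/-- The complex number underlying an element of the unit object. -/
def scal (c : (𝟙_ (CStarAlg κ))) : ℂ := uscal c

/-- The unit of the complex numbers, as an element of the unit object. -/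
def uone : (𝟙_ (CStarAlg κ)) := (⟨1⟩ : ULift.{u} ℂ)

@[simp] lemma scal_uone : scal (uone : (𝟙_ (CStarAlg κ))) = 1 := rfl

@[simp] lemma leftUnitor_tmul {A : CStarAlg κ} (c : (𝟙_ (CStarAlg κ))) (a : A) :
    (λ_ A).hom (tmul c a) = scal c • a := κ.lid_tmul _ _
@[simp] lemma rightUnitor_tmul {A : CStarAlg κ} (c : (𝟙_ (CStarAlg κ))) (a : A) :
    (ρ_ A).hom (tmul a c) = scal c • a := by
  change lidHom A (flip A unit (tm a c)) = _
  rw [flip_tm]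
  exact κ.lid_tmul _ _

lemma smul_tmul {A B : CStarAlg κ} (c : ℂ) (a : A) (b : B) : tmul (c • a) b = c • tmul a b :=
  κ.tmul_smul_left c a b

lemma tmul_smul {A B : CStarAlg κ} (c : ℂ) (a : A) (b : B) : tmul a (c • b) = c • tmul a b :=
  κ.tmul_smul_right c a b

lemma tensor_ext {A B C : CStarAlg κ} {f g : A ⊗ B ⟶ C}
    (h : ∀ a b, f (tmul a b) = g (tmul a b)) : f = g :=
  tens_ext h

lemma tensor_ext₃ {A B C D : CStarAlg κ} {f g : (A ⊗ B) ⊗ C ⟶ D}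
    (h : ∀ a b c, f (tmul (tmul a b) c) = g (tmul (tmul a b) c)) : f = g :=
  tens_ext₃ h

lemma tensor_ext₃' {A B C D : CStarAlg κ} {f g : A ⊗ (B ⊗ C) ⟶ D}
    (h : ∀ a b c, f (tmul a (tmul b c)) = g (tmul a (tmul b c))) : f = g :=
  tens_ext₃' h

lemma tensor_ext₄ {A B C D E : CStarAlg κ} {f g : ((A ⊗ B) ⊗ C) ⊗ D ⟶ E}
    (h : ∀ a b c d, f (tmul (tmul (tmul a b) c) d) = g (tmul (tmul (tmul a b) c) d)) : f = g :=
  tens_ext₄ h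

instance : MonoidalCategory (CStarAlg κ) :=
  MonoidalCategory.ofTensorHom
    (id_tensorHom_id := fun A B => tensor_ext fun a b => by simp)
    (id_tensorHom := fun _ _ _ _ => rfl)
    (tensorHom_id := fun _ _ => rfl)
    (tensorHom_comp_tensorHom := fun _ _ _ _ => tensor_ext fun a b => by simp)
    (associator_naturality := fun f g h => tensor_ext₃ fun a b c => by simp)
    (leftUnitor_naturality := fun f => tensor_ext fun c a => by simp)
    (rightUnitor_naturality := fun f => tensor_ext fun a c => by simp)
    (pentagon := fun W X Y Z => tensor_ext₄ fun a b c d => by simp)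
    (triangle := fun X Y => tensor_ext₃ fun a c b => by simp [smul_tmul, tmul_smul])

instance : SymmetricCategory (CStarAlg κ) where
  braiding A B := ⟨flip A B, flip B A, flip_flip A B, flip_flip B A⟩
  braiding_naturality_right A _ _ f := flip_nat (𝟙 A) f
  braiding_naturality_left f A := flip_nat f (𝟙 A)
  hexagon_forward X Y Z := by
    have hb (A B : CStarAlg κ) (a : A) (b : B) :
        (show A ⊗ B ⟶ B ⊗ A from flip A B) (tmul a b) = tmul b a := κ.comm_tmul _ _
    exact tensor_ext₃ fun a b c => by simp [hb]
  hexagon_reverse X Y Z := by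
    have hb (A B : CStarAlg κ) (a : A) (b : B) :
        (show A ⊗ B ⟶ B ⊗ A from flip A B) (tmul a b) = tmul b a := κ.comm_tmul _ _
    exact tensor_ext₃' fun a b c => by simp [hb]
  symmetry A B := flip_flip A B

@[simp] lemma braiding_tmul {A B : CStarAlg κ} (a : A) (b : B) :
    (β_ A B).hom (tmul a b) = tmul b a :=
  κ.comm_tmul _ _

end CStarAlg

/-! ### Spaces: compactly generated weakly Hausdorff spaces -/

/-- Continuity on the compactly generated topology (the `k`-ification) of the domain. For maps
out of a finite product this is continuity on the product of compactly generated spaces. -/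
def KCont {X : Type w} {Y : Type w'} [TopologicalSpace X] [TopologicalSpace Y] (f : X → Y) : Prop :=
  @Continuous X Y (compactlyGenerated.{u} X) inferInstance f

/-- A space, in the sense of algebraic topology: compactly generated and weakly Hausdorff. -/
class IsSpace (X : Type u) [TopologicalSpace X] : Prop where
  cg : CompactlyGeneratedSpace X
  wh : ∀ (S : Type u) [TopologicalSpace S] [CompactSpace S] [T2Space S] (f : S → X),
    Continuous f → IsClosed (Set.range f)

lemma IsSpace.of_t2 (X : Type u) [TopologicalSpace X] [T2Space X] [CompactlyGeneratedSpace X] :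
    IsSpace X where
  cg := inferInstance
  wh _ _ _ _ _ hf := (isCompact_range hf).isClosed

instance : IsSpace PUnit.{u + 1} := .of_t2 _

instance (X Y : Type u) [TopologicalSpace X] [TopologicalSpace Y] [IsSpace X] [IsSpace Y] :
    IsSpace (X ⊕ Y) where
  cg := by
    have := IsSpace.cg (X := X)
    have := IsSpace.cg (X := Y)
    infer_instance
  wh S _ _ _ f hf := by
    rw [isClosed_sum_iff]
    constructor
    · have hc : IsClosed (f ⁻¹' Set.range Sum.inl) := isClosed_range_inl.preimage hf
      have : CompactSpace (f ⁻¹' Set.range Sum.inl) := isCompact_iff_compactSpace.1 hc.isCompact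
      choose g hg using fun s : f ⁻¹' Set.range (Sum.inl : X → X ⊕ Y) => s.2
      have hgc : Continuous g := by
        rw [Topology.IsEmbedding.inl.continuous_iff (g := (Sum.inl : X → X ⊕ Y))]
        have : (Sum.inl : X → X ⊕ Y) ∘ g = fun s => f s.1 := funext hg
        rw [this]
        exact hf.comp continuous_subtype_val
      convert IsSpace.wh _ g hgc using 1
      ext x
      constructor
      · rintro ⟨s, hs⟩
        exact ⟨⟨s, x, hs.symm⟩, Sum.inl_injective ((hg _).trans hs)⟩
      · rintro ⟨s, rfl⟩
        exact ⟨s.1, (hg s).symm⟩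
    · have hc : IsClosed (f ⁻¹' Set.range Sum.inr) := isClosed_range_inr.preimage hf
      have : CompactSpace (f ⁻¹' Set.range Sum.inr) := isCompact_iff_compactSpace.1 hc.isCompact
      choose g hg using fun s : f ⁻¹' Set.range (Sum.inr : Y → X ⊕ Y) => s.2
      have hgc : Continuous g := by
        rw [Topology.IsEmbedding.inr.continuous_iff (g := (Sum.inr : Y → X ⊕ Y))]
        have : (Sum.inr : Y → X ⊕ Y) ∘ g = fun s => f s.1 := funext hg
        rw [this]
        exact hf.comp continuous_subtype_val
      convert IsSpace.wh _ g hgc using 1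
      ext x
      constructor
      · rintro ⟨s, hs⟩
        exact ⟨⟨s, x, hs.symm⟩, Sum.inr_injective ((hg _).trans hs)⟩
      · rintro ⟨s, rfl⟩
        exact ⟨s.1, (hg s).symm⟩

/-- A pointed space. -/
structure PtSpace where
  carrier : Type u
  [top : TopologicalSpace carrier]
  [isSpace : IsSpace carrier]
  pt : carrier

namespace PtSpace

instance : CoeSort PtSpace.{u} (Type u) := ⟨PtSpace.carrier⟩
instance (K : PtSpace.{u}) : TopologicalSpace K := K.top
instance (K : PtSpace.{u}) : IsSpace K := K.isSpace

/-- The space of pointed maps. -/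
structure Map (K L : PtSpace.{u}) where
  toMap : C(K, L)
  map_pt : toMap K.pt = L.pt

instance (K L : PtSpace.{u}) : FunLike (Map K L) K L where
  coe f := f.toMap
  coe_injective := by
    rintro ⟨f, _⟩ ⟨g, _⟩ h
    congr
    exact DFunLike.coe_injective h

/-- The topology of the space of pointed maps: the `k`-ification of the compact-open topology. -/
instance (K L : PtSpace.{u}) : TopologicalSpace (Map K L) :=
  @compactlyGenerated.{u} (Map K L) (TopologicalSpace.induced Map.toMap inferInstance)

instance : Category PtSpace.{u} where
  Hom := Map
  id K := ⟨.id K, rfl⟩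
  comp f g := ⟨g.toMap.comp f.toMap, (congrArg g.toMap f.map_pt).trans g.map_pt⟩

/-- The pointed space `C₊` obtained by adding a disjoint base point. -/
def plus (C : Type u) [TopologicalSpace C] [IsSpace C] : PtSpace.{u} where
  carrier := C ⊕ PUnit.{u + 1}
  pt := Sum.inr ⟨⟩

/-- The pointed space `S⁰`. -/
def sphere0 : PtSpace.{u} := plus PUnit.{u + 1}

/-- `μ` exhibits `P` as the smash product of `K` and `L`: the quotient of the product `K × L` (of
compactly generated spaces) by the wedge. -/
structure IsSmash (K L P : PtSpace.{u}) (μ : K → L → P) : Prop where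
  surjective : ∀ p, ∃ k l, μ k l = p
  eq_pt : ∀ k l, μ k l = P.pt ↔ k = K.pt ∨ l = L.pt
  inj : ∀ k l k' l', μ k l = μ k' l' → μ k l ≠ P.pt → k = k' ∧ l = l'
  top_eq : P.top = TopologicalSpace.coinduced (fun x : K × L => μ x.1 x.2)
    (compactlyGenerated.{u} (K × L))

end PtSpace

/-! ### Pointed topological categories and closed actions of pointed spaces -/

open Limits

/-- A pointed topological category: a category enriched in pointed spaces. The base points of
the morphism spaces are the zero morphisms. -/
class PtTopCategory (B : Type v) [Category.{u} B] [HasZeroMorphisms B] where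
  top : ∀ X Y : B, TopologicalSpace (X ⟶ Y)
  isSpace : ∀ X Y : B, IsSpace (X ⟶ Y)
  comp_cont : ∀ X Y Z : B, KCont.{u} fun p : (X ⟶ Y) × (Y ⟶ Z) => p.1 ≫ p.2

instance (B : Type v) [Category.{u} B] [HasZeroMorphisms B] [PtTopCategory B] (X Y : B) :
    TopologicalSpace (X ⟶ Y) := PtTopCategory.top X Y

instance (B : Type v) [Category.{u} B] [HasZeroMorphisms B] [PtTopCategory B] (X Y : B) :
    IsSpace (X ⟶ Y) := PtTopCategory.isSpace X Y

/-- The pointed space of morphisms. -/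
def mapSpace {B : Type v} [Category.{u} B] [HasZeroMorphisms B] [PtTopCategory B] (X Y : B) :
    PtSpace.{u} where
  carrier := X ⟶ Y
  pt := 0

/-- The morphism `f k`, for a pointed map `f` from `K` to `Map(X, Y)`. -/
def PtSpace.Map.value {B : Type v} [Category.{u} B] [HasZeroMorphisms B] [PtTopCategory B]
    {K : PtSpace.{u}} {X Y : B} (f : PtSpace.Map K (mapSpace X Y)) (k : K) : X ⟶ Y := f k

/-- The monoidal product of a pointed topological category is enriched in pointed spaces. -/
class MonoidalPtTop (B : Type v) [Category.{u} B] [HasZeroMorphisms B] [PtTopCategory B]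
    [MonoidalCategory B] : Prop where
  tensor_cont : ∀ X Y X' Y' : B, KCont.{u} fun p : (X ⟶ Y) × (X' ⟶ Y') => p.1 ⊗ₘ p.2
  zero_tensor : ∀ {X Y X' Y' : B} (f : X' ⟶ Y'), (0 : X ⟶ Y) ⊗ₘ f = 0
  tensor_zero : ∀ {X Y X' Y' : B} (f : X ⟶ Y), f ⊗ₘ (0 : X' ⟶ Y') = 0

/-- A closed action of pointed spaces on a pointed topological category. -/
structure ClosedAction (B : Type v) [Category.{u} B] [HasZeroMorphisms B] [PtTopCategory B] where
  /-- the functor `(K, X) ↦ K ∧ X` -/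
  smash : PtSpace.{u} ⥤ B ⥤ B
  /-- `- ∧ X` is enriched left adjoint to `Map(X, -)` -/
  adj : ∀ (K : PtSpace.{u}) (X Y : B), ((smash.obj K).obj X ⟶ Y) ≃ₜ (PtSpace.Map K (mapSpace X Y))
  adj_nat : ∀ {K L : PtSpace.{u}} {X X' Y Y' : B} (f : K ⟶ L) (g : X ⟶ X')
    (φ : (smash.obj L).obj X' ⟶ Y) (h : Y ⟶ Y') (k : K),
    (adj K X Y' ((smash.map f).app X ≫ (smash.obj L).map g ≫ φ ≫ h)).value k =
      g ≫ (adj L X' Y φ).value (f.toMap k) ≫ h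
  /-- the functor `X ↦ X ^ K` -/
  cotensor : PtSpace.{u} → B ⥤ B
  /-- `(-) ^ K` is enriched right adjoint to `K ∧ -` -/
  coadj : ∀ (K : PtSpace.{u}) (X Y : B), ((smash.obj K).obj X ⟶ Y) ≃ₜ (X ⟶ (cotensor K).obj Y)
  coadj_nat : ∀ {K : PtSpace.{u}} {X X' Y Y' : B} (g : X ⟶ X')
    (φ : (smash.obj K).obj X' ⟶ Y) (h : Y ⟶ Y'),
    coadj K X Y' ((smash.obj K).map g ≫ φ ≫ h) = g ≫ coadj K X' Y φ ≫ (cotensor K).map h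
  /-- `(K ∧ L) ∧ X ≅ K ∧ (L ∧ X)`, where points correspond to points: for `k` in `K`, the value at
  `k` of the unit `K ⟶ Map(X, K ∧ X)` of the adjunction is the inclusion `X ⟶ K ∧ X` at `k`. This
  determines the isomorphisms, and makes them natural and coherent. -/
  assoc : ∀ {K L P : PtSpace.{u}} (μ : K → L → P), PtSpace.IsSmash K L P μ → ∀ X : B,
    ∃ a : (smash.obj P).obj X ≅ (smash.obj K).obj ((smash.obj L).obj X), ∀ k l,
      (adj P X _ (𝟙 _)).value (μ k l) ≫ a.hom =
        (adj L X _ (𝟙 _)).value l ≫ (adj K ((smash.obj L).obj X) _ (𝟙 _)).value k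
  /-- `S⁰ ∧ X ≅ X`, inverse to the inclusion at the point of `S⁰` -/
  unit : ∀ X : B, ∃ a : (smash.obj PtSpace.sphere0).obj X ≅ X,
    a.inv = (adj PtSpace.sphere0 X _ (𝟙 _)).value (Sum.inl ⟨⟩)

namespace ClosedAction

variable {B : Type v} [Category.{u} B] [HasZeroMorphisms B] [PtTopCategory B]
  (T : ClosedAction B)

/-- The value at a point `k` of `K` of a map `K ∧ X ⟶ Y`: the map `X ⟶ Y`, `x ↦ φ (k ∧ x)`. -/
def eval {K : PtSpace.{u}} {X Y : B} (φ : (T.smash.obj K).obj X ⟶ Y) (k : K) : X ⟶ Y :=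
  (T.adj K X Y φ).value k

/-- Maps out of `K ∧ X` are determined by their values at the points of `K`. -/
lemma eval_ext {K : PtSpace.{u}} {X Y : B} {φ ψ : (T.smash.obj K).obj X ⟶ Y}
    (h : ∀ k, T.eval φ k = T.eval ψ k) : φ = ψ :=
  (T.adj K X Y).injective (DFunLike.ext _ _ h)

end ClosedAction

/-! ### Tensor powers in a symmetric monoidal category -/

section Powers

variable {C : Type w₁} [Category.{w₂} C] [MonoidalCategory C]

/-- The tensor power `X^{⊗ n}`. -/
def tpow (X : C) : ℕ → C
  | 0 => 𝟙_ C
  | n + 1 => tpow X n ⊗ X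

/-- `X^{⊗ 1} ≅ X`. -/
def powOne (X : C) : tpow X 1 ≅ X := λ_ X

/-- Equal exponents give isomorphic powers. -/
def powCast (X : C) {m n : ℕ} (h : m = n) : tpow X m ≅ tpow X n := eqToIso (congrArg (tpow X) h)

/-- `X^{⊗ (m + n)} ≅ X^{⊗ m} ⊗ X^{⊗ n}`. -/
def powAdd (X : C) (m : ℕ) : ∀ n, tpow X (m + n) ≅ tpow X m ⊗ tpow X n
  | 0 => (ρ_ (tpow X m)).symm
  | n + 1 => whiskerRightIso (powAdd X m n) X ≪≫ α_ (tpow X m) (tpow X n) X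

/-- The tensor product `f₁ ⊗ ⋯ ⊗ f_k` of morphisms `f_i` from `X^{⊗ n_i}` to `Y`. -/
def tensorMaps {X Y : C} : ∀ {k : ℕ} (n : Fin k → ℕ), (∀ i, tpow X (n i) ⟶ Y) →
    (tpow X (∑ i, n i) ⟶ tpow Y k)
  | 0, n, _ => (powCast X (Fin.sum_univ_zero n)).hom
  | k + 1, n, f =>
    (powCast X (Fin.sum_univ_castSucc n)).hom ≫ (powAdd X _ _).hom ≫
      (tensorMaps (fun i => n i.castSucc) (fun i => f i.castSucc) ⊗ₘ f (Fin.last k))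

variable [SymmetricCategory C]

/-- The morphism `X^{⊗ n} ⊗ X ⟶ X^{⊗ (n + 1)}` that moves the last factor to the position `p`. -/
def insertFactor (X : C) : ∀ {n : ℕ}, Fin (n + 1) → (tpow X n ⊗ X ⟶ tpow X (n + 1))
  | 0, _ => 𝟙 _
  | n + 1, p => Fin.lastCases (motive := fun _ => tpow X (n + 1) ⊗ X ⟶ tpow X (n + 2)) (𝟙 _)
      (fun q => (α_ (tpow X n) X X).hom ≫ (tpow X n ◁ (β_ X X).hom) ≫ (α_ (tpow X n) X X).inv ≫
        (insertFactor X q ▷ X)) p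

lemma insertFactor_last (X : C) (n : ℕ) :
    insertFactor X (Fin.last n) = 𝟙 (tpow X n ⊗ X) := by
  cases n with
  | zero => rfl
  | succ n => exact Fin.lastCases_last

lemma insertFactor_castSucc (X : C) {n : ℕ} (q : Fin (n + 1)) :
    insertFactor X q.castSucc = (α_ (tpow X n) X X).hom ≫ (tpow X n ◁ (β_ X X).hom) ≫
      (α_ (tpow X n) X X).inv ≫ (insertFactor X q ▷ X) :=
  Fin.lastCases_castSucc _

/-- The bijection induced by `e` on the complements of the last element and of its image. -/
def dropLast {m n : ℕ} (e : Fin (m + 1) ≃ Fin (n + 1)) : Fin m ≃ Fin n :=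
  Equiv.removeNone (((finSuccEquiv' (Fin.last m)).symm.trans e).trans
    (finSuccEquiv' (e (Fin.last m))))

/-- The morphism `X^{⊗ m} ⟶ X^{⊗ n}` that moves the factor number `i` to the position `e i`. -/
def permPow (X : C) : ∀ {m n : ℕ}, Fin m ≃ Fin n → (tpow X m ⟶ tpow X n)
  | 0, 0, _ => 𝟙 _
  | 0, _ + 1, e => (e.symm 0).elim0
  | _ + 1, 0, e => (e 0).elim0
  | m + 1, n + 1, e => (permPow X (dropLast e) ▷ X) ≫ insertFactor X (e (Fin.last m))

end Powers

/-! ### Operads in spaces -/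

lemma finSigma_lt_iff {k : ℕ} (n : Fin k → ℕ) (i j : Fin k) (a : Fin (n i)) (b : Fin (n j)) :
    finSigmaFinEquiv ⟨i, a⟩ < finSigmaFinEquiv ⟨j, b⟩ ↔
      i < j ∨ (i = j ∧ (a : ℕ) < b) := by
  have key : ∀ (i j : Fin k) (a : Fin (n i)) (b : Fin (n j)), i < j →
      finSigmaFinEquiv ⟨i, a⟩ < finSigmaFinEquiv ⟨j, b⟩ := by
    intro i j a b h
    rw [Fin.lt_def, finSigmaFinEquiv_apply, finSigmaFinEquiv_apply]
    have hs : ∀ i : Fin k, ∑ x : Fin i.1, n (Fin.castLE i.2.le x) =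
        ∑ x ∈ Finset.range i.1, if h : x < k then n ⟨x, h⟩ else 0 := by
      intro i
      rw [Finset.sum_range]
      refine Finset.sum_congr rfl fun x _ => ?_
      rw [dif_pos (x.2.trans i.2)]
      rfl
    rw [hs, hs]
    have h1 : ∑ x ∈ Finset.range (i.1 + 1), (if h : x < k then n ⟨x, h⟩ else 0) ≤
        ∑ x ∈ Finset.range j.1, if h : x < k then n ⟨x, h⟩ else 0 :=
      Finset.sum_le_sum_of_subset (Finset.range_mono h)
    rw [Finset.sum_range_succ, dif_pos i.2] at h1
    have h2 := a.2
    have h3 : (if h : i.1 < k then n ⟨i.1, h⟩ else 0) = n i := dif_pos i.2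
    simp only [Fin.eta] at h1 ⊢
    linarith
  rcases lt_trichotomy i j with h | rfl | h
  · simp [h, key i j a b h]
  · rw [Fin.lt_def, finSigmaFinEquiv_apply, finSigmaFinEquiv_apply]
    simp
  · have := key j i b a h
    simp [h.not_gt, h.ne', this.not_gt]

lemma finEquiv_unique {T : Type*} {m n : ℕ} (f : T ≃ Fin m) (g : T ≃ Fin n)
    (h : ∀ s t, f s < f t ↔ g s < g t) (t : T) : (f t : ℕ) = g t := by
  obtain rfl : m = n := Fin.equiv_iff_eq.1 ⟨f.symm.trans g⟩
  let e : Fin m ≃o Fin m := StrictMono.orderIsoOfSurjective (f.symm.trans g)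
    (fun x y hxy => (h _ _).1 (by simpa using hxy)) (f.symm.trans g).surjective
  have he : e = OrderIso.refl _ := Subsingleton.elim _ _
  have h1 : g (f.symm (f t)) = f t := DFunLike.congr_fun he (f t)
  rw [f.symm_apply_apply] at h1
  rw [h1]

lemma sum_finSigma {k : ℕ} (n : Fin k → ℕ) (p : ∀ i, Fin (n i) → ℕ) :
    ∑ s, p (finSigmaFinEquiv.symm s).1 (finSigmaFinEquiv.symm s).2 = ∑ i, ∑ a, p i a := by
  rw [← Fintype.sum_sigma' , ← (finSigmaFinEquiv (n := n)).symm.sum_comp]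

/-- The block permutation induced by a permutation of blocks of sizes `n i`. -/
def blockPerm {k k' : ℕ} (e : Fin k' ≃ Fin k) (n : Fin k → ℕ) :
    Fin (∑ i, n (e i)) ≃ Fin (∑ i, n i) :=
  finSigmaFinEquiv.symm.trans
    ((Equiv.sigmaCongrLeft (β := fun i => Fin (n i)) e).trans finSigmaFinEquiv)

/-- The direct sum of bijections. -/
def sumPerm {k : ℕ} {m n : Fin k → ℕ} (e : ∀ i, Fin (m i) ≃ Fin (n i)) :
    Fin (∑ i, m i) ≃ Fin (∑ i, n i) :=
  finSigmaFinEquiv.symm.trans ((Equiv.sigmaCongrRight e).trans finSigmaFinEquiv)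

/-- An operad in spaces. The right actions of the symmetric groups are given as actions of
bijections `e : Fin m ≃ Fin n` (so that `m = n`); thus the equalities of the exponents in the
axioms act through the identity permutations `finCongr _`. -/
structure TopOperad where
  obj : ℕ → Type u
  [top : ∀ j, TopologicalSpace (obj j)]
  [isSpace : ∀ j, IsSpace (obj j)]
  /-- the right action of the symmetric groups -/
  act : ∀ {m n : ℕ}, (Fin m ≃ Fin n) → obj n → obj m
  act_cont : ∀ {m n : ℕ} (e : Fin m ≃ Fin n), Continuous (act e)
  act_refl : ∀ {n : ℕ} (c : obj n), act (Equiv.refl _) c = c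
  act_trans : ∀ {l m n : ℕ} (e : Fin l ≃ Fin m) (e' : Fin m ≃ Fin n) (c : obj n),
    act (e.trans e') c = act e (act e' c)
  /-- the unit -/
  one : obj 1
  /-- the composition `γ` -/
  comp : ∀ {k : ℕ} (n : Fin k → ℕ), obj k → (∀ i, obj (n i)) → obj (∑ i, n i)
  comp_cont : ∀ {k : ℕ} (n : Fin k → ℕ),
    KCont.{u} fun x : obj k × (∀ i, obj (n i)) => comp n x.1 x.2
  one_comp : ∀ {n : ℕ} (c : obj n),
    comp (fun _ : Fin 1 => n) one (fun _ => c) = act (finCongr (by simp)) c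
  comp_one : ∀ {k : ℕ} (c : obj k),
    comp (fun _ : Fin k => 1) c (fun _ => one) = act (finCongr (by simp)) c
  assoc : ∀ {k : ℕ} (n : Fin k → ℕ) (p : ∀ i, Fin (n i) → ℕ) (c : obj k) (d : ∀ i, obj (n i))
    (b : ∀ i a, obj (p i a)),
    comp (fun s => p (finSigmaFinEquiv.symm s).1 (finSigmaFinEquiv.symm s).2) (comp n c d)
        (fun s => b (finSigmaFinEquiv.symm s).1 (finSigmaFinEquiv.symm s).2) =
      act (finCongr (sum_finSigma n p))
        (comp (fun i => ∑ a, p i a) c fun i => comp (p i) (d i) (b i))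
  equivariant_left : ∀ {k k' : ℕ} (e : Fin k' ≃ Fin k) (n : Fin k → ℕ) (c : obj k)
    (d : ∀ i, obj (n i)),
    comp (fun i => n (e i)) (act e c) (fun i => d (e i)) = act (blockPerm e n) (comp n c d)
  equivariant_right : ∀ {k : ℕ} {m n : Fin k → ℕ} (e : ∀ i, Fin (m i) ≃ Fin (n i)) (c : obj k)
    (d : ∀ i, obj (n i)),
    comp m c (fun i => act (e i) (d i)) = act (sumPerm e) (comp n c d)

instance (O : TopOperad.{u}) (j : ℕ) : TopologicalSpace (O.obj j) := O.top j
instance (O : TopOperad.{u}) (j : ℕ) : IsSpace (O.obj j) := O.isSpace j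

/-! ### Tensor powers of C*-algebras -/

namespace CStarAlg

variable {κ : CStarTensor.{u}}

lemma hom_continuous {A B : CStarAlg κ} (f : A ⟶ B) : Continuous f := starHom_continuous f.hom

/-- The elementary tensors in the tensor powers. -/
def tprod {A : CStarAlg κ} : ∀ {n : ℕ}, (Fin n → A) → (tpow A n : CStarAlg κ)
  | 0, _ => uone
  | _ + 1, x => tmul (tprod fun i => x i.castSucc) (x (Fin.last _))

lemma tprod_zero {A : CStarAlg κ} (x : Fin 0 → A) : tprod x = (uone : (𝟙_ (CStarAlg κ))) := rfl

lemma tprod_succ {A : CStarAlg κ} {n : ℕ} (x : Fin (n + 1) → A) :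
    tprod x = tmul (tprod fun i => x i.castSucc) (x (Fin.last _)) := rfl

lemma tmul_induction {A B : CStarAlg κ} {P : (A ⊗ B : CStarAlg κ) → Prop}
    (hc : IsClosed {x | P x}) (hadd : ∀ x y, P x → P y → P (x + y)) (h : ∀ a b, P (tmul a b))
    (x : (A ⊗ B : CStarAlg κ)) : P x :=
  κ.induction hc hadd h x

lemma continuous_tmul_left {A B : CStarAlg κ} (b : B) :
    Continuous fun a : A => (tmul a b : (A ⊗ B : CStarAlg κ)) :=
  κ.continuous_tmul continuous_id continuous_const

lemma add_tmul {A B : CStarAlg κ} (a a' : A) (b : B) :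
    tmul (a + a') b = tmul a b + tmul a' b := κ.tmul_add_left a a' b

lemma tmul_mul {A B : CStarAlg κ} (a a' : A) (b b' : B) :
    tmul a b * tmul a' b' = tmul (a * a') (b * b') := κ.tmul_mul a a' b b'

lemma scal_smul_uone (c : (𝟙_ (CStarAlg κ))) : scal c • uone = c := unit_eq c

lemma pow_induction {A : CStarAlg κ} : ∀ {n : ℕ} {P : CStarAlg.carrier (tpow A n) → Prop}
    (_ : IsClosed {x | P x}) (_ : ∀ x y, P x → P y → P (x + y))
    (_ : ∀ (c : ℂ) x, P x → P (c • x)) (_ : ∀ x, P (tprod x)) (t : (tpow A n : CStarAlg κ)), P t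
  | 0, P, _, _, hs, h, t => by
    have := hs (scal t) uone (h Fin.elim0)
    exact (congrArg P (scal_smul_uone t)).mp this
  | n + 1, P, hc, ha, hs, h, t => by
    refine tmul_induction hc ha (fun t a => ?_) t
    refine pow_induction (P := fun t => P (tmul t a)) (hc.preimage (continuous_tmul_left a))
      (fun x y hx hy => ?_) (fun c x hx => ?_) (fun x => ?_) t
    · rw [add_tmul]; exact ha _ _ hx hy
    · rw [smul_tmul]; exact hs _ _ hx
    · have := h (Fin.snoc x a)
      rw [tprod_succ] at this
      simpa using this

lemma pow_ext {A B : CStarAlg κ} {n : ℕ} {f g : tpow A n ⟶ B}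
    (h : ∀ x, f (tprod x) = g (tprod x)) : f = g := by
  ext t
  refine pow_induction (P := fun t => f t = g t)
    (isClosed_eq (hom_continuous f) (hom_continuous g)) (fun x y hx hy => ?_) (fun c x hx => ?_)
    h t
  · have (f : tpow A n ⟶ B) : f (x + y) = f x + f y := map_add f.hom x y
    rw [this, this, hx, hy]
  · rw [hom_smul, hom_smul, hx]

lemma powCast_tprod {A : CStarAlg κ} {m n : ℕ} (h : m = n) (x : Fin m → A) :
    (powCast A h).hom (tprod x) = tprod fun i => x (Fin.cast h.symm i) := by
  subst h; rfl

lemma iso_inv_apply {A B : CStarAlg κ} (e : A ≅ B) {a : A} {b : B} (h : e.hom a = b) :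
    e.inv b = a := by
  rw [← h, ← comp_apply, e.hom_inv_id, id_apply]

lemma powAdd_tprod {A : CStarAlg κ} {m : ℕ} : ∀ {n : ℕ} (x : Fin (m + n) → A),
    (powAdd A m n).hom (tprod x) =
      tmul (tprod fun i => x (Fin.castAdd n i)) (tprod fun i => x (Fin.natAdd m i))
  | 0, x => by
    refine iso_inv_apply (ρ_ (tpow A m)) ?_
    change (ρ_ (tpow A m)).hom (tmul (tprod fun i => x (Fin.castAdd 0 i)) uone) = _
    rw [rightUnitor_tmul, scal_uone, one_smul]
    rfl
  | n + 1, x => by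
    change (α_ (tpow A m) (tpow A n) A).hom (((powAdd A m n).hom ▷ A)
      (tmul (tprod fun i : Fin (m + n) => x i.castSucc) (x (Fin.last _)))) = _
    rw [whiskerRight_tmul, powAdd_tprod, associator_tmul, tprod_succ (n := n)]
    rfl

lemma tensorMaps_tprod {A B : CStarAlg κ} : ∀ {k : ℕ} (n : Fin k → ℕ) (f : ∀ i, tpow A (n i) ⟶ B)
    (x : Fin (∑ i, n i) → A),
    tensorMaps n f (tprod x) = tprod fun i => f i (tprod fun a => x (finSigmaFinEquiv ⟨i, a⟩))
  | 0, n, f, x => by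
    change (powCast A _).hom (tprod x) = _
    rw [powCast_tprod]; rfl
  | k + 1, n, f, x => by
    change (tensorMaps (fun i => n i.castSucc) (fun i => f i.castSucc) ⊗ₘ f (Fin.last k))
      ((powAdd A _ _).hom ((powCast A (Fin.sum_univ_castSucc n)).hom (tprod x))) = _
    rw [powCast_tprod, powAdd_tprod, tensorHom_tmul, tensorMaps_tprod, tprod_succ]
    have h1 (i : Fin k) (a : Fin (n i.castSucc)) :
        finSigmaFinEquiv ⟨i.castSucc, a⟩ = Fin.cast (Fin.sum_univ_castSucc n).symm (Fin.castAdd _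
          (finSigmaFinEquiv (n := fun i : Fin k => n i.castSucc) ⟨i, a⟩)) := by
      ext; simp
    have h2 (a : Fin (n (Fin.last k))) :
        finSigmaFinEquiv ⟨Fin.last k, a⟩ =
          Fin.cast (Fin.sum_univ_castSucc n).symm (Fin.natAdd _ a) := by
      ext; simp
      rfl
    simp only [h1, h2]

lemma insertFactor_tprod {A : CStarAlg κ} : ∀ {n : ℕ} (p : Fin (n + 1)) (x : Fin n → A) (y : A),
    insertFactor A p (tmul (tprod x) y) = tprod (Fin.insertNth p y x)
  | 0, p, x, y => by
    obtain rfl : p = Fin.last 0 := Fin.ext (by omega)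
    rw [insertFactor_last, tprod_succ]
    change tmul _ _ = _
    simp only [Fin.insertNth_last', Fin.snoc_last, Fin.snoc_castSucc]
  | n + 1, p, x, y => by
    induction p using Fin.lastCases with
    | last =>
      rw [insertFactor_last, tprod_succ (n := n + 1)]
      change tmul _ _ = _
      simp only [Fin.insertNth_last', Fin.snoc_last, Fin.snoc_castSucc]
    | cast q =>
      rw [insertFactor_castSucc, tprod_succ (n := n)]
      change (insertFactor A q ▷ A) ((α_ (tpow A n) A A).inv ((tpow A n ◁ (β_ A A).hom)
        ((α_ (tpow A n) A A).hom (tmul (tmul (tprod fun i => x i.castSucc) (x (Fin.last n))) y)))) = _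
      rw [associator_tmul, whiskerLeft_tmul, braiding_tmul, associator_inv_tmul,
        whiskerRight_tmul, insertFactor_tprod, tprod_succ (n := n + 1)]
      congr 1
      · congr 1
        funext i
        rcases Fin.eq_self_or_eq_succAbove q i with rfl | ⟨j, rfl⟩
        · simp
        · rw [← Fin.castSucc_succAbove_castSucc, Fin.insertNth_apply_succAbove,
            Fin.insertNth_apply_succAbove]
      · have : Fin.last (n + 1) = q.castSucc.succAbove (Fin.last n) :=
          (Fin.succAbove_castSucc_of_le _ _ (Fin.le_last q)).symm
        rw [this, Fin.insertNth_apply_succAbove]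

lemma dropLast_spec {m n : ℕ} (e : Fin (m + 1) ≃ Fin (n + 1)) (i : Fin m) :
    (e (Fin.last m)).succAbove (dropLast e i) = e i.castSucc := by
  have h : some (dropLast e i) = finSuccEquiv' (e (Fin.last m)) (e i.castSucc) := by
    have h0 : ∀ i, (((finSuccEquiv' (Fin.last m)).symm.trans e).trans
        (finSuccEquiv' (e (Fin.last m)))) (some i) =
          finSuccEquiv' (e (Fin.last m)) (e i.castSucc) := by
      intro i; simp
    rw [← h0, dropLast]
    apply Equiv.removeNone_some
    rw [h0]
    have hne : e i.castSucc ≠ e (Fin.last m) := fun h => (Fin.castSucc_lt_last i).ne (e.injective h)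
    obtain ⟨j, hj⟩ := Fin.exists_succAbove_eq hne
    exact ⟨j, by rw [← hj, finSuccEquiv'_succAbove]⟩
  rw [← finSuccEquiv'_symm_some, h, Equiv.symm_apply_apply]

lemma permPow_tprod {A : CStarAlg κ} : ∀ {m n : ℕ} (e : Fin m ≃ Fin n) (x : Fin m → A),
    permPow A e (tprod x) = tprod (x ∘ e.symm)
  | 0, 0, e, x => rfl
  | 0, _ + 1, e, x => (e.symm 0).elim0
  | _ + 1, 0, e, x => (e 0).elim0
  | m + 1, n + 1, e, x => by
    change insertFactor A (e (Fin.last m)) ((permPow A (dropLast e) ▷ A)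
      (tmul (tprod fun i => x i.castSucc) (x (Fin.last m)))) = _
    rw [whiskerRight_tmul, permPow_tprod, insertFactor_tprod]
    congr 1
    funext i
    rcases Fin.eq_self_or_eq_succAbove (e (Fin.last m)) i with rfl | ⟨j, rfl⟩
    · simp
    · obtain ⟨j, rfl⟩ := (dropLast e).surjective j
      rw [dropLast_spec]
      conv_lhs => rw [← dropLast_spec]
      simp

end CStarAlg

/-! ### Strongly self-absorbing C*-algebras and their operads -/

namespace CStarAlg

variable {κ : CStarTensor.{u}}

/-- `e` is a (two-sided) identity of `A`. -/
def IsOne {A : CStarAlg κ} (e : A) : Prop := ∀ a : A, e * a = a ∧ a * e = a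

/-- A unital `*`-homomorphism between unital C*-algebras. -/
def UnitalHom {A B : CStarAlg κ} (f : A ⟶ B) : Prop := ∃ e : A, IsOne e ∧ IsOne (f e)

lemma IsOne.unique {A : CStarAlg κ} {e e' : A} (h : IsOne e) (h' : IsOne e') : e = e' := by
  rw [← (h' e).2, (h e').1]

lemma UnitalHom.isOne {A B : CStarAlg κ} {f : A ⟶ B} (h : UnitalHom f) {e : A} (he : IsOne e) :
    IsOne (f e) := by
  obtain ⟨e', he', h⟩ := h
  rwa [he.unique he']

lemma UnitalHom.comp {A B C : CStarAlg κ} {f : A ⟶ B} {g : B ⟶ C} (hf : UnitalHom f)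
    (hg : UnitalHom g) : UnitalHom (f ≫ g) := by
  obtain ⟨e, he, h⟩ := hf
  exact ⟨e, he, hg.isOne h⟩

lemma isOne_uone : IsOne (uone : (𝟙_ (CStarAlg κ))) := fun a =>
  ⟨ULift.ext _ _ (one_mul (ULift.down a)), ULift.ext _ _ (mul_one (ULift.down a))⟩

lemma isOne_tmul {A B : CStarAlg κ} {e : A} {e' : B} (h : IsOne e) (h' : IsOne e') :
    IsOne (tmul e e') := by
  intro t
  refine tmul_induction (P := fun t => tmul e e' * t = t ∧ t * tmul e e' = t) ?_
    (fun x y hx hy => ?_) (fun a b => ?_) t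
  · exact (isClosed_eq (by fun_prop) (by fun_prop)).inter (isClosed_eq (by fun_prop) (by fun_prop))
  · rw [mul_add, add_mul, hx.1, hx.2, hy.1, hy.2]
    exact ⟨rfl, rfl⟩
  · rw [tmul_mul, tmul_mul, (h a).1, (h a).2, (h' b).1, (h' b).2]
    exact ⟨rfl, rfl⟩

lemma isOne_tprod {A : CStarAlg κ} : ∀ {n : ℕ} {x : Fin n → A}, (∀ i, IsOne (x i)) →
    IsOne (tprod x)
  | 0, _, _ => isOne_uone
  | _ + 1, _, h => isOne_tmul (isOne_tprod fun i => h i.castSucc) (h _)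

lemma unitalHom_of_pow {A B : CStarAlg κ} {n : ℕ} {f : tpow A n ⟶ B} {e : A} (he : IsOne e)
    (h : IsOne (f (tprod fun _ => e))) : UnitalHom f :=
  ⟨_, isOne_tprod fun _ => he, h⟩

/-- The topology of pointwise norm convergence on the set of `*`-homomorphisms. -/
instance pointNorm (A B : CStarAlg κ) : TopologicalSpace (A ⟶ B) :=
  TopologicalSpace.induced (fun f : A ⟶ B => (f : A → B)) inferInstance

lemma continuous_eval {A B : CStarAlg κ} (a : A) : Continuous fun f : A ⟶ B => f a :=
  (continuous_apply a).comp continuous_induced_dom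

lemma continuous_hom_iff {A B : CStarAlg κ} {Z : Type*} [TopologicalSpace Z] {F : Z → (A ⟶ B)} :
    Continuous F ↔ ∀ a, Continuous fun z => F z a := by
  rw [continuous_induced_rng, continuous_pi_iff]; rfl

lemma hom_add {A B : CStarAlg κ} (f : A ⟶ B) (a b : A) : f (a + b) = f a + f b :=
  map_add f.hom a b

lemma hom_dist_le {A B : CStarAlg κ} (f : A ⟶ B) (a b : A) : dist (f a) (f b) ≤ dist a b := by
  rw [dist_eq_norm, dist_eq_norm]
  have : f a - f b = f.hom (a - b) := (map_sub f.hom a b).symm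
  rw [this]
  exact NonUnitalStarAlgHom.norm_apply_le f.hom _

lemma isClosed_continuous_eval {A B : CStarAlg κ} {Z : Type*} [TopologicalSpace Z]
    (F : Z → (A ⟶ B)) : IsClosed {a | Continuous fun z => F z a} := by
  refine isClosed_of_closure_subset fun a ha => ?_
  refine continuous_of_uniform_approx_of_continuous fun V hV => ?_
  obtain ⟨ε, hε, hV⟩ := Metric.mem_uniformity_dist.1 hV
  obtain ⟨b, hb, hab⟩ := Metric.mem_closure_iff.1 ha ε hε
  exact ⟨fun z => F z b, hb, fun z => hV ((hom_dist_le _ _ _).trans_lt hab)⟩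

lemma continuous_comp {A B C : CStarAlg κ} {Z : Type*} [TopologicalSpace Z]
    {F : Z → (A ⟶ B)} {G : Z → (B ⟶ C)} (hF : Continuous F) (hG : Continuous G) :
    Continuous fun z => F z ≫ G z := by
  rw [continuous_hom_iff] at hF ⊢
  intro a
  rw [continuous_iff_continuousAt]
  intro z₀
  rw [ContinuousAt, tendsto_iff_dist_tendsto_zero]
  have h1 := tendsto_iff_dist_tendsto_zero.1 ((hF a).tendsto z₀)
  have h2 := tendsto_iff_dist_tendsto_zero.1
    (((continuous_eval (F z₀ a)).comp hG).tendsto z₀)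
  refine squeeze_zero (fun _ => dist_nonneg) (fun z => ?_) (by simpa using h1.add h2)
  exact (dist_triangle _ (G z (F z₀ a)) _).trans (add_le_add_left (hom_dist_le (G z) _ _) _)

lemma continuous_tensorHom {A B A' B' : CStarAlg κ} {Z : Type*} [TopologicalSpace Z]
    {F : Z → (A ⟶ A')} {G : Z → (B ⟶ B')} (hF : Continuous F) (hG : Continuous G) :
    Continuous fun z => F z ⊗ₘ G z := by
  rw [continuous_hom_iff] at hF hG ⊢
  intro t
  refine tmul_induction (P := fun t => Continuous fun z => (F z ⊗ₘ G z) t)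
    (isClosed_continuous_eval _) (fun x y hx hy => ?_) (fun a b => ?_) t
  · simp only [hom_add]; exact hx.add hy
  · simp only [tensorHom_tmul]; exact κ.continuous_tmul (hF a) (hG b)

lemma continuous_tensorMaps {A B : CStarAlg κ} {Z : Type*} [TopologicalSpace Z] :
    ∀ {k : ℕ} (n : Fin k → ℕ) {F : Z → ∀ i, tpow A (n i) ⟶ B}, (∀ i, Continuous fun z => F z i) →
      Continuous fun z => tensorMaps n (F z)
  | 0, _, _, _ => continuous_const
  | _ + 1, _, _, h => continuous_comp continuous_const (continuous_comp continuous_const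
      (continuous_tensorHom (continuous_tensorMaps _ fun i => h i.castSucc) (h (Fin.last _))))

instance (A B : CStarAlg κ) : T2Space (A ⟶ B) :=
  T2Space.of_injective_continuous (f := fun f : A ⟶ B => (f : A → B)) DFunLike.coe_injective
    continuous_induced_dom

lemma firstCountable_hom (A B : CStarAlg κ) [SeparableSpace A] :
    FirstCountableTopology (A ⟶ B) := by
  have : Nonempty A := ⟨0⟩
  let s := denseSeq A
  have hs : DenseRange s := denseRange_denseSeq A
  have L : ∀ {Z : Type u} [TopologicalSpace Z] (F : Z → (A ⟶ B)),
      (∀ n, Continuous fun z => F z (s n)) → Continuous F := by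
    intro Z _ F h
    rw [continuous_hom_iff]
    intro a
    have hd : Dense {a : A | Continuous fun z => F z a} := hs.mono (by rintro _ ⟨n, rfl⟩; exact h n)
    have huniv := hd.closure_eq
    rw [(isClosed_continuous_eval F).closure_eq] at huniv
    exact (huniv ▸ Set.mem_univ a : a ∈ {a : A | Continuous fun z => F z a})
  let Φ : (A ⟶ B) → Set.range fun (f : A ⟶ B) (n : ℕ) => f (s n) := fun f => ⟨_, f, rfl⟩
  choose F hF using fun z : Set.range fun (f : A ⟶ B) (n : ℕ) => f (s n) => z.2
  have hFΦ : Function.LeftInverse F Φ := fun f => by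
    refine DFunLike.coe_injective (hs.equalizer (hom_continuous _) (hom_continuous _) ?_)
    exact hF (Φ f)
  have hΦ : Continuous Φ := Continuous.subtype_mk (continuous_pi fun n => continuous_eval (s n)) _
  have hFc : Continuous F := L F fun n => by
    have : (fun z => F z (s n)) = fun z => z.1 n := funext fun z => congrFun (hF z) n
    rw [this]
    exact (continuous_apply n).comp continuous_subtype_val
  exact (Topology.IsEmbedding.of_leftInverse hFΦ hFc hΦ).isInducing.firstCountableTopology

instance separable_tensor (A B : CStarAlg κ) [SeparableSpace A] [SeparableSpace B] :
    SeparableSpace (A ⊗ B : CStarAlg κ).carrier := by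
  let S : Set (A ⊗ B : CStarAlg κ) := Set.range fun x : A × B => tmul x.1 x.2
  have hS : IsSeparable S := isSeparable_range (κ.continuous_tmul continuous_fst continuous_snd)
  have h2 := (hS.span (R := ℂ)).closure
  rw [← isSeparable_univ_iff]
  refine h2.mono fun t _ => ?_
  refine tmul_induction (P := fun t => t ∈ closure (Submodule.span ℂ S : Set (A ⊗ B : CStarAlg κ)))
    isClosed_closure
    (fun x y hx hy => ?_) (fun a b => ?_) t
  · exact (Submodule.span ℂ S).topologicalClosure.add_mem hx hy
  · exact subset_closure (Submodule.subset_span ⟨(a, b), rfl⟩)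

instance : SeparableSpace (𝟙_ (CStarAlg κ)).carrier :=
  inferInstanceAs (SeparableSpace (ULift.{u} ℂ))

instance separable_pow (A : CStarAlg κ) [h : SeparableSpace A] : ∀ n : ℕ,
    SeparableSpace (tpow A n).carrier
  | 0 => inferInstanceAs (SeparableSpace (𝟙_ (CStarAlg κ)).carrier)
  | n + 1 => @separable_tensor κ (tpow A n) A (separable_pow A n) h

/-- A strongly self-absorbing C*-algebra: a unital separable C*-algebra `D`, not isomorphic to the
complex numbers (and nonzero), with an isomorphism `φ` from `D` to `D ⊗ D` that is approximately
unitarily equivalent to `d ↦ d ⊗ 1`. -/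
structure IsStronglySelfAbsorbing (D : CStarAlg κ) : Prop where
  separable : SeparableSpace D
  nontrivial : Nontrivial D
  unital : ∃ e : D, IsOne e
  not_complex : IsEmpty (D ≅ 𝟙_ (CStarAlg κ))
  absorbing : ∃ (e : D) (_ : IsOne e) (φ : D ≅ D ⊗ D) (w : ℕ → (D ⊗ D : CStarAlg κ)),
    (∀ n, star (w n) * w n = tmul e e ∧ w n * star (w n) = tmul e e) ∧
    ∀ d : D, Filter.Tendsto (fun n => w n * φ.hom d * star (w n)) Filter.atTop
      (nhds (tmul d e))

/-- The space of unital `*`-homomorphisms from `D^{⊗ j}` to `D`. -/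
def UHom (D : CStarAlg κ) (j : ℕ) : Type u := {f : tpow D j ⟶ D // UnitalHom f}

instance (D : CStarAlg κ) (j : ℕ) : TopologicalSpace (UHom D j) :=
  inferInstanceAs (TopologicalSpace {f : tpow D j ⟶ D // UnitalHom f})

lemma isSpace_uHom (D : CStarAlg κ) [SeparableSpace D] (j : ℕ) : IsSpace (UHom D j) := by
  have : FirstCountableTopology (tpow D j ⟶ D) := firstCountable_hom _ _
  have : FirstCountableTopology (UHom D j) :=
    Topology.IsInducing.firstCountableTopology (f := fun f : UHom D j => f.1) ⟨rfl⟩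
  have : T2Space (UHom D j) := inferInstanceAs (T2Space {f : tpow D j ⟶ D // UnitalHom f})
  exact .of_t2 _

end CStarAlg

lemma KCont.of_continuous {X Y : Type u} [TopologicalSpace X] [TopologicalSpace Y] {f : X → Y}
    (h : Continuous f) : KCont.{u} f := by
  refine continuous_from_compactlyGenerated f fun S g => h.comp g.2

lemma finSigma_lex {k : ℕ} (n : Fin k → ℕ) (p : ∀ i, Fin (n i) → ℕ) (y y' : Σ i, Fin (n i))
    (b : Fin (p y.1 y.2)) (b' : Fin (p y'.1 y'.2)) :
    (finSigmaFinEquiv y < finSigmaFinEquiv y' ∨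
      finSigmaFinEquiv y = finSigmaFinEquiv y' ∧ (b : ℕ) < b') ↔
    (y.1 < y'.1 ∨ y.1 = y'.1 ∧ (finSigmaFinEquiv (n := p y.1) ⟨y.2, b⟩ : ℕ) <
      finSigmaFinEquiv (n := p y'.1) ⟨y'.2, b'⟩) := by
  obtain ⟨i, a⟩ := y
  obtain ⟨i', a'⟩ := y'
  rw [finSigma_lt_iff]
  by_cases h : i = i'
  · subst h
    simp only [lt_irrefl, true_and, false_or, EmbeddingLike.apply_eq_iff_eq, Sigma.mk.injEq,
      heq_eq_eq]
    rw [← Fin.lt_def, ← Fin.lt_def, finSigma_lt_iff]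
  · simp [h]

lemma finSigma_assoc {k : ℕ} (n : Fin k → ℕ) (p : ∀ i, Fin (n i) → ℕ) (s : Fin (∑ i, n i))
    (b : Fin (p (finSigmaFinEquiv.symm s).1 (finSigmaFinEquiv.symm s).2)) :
    (finSigmaFinEquiv (n := fun s => p (finSigmaFinEquiv.symm s).1 (finSigmaFinEquiv.symm s).2)
      ⟨s, b⟩ : ℕ) = finSigmaFinEquiv (n := fun i => ∑ a, p i a)
        ⟨(finSigmaFinEquiv.symm s).1, finSigmaFinEquiv ⟨(finSigmaFinEquiv.symm s).2, b⟩⟩ := by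
  let T := Σ s : Fin (∑ i, n i), Fin (p (finSigmaFinEquiv.symm s).1 (finSigmaFinEquiv.symm s).2)
  let f : T ≃ Fin _ := finSigmaFinEquiv
  let g : T ≃ Fin (∑ i, ∑ a, p i a) :=
    ((Equiv.sigmaCongrLeft (β := fun y : (Σ i, Fin (n i)) => Fin (p y.1 y.2))
      (finSigmaFinEquiv (n := n)).symm).trans
      (Equiv.sigmaAssoc fun i a => Fin (p i a))).trans
      ((Equiv.sigmaCongrRight fun i => finSigmaFinEquiv (n := p i)).trans finSigmaFinEquiv)
  have hg (s b) : g ⟨s, b⟩ = finSigmaFinEquiv (n := fun i => ∑ a, p i a)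
        ⟨(finSigmaFinEquiv.symm s).1, finSigmaFinEquiv ⟨(finSigmaFinEquiv.symm s).2, b⟩⟩ := rfl
  refine (finEquiv_unique f g ?_ ⟨s, b⟩).trans (congrArg Fin.val (hg s b))
  rintro ⟨s, b⟩ ⟨s', b'⟩
  rw [hg, hg, finSigma_lt_iff, finSigma_lt_iff]
  have := finSigma_lex n p (finSigmaFinEquiv.symm s) (finSigmaFinEquiv.symm s') b b'
  rwa [Equiv.apply_symm_apply, Equiv.apply_symm_apply] at this

namespace CStarAlg

variable {κ : CStarTensor.{u}} (D : CStarAlg κ)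

lemma unitalHom_permPow {D : CStarAlg κ} (hD : ∃ e : D, IsOne e) {m n : ℕ} (e : Fin m ≃ Fin n) :
    UnitalHom (permPow D e) := by
  obtain ⟨x, hx⟩ := hD
  refine unitalHom_of_pow hx ?_
  rw [permPow_tprod]
  exact isOne_tprod fun _ => hx

lemma unitalHom_tensorMaps {D : CStarAlg κ} (hD : ∃ e : D, IsOne e) {k : ℕ} (n : Fin k → ℕ)
    (f : ∀ i, tpow D (n i) ⟶ D) (hf : ∀ i, UnitalHom (f i)) : UnitalHom (tensorMaps n f) := by
  obtain ⟨x, hx⟩ := hD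
  refine unitalHom_of_pow hx ?_
  rw [tensorMaps_tprod]
  exact isOne_tprod fun i => (hf i).isOne (isOne_tprod fun _ => hx)

lemma powOne_tprod {D : CStarAlg κ} (x : Fin 1 → D) : (powOne D).hom (tprod x) = x (Fin.last 0) := by
  change (λ_ D).hom (tmul uone _) = _
  rw [leftUnitor_tmul, scal_uone, one_smul]

/-- The identity of `D`, as a point of the operad. -/
def uOne {D : CStarAlg κ} (hD : ∃ e : D, IsOne e) : UHom D 1 :=
  ⟨(powOne D).hom, by
    obtain ⟨x, hx⟩ := hD
    refine unitalHom_of_pow hx ?_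
    rwa [powOne_tprod]⟩

lemma uOne_tprod {D : CStarAlg κ} (hD : ∃ e : D, IsOne e) (x : Fin 1 → D) :
    (uOne hD).1 (tprod x) = x (Fin.last 0) := powOne_tprod x

/-- The composition of the operad: `(α, β₁, …, β_k) ↦ α ∘ (β₁ ⊗ ⋯ ⊗ β_k)`. -/
def uComp {D : CStarAlg κ} (hD : ∃ e : D, IsOne e) {k : ℕ} (n : Fin k → ℕ) (c : UHom D k)
    (d : ∀ i, UHom D (n i)) : UHom D (∑ i, n i) :=
  ⟨tensorMaps n (fun i => (d i).1) ≫ c.1,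
    (unitalHom_tensorMaps hD n _ fun i => (d i).2).comp c.2⟩

/-- The action of the permutations on the tensor factors. -/
def uAct {D : CStarAlg κ} (hD : ∃ e : D, IsOne e) {m n : ℕ} (e : Fin m ≃ Fin n) (c : UHom D n) :
    UHom D m :=
  ⟨permPow D e ≫ c.1, (unitalHom_permPow hD e).comp c.2⟩

lemma uHom_ext {D : CStarAlg κ} {n : ℕ} {f g : UHom D n} (h : ∀ x, f.1 (tprod x) = g.1 (tprod x)) :
    f = g :=
  Subtype.ext (pow_ext h)

lemma uComp_tprod {D : CStarAlg κ} (hD : ∃ e : D, IsOne e) {k : ℕ} (n : Fin k → ℕ) (c : UHom D k)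
    (d : ∀ i, UHom D (n i)) (x : Fin (∑ i, n i) → D) :
    (uComp hD n c d).1 (tprod x) =
      c.1 (tprod fun i => (d i).1 (tprod fun a => x (finSigmaFinEquiv ⟨i, a⟩))) :=
  congrArg c.1 (tensorMaps_tprod n _ x)

lemma uAct_tprod {D : CStarAlg κ} (hD : ∃ e : D, IsOne e) {m n : ℕ} (e : Fin m ≃ Fin n)
    (c : UHom D n) (x : Fin m → D) :
    (uAct hD e c).1 (tprod x) = c.1 (tprod (x ∘ e.symm)) :=
  congrArg c.1 (permPow_tprod e x)

/-- The strongly self-absorbing `D`-operad. -/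
def dOperad (hD : IsStronglySelfAbsorbing D) : TopOperad.{u} where
  obj := UHom D
  isSpace j := have := hD.separable; isSpace_uHom D j
  act e c := uAct hD.unital e c
  act_cont e := Continuous.subtype_mk (continuous_comp continuous_const continuous_subtype_val) _
  act_refl c := uHom_ext fun x => by rw [uAct_tprod]; rfl
  act_trans e e' c := uHom_ext fun x => by
    rw [uAct_tprod, uAct_tprod, uAct_tprod]; rfl
  one := uOne hD.unital
  comp n c d := uComp hD.unital n c d
  comp_cont n := by
    refine KCont.of_continuous (Continuous.subtype_mk (continuous_comp
      (continuous_tensorMaps n fun i => ?_) (continuous_subtype_val.comp continuous_fst)) _)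
    exact continuous_subtype_val.comp ((continuous_apply i).comp continuous_snd)
  one_comp c := uHom_ext fun x => by
    rw [uComp_tprod, uAct_tprod, uOne_tprod]
    congr 2
    funext a
    refine congrArg x (Fin.ext ?_)
    rw [finSigmaFinEquiv_one]
    rfl
  comp_one {k} c := uHom_ext fun x => by
    rw [uComp_tprod, uAct_tprod]
    congr 2
    funext i
    rw [uOne_tprod]
    refine congrArg x (Fin.ext ?_)
    rw [finSigmaFinEquiv_apply]
    simp
  assoc n p c d b := uHom_ext fun x => by
    rw [uComp_tprod, uComp_tprod, uAct_tprod, uComp_tprod]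
    congr 2
    funext i
    rw [uComp_tprod]
    congr 2
    funext a
    let H : (Σ i, Fin (n i)) → D := fun y => (b y.1 y.2).1 (tprod fun β =>
      (x ∘ (finCongr (sum_finSigma n p)).symm) (finSigmaFinEquiv (n := fun i => ∑ a, p i a)
        ⟨y.1, finSigmaFinEquiv ⟨y.2, β⟩⟩))
    have hH (s : Fin (∑ i, n i)) : (b (finSigmaFinEquiv.symm s).1 (finSigmaFinEquiv.symm s).2).1
        (tprod fun β => x (finSigmaFinEquiv (n := fun s => p (finSigmaFinEquiv.symm s).1
          (finSigmaFinEquiv.symm s).2) ⟨s, β⟩)) = H (finSigmaFinEquiv.symm s) := by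
      simp only [H]
      congr 2
      funext β
      refine congrArg x (Fin.ext ?_)
      rw [finSigma_assoc]
      rfl
    rw [hH, Equiv.symm_apply_apply]
  equivariant_left e n c d := uHom_ext fun x => by
    rw [uComp_tprod, uAct_tprod, uAct_tprod, uComp_tprod]
    congr 2
    funext i
    obtain ⟨i', rfl⟩ := e.surjective i
    rw [Function.comp_apply, Equiv.symm_apply_apply]
    congr 2
    funext a
    refine congrArg x ?_
    rw [Equiv.eq_symm_apply]
    simp [blockPerm]
  equivariant_right {k m n} e c d := uHom_ext fun x => by
    rw [uComp_tprod, uAct_tprod, uComp_tprod]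
    congr 2
    funext i
    rw [uAct_tprod]
    congr 2
    funext a
    refine congrArg x ?_
    rw [Equiv.eq_symm_apply]
    simp [sumPerm]

end CStarAlg

/-! ### Algebras over operads and their modules -/

section Algebras

open Limits

variable {B : Type v} [Category.{u} B] [HasZeroMorphisms B] [PtTopCategory B]

/-- For `φ : C₊ ∧ X ⟶ Y` and a point `c` of `C`, the morphism `X ⟶ Y`, `x ↦ φ (c ∧ x)`. -/
def ClosedAction.evalAt (T : ClosedAction B) {C : Type u} [TopologicalSpace C] [IsSpace C] {X Y : B}
    (φ : (T.smash.obj (PtSpace.plus C)).obj X ⟶ Y) (c : C) : X ⟶ Y :=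
  T.eval φ (Sum.inl c)

/-- The isomorphism `X^{⊗ 0} ⊗ M ≅ M`. -/
def powZeroTensor {C : Type w₁} [Category.{w₂} C] [MonoidalCategory C] (X M : C) :
    tpow X 0 ⊗ M ≅ M := λ_ M

/-- The isomorphism `X^{⊗ (m + n)} ⊗ M ≅ X^{⊗ m} ⊗ (X^{⊗ n} ⊗ M)`. -/
def powAddTensor {C : Type w₁} [Category.{w₂} C] [MonoidalCategory C] (X M : C) (m n : ℕ) :
    tpow X (m + n) ⊗ M ≅ tpow X m ⊗ (tpow X n ⊗ M) :=
  whiskerRightIso (powAdd X m n) M ≪≫ α_ (tpow X m) (tpow X n) M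

/-- The extension of a bijection that matches the last elements. -/
def extendLast {m n : ℕ} (e : Fin m ≃ Fin n) : Fin (m + 1) ≃ Fin (n + 1) :=
  finSuccEquivLast.trans (e.optionCongr.trans finSuccEquivLast.symm)

variable [MonoidalCategory B] [SymmetricCategory B]

/-- The structure of an algebra over the operad `O` on the object `X`: morphisms
`θ : O(j)₊ ∧ X^{∧ j} ⟶ X` that are unital, associative and equivariant. As morphisms out of
`O(j)₊ ∧ Y` are determined by their values at the points of `O(j)`, the axioms are stated at
points. -/
structure OperadAlgebra (T : ClosedAction B) (O : TopOperad.{u}) (X : B) where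
  θ : ∀ j, (T.smash.obj (PtSpace.plus (O.obj j))).obj (tpow X j) ⟶ X
  unit : T.evalAt (θ 1) O.one = (powOne X).hom
  assoc : ∀ {k : ℕ} (n : Fin k → ℕ) (c : O.obj k) (d : ∀ i, O.obj (n i)),
    T.evalAt (θ (∑ i, n i)) (O.comp n c d) =
      tensorMaps n (fun i => T.evalAt (θ (n i)) (d i)) ≫ T.evalAt (θ k) c
  equivariant : ∀ {m n : ℕ} (e : Fin m ≃ Fin n) (c : O.obj n),
    T.evalAt (θ m) (O.act e c) = permPow X e ≫ T.evalAt (θ n) c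

/-- The structure of a module over the `O`-algebra `X` on the object `M`: morphisms
`lam : O(n + 1)₊ ∧ (X^{∧ n} ∧ M) ⟶ M` that are unital, associative and equivariant for the
permutations of the first `n` factors. -/
structure OperadModule {T : ClosedAction B} {O : TopOperad.{u}} {X : B} (alg : OperadAlgebra T O X)
    (M : B) where
  lam : ∀ n, (T.smash.obj (PtSpace.plus (O.obj (n + 1)))).obj (tpow X n ⊗ M) ⟶ M
  unit : T.evalAt (lam 0) O.one = (powZeroTensor X M).hom
  assoc : ∀ {k m : ℕ} (n : Fin (k + 1) → ℕ) (h : n (Fin.last k) = m + 1) (c : O.obj (k + 1))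
    (d : ∀ i, O.obj (n i)),
    T.evalAt (lam ((∑ i : Fin k, n i.castSucc) + m))
        (O.act (finCongr (by rw [Fin.sum_univ_castSucc, h, add_assoc])) (O.comp n c d)) =
      (powAddTensor X M (∑ i : Fin k, n i.castSucc) m).hom ≫
        (tensorMaps (fun i : Fin k => n i.castSucc)
            (fun i => T.evalAt (alg.θ (n i.castSucc)) (d i.castSucc)) ⊗ₘ
          T.evalAt (lam m) (O.act (finCongr h.symm) (d (Fin.last k)))) ≫
        T.evalAt (lam k) c
  equivariant : ∀ {m n : ℕ} (e : Fin m ≃ Fin n) (c : O.obj (n + 1)),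
    T.evalAt (lam m) (O.act (extendLast e) c) = (permPow X e ▷ M) ≫ T.evalAt (lam n) c

end Algebras

/-! ### Lax monoidal and enriched functors -/

section Functors

open Limits Functor.LaxMonoidal

/-- The canonical morphism `F(X)^{⊗ n} ⟶ F(X^{⊗ n})` of a lax monoidal functor. -/
def powMu {C : Type w} [Category.{w'} C] [MonoidalCategory C] {E : Type w₁} [Category.{w₂} E]
    [MonoidalCategory E] (F : C ⥤ E) [F.LaxMonoidal] (X : C) :
    ∀ n, tpow (F.obj X) n ⟶ F.obj (tpow X n)
  | 0 => ε F
  | n + 1 => (powMu F X n ▷ F.obj X) ≫ μ F (tpow X n) X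

/-- `F` is an enriched functor on the subcategory `U` of the category of C*-algebras: it is
continuous on the spaces of morphisms, whose topology is the (`k`-ification of the) point-norm
topology. (Zero morphisms need not be preserved, so pointed enriched functors are included.) -/
def IsEnriched {κ : CStarTensor.{u}} {C : Type w} [Category.{w'} C] (U : C ⥤ CStarAlg κ)
    {B : Type v} [Category.{u} B] [HasZeroMorphisms B] [PtTopCategory B] (F : C ⥤ B) : Prop :=
  ∀ X Y : C, @KCont.{u} (X ⟶ Y) (F.obj X ⟶ F.obj Y)
    (TopologicalSpace.induced (fun f => U.map f) (CStarAlg.pointNorm (U.obj X) (U.obj Y)))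
    inferInstance (fun f => F.map f)

end Functors

end

noncomputable section

open Functor.LaxMonoidal

/-! ### Compatibilities with the structure morphisms of a lax monoidal functor -/

section LaxSquares

variable {C : Type w} [Category.{w'} C] [MonoidalCategory C] {E : Type w₁} [Category.{w₂} E]
  [MonoidalCategory E] (F : C ⥤ E)

/-! A lax symmetric monoidal functor carries the endomorphism operad of an object to that of its
image. The iterated structure map `powMu F X n : F(X)^{⊗ n} ⟶ F(X^{⊗ n})` turns an operation `g :
D^{⊗ j} ⟶ D` into `powMu F D j ≫ F.map g`. This assignment respects units, composition and
permutations because `powMu` does: each construction `a` on tensor powers (reassociation, blockwise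
tensor products, permutations of factors) satisfies a square `a' ≫ q = p ≫ F.map a`, where `a'` is
the same construction on the powers of `F(X)` and `p`, `q` are structure maps. The squares
`tensorMaps_powMu` and `permPow_powMu` carry the algebraic part. Both go by induction on the number
of factors, and `id_comp_eq_comp_map_id` is the degenerate square that starts or closes several of
these inductions.

The points of the `D`-operad are homomorphisms of C*-algebras, whereas `F` is defined on `C`. Since
`U` is strong monoidal, `powMu U D j` is invertible, and since `U` is faithful, each point has
exactly one preimage `uLift` in `C`. The same squares, applied to `U` instead of `F`, show that
`uLift` respects the operad structure (`uLift_uOne`, `uLift_uAct`, `uLift_uComp`).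

For the topology, a morphism `Z₊ ∧ X ⟶ Y` is the same as a continuous family of morphisms `X ⟶ Y`
indexed by `Z` (`ClosedAction.ofFamily`). So the structure morphisms exist as soon as `f ↦ powMu F D
j ≫ F.map (uLift f)` is continuous, and the axioms can be checked point by point. Continuity follows
from the enrichment of `F`, as `U.map (uLift f)` is `f` preceded by a fixed isomorphism.

The module `F(D ⊗ A)` arises in the same way from the operations `g ▷ A`; its associativity is
`lax_module_assoc`. The module structure on `F(A ⊗ D)` is transported along the image of the
braiding. -/

lemma id_comp_eq_comp_map_id {S : E} {T : C} (f : S ⟶ F.obj T) : 𝟙 S ≫ f = f ≫ F.map (𝟙 T) := by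
  simp

variable [F.LaxMonoidal]

/-- Right unitality of `F`. This is the case of an empty second block in `powAdd_powMu`, where
`powAdd` is an inverse right unitor. -/
lemma rightUnitor_inv_lax {P' : E} {P : C} (p : P' ⟶ F.obj P) :
    (ρ_ P').inv ≫ (p ⊗ₘ ε F) ≫ μ F P (𝟙_ C) = p ≫ F.map (ρ_ P).inv := by
  rw [← right_unitality_inv F P, MonoidalCategory.tensorHom_def, Category.assoc,
    rightUnitor_inv_naturality_assoc]

/-- Associativity of `μ`, after naturality of the associator has moved `p`, `q` and `r` to the
front. -/
lemma associator_lax {P' Q' R' : E} {P Q R : C} (p : P' ⟶ F.obj P) (q : Q' ⟶ F.obj Q)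
    (r : R' ⟶ F.obj R) :
    (α_ P' Q' R').hom ≫ (p ⊗ₘ ((q ⊗ₘ r) ≫ μ F Q R)) ≫ μ F P (Q ⊗ R) =
      (((p ⊗ₘ q) ≫ μ F P Q) ⊗ₘ r) ≫ μ F (P ⊗ Q) R ≫ F.map (α_ P Q R).hom := by
  have h1 : (p ⊗ₘ ((q ⊗ₘ r) ≫ μ F Q R)) = (p ⊗ₘ (q ⊗ₘ r)) ≫ (F.obj P ◁ μ F Q R) := by
    rw [← id_tensorHom, tensorHom_comp_tensorHom, Category.comp_id]
  have h2 : (((p ⊗ₘ q) ≫ μ F P Q) ⊗ₘ r) = ((p ⊗ₘ q) ⊗ₘ r) ≫ (μ F P Q ▷ F.obj R) := by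
    rw [← tensorHom_id, tensorHom_comp_tensorHom, Category.comp_id]
  rw [h1, h2, Category.assoc, Category.assoc, associativity, ← associator_naturality_assoc]

/-- The inductive step of `powAdd_powMu`: a splitting `a` of a power, compatible with the structure
maps, remains compatible after one more factor `X` has joined the second block. The module proof
uses it again with `X ⊗ A` as the extra factor. -/
lemma whiskerRight_associator_lax {S' P' Q' : E} {S P Q X : C} {a' : S' ⟶ P' ⊗ Q'} {a : S ⟶ P ⊗ Q}
    {s : S' ⟶ F.obj S} {p : P' ⟶ F.obj P} {q : Q' ⟶ F.obj Q}
    (h : a' ≫ (p ⊗ₘ q) ≫ μ F P Q = s ≫ F.map a) :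
    ((a' ▷ F.obj X) ≫ (α_ P' Q' (F.obj X)).hom) ≫ (p ⊗ₘ ((q ▷ F.obj X) ≫ μ F Q X)) ≫
        μ F P (Q ⊗ X) =
      ((s ▷ F.obj X) ≫ μ F S X) ≫ F.map ((a ▷ X) ≫ (α_ P Q X).hom) := by
  rw [Category.assoc, ← tensorHom_id q, associator_lax, tensorHom_id, ← comp_whiskerRight_assoc, h,
    comp_whiskerRight_assoc, μ_natural_left_assoc, F.map_comp, Category.assoc]

lemma tensorHom_lax {P' Q' Y' Z' : E} {P Q Y Z : C} {p : P' ⟶ F.obj P} {q : Q' ⟶ F.obj Q}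
    {y : Y' ⟶ F.obj Y} {z : Z' ⟶ F.obj Z} {t' : P' ⟶ Y'} {t : P ⟶ Y} {f' : Q' ⟶ Z'} {f : Q ⟶ Z}
    (ht : t' ≫ y = p ≫ F.map t) (hf : f' ≫ z = q ≫ F.map f) :
    (t' ⊗ₘ f') ≫ (y ⊗ₘ z) ≫ μ F Y Z = ((p ⊗ₘ q) ≫ μ F P Q) ≫ F.map (t ⊗ₘ f) := by
  rw [tensorHom_comp_tensorHom_assoc, ht, hf, ← tensorHom_comp_tensorHom_assoc, μ_natural,
    Category.assoc]

/-- The inductive step of `tensorMaps_powMu`, following the three stages of `tensorMaps`: cast of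
the exponent (`c`), splitting off the last block (`a`), and the tensor product of the earlier maps
(`t`) with the last one (`f`). The last map already ends in `F.obj Z`, so its square closes with an
identity. -/
lemma comp_tensorHom_lax {T' S' P' Q' Y' : E} {T S P Q Y Z : C} {c' : T' ⟶ S'} {c : T ⟶ S}
    {a' : S' ⟶ P' ⊗ Q'} {a : S ⟶ P ⊗ Q} {τ : T' ⟶ F.obj T} {s : S' ⟶ F.obj S}
    {p : P' ⟶ F.obj P} {q : Q' ⟶ F.obj Q} {y : Y' ⟶ F.obj Y} {t' : P' ⟶ Y'} {t : P ⟶ Y}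
    (f : Q ⟶ Z) (hc : c' ≫ s = τ ≫ F.map c) (ha : a' ≫ (p ⊗ₘ q) ≫ μ F P Q = s ≫ F.map a)
    (ht : t' ≫ y = p ≫ F.map t) :
    (c' ≫ a' ≫ (t' ⊗ₘ (q ≫ F.map f))) ≫ (y ▷ F.obj Z) ≫ μ F Y Z =
      τ ≫ F.map (c ≫ a ≫ (t ⊗ₘ f)) := by
  have h := tensorHom_lax F (z := 𝟙 (F.obj Z)) ht (Category.comp_id (q ≫ F.map f))
  rw [tensorHom_id] at h
  simp only [Category.assoc] at h ⊢
  rw [h, reassoc_of% ha, reassoc_of% hc, F.map_comp, F.map_comp]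

/-- The inductive step of `permPow_powMu`: `a` permutes all factors but the last, and `i` inserts
the last one. -/
lemma whiskerRight_comp_lax {P' Q' R' : E} {P Q R X : C} {p : P' ⟶ F.obj P} {q : Q' ⟶ F.obj Q}
    {r : R' ⟶ F.obj R} {a' : P' ⟶ Q'} {a : P ⟶ Q} {i' : Q' ⊗ F.obj X ⟶ R'} {i : Q ⊗ X ⟶ R}
    (ha : a' ≫ q = p ≫ F.map a) (hi : i' ≫ r = ((q ▷ F.obj X) ≫ μ F Q X) ≫ F.map i) :
    ((a' ▷ F.obj X) ≫ i') ≫ r = ((p ▷ F.obj X) ≫ μ F P X) ≫ F.map ((a ▷ X) ≫ i) := by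
  rw [Category.assoc, hi, Category.assoc, ← comp_whiskerRight_assoc, ha, comp_whiskerRight_assoc,
    μ_natural_left_assoc, F.map_comp, Category.assoc]

end LaxSquares

/-- The inductive step of `insertFactor_powMu`: the new factor is exchanged with its neighbour and
then inserted further to the left by `i`. Here, and only here, the compatibility of `F` with the
braidings enters; associativity of `μ` in both directions brings the two factors next to each other.
-/
lemma braiding_comp_lax {C : Type w} [Category.{w'} C] [MonoidalCategory C] [BraidedCategory C]
    {E : Type w₁} [Category.{w₂} E] [MonoidalCategory E] [BraidedCategory E] (F : C ⥤ E)
    [F.LaxBraided] {P' Q' : E} {P Q X : C} {p : P' ⟶ F.obj P} {q : Q' ⟶ F.obj Q}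
    {i' : P' ⊗ F.obj X ⟶ Q'} {i : P ⊗ X ⟶ Q}
    (hi : i' ≫ q = ((p ▷ F.obj X) ≫ μ F P X) ≫ F.map i) :
    ((α_ P' (F.obj X) (F.obj X)).hom ≫ (P' ◁ (β_ (F.obj X) (F.obj X)).hom) ≫
        (α_ P' (F.obj X) (F.obj X)).inv ≫ (i' ▷ F.obj X)) ≫ (q ▷ F.obj X) ≫ μ F Q X =
      ((((p ▷ F.obj X) ≫ μ F P X) ▷ F.obj X) ≫ μ F (P ⊗ X) X) ≫
        F.map ((α_ P X X).hom ≫ (P ◁ (β_ X X).hom) ≫ (α_ P X X).inv ≫ (i ▷ X)) := by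
  have a := associativity F P X X
  have a' := associativity_inv F P X X
  have b := Functor.LaxBraided.braided (F := F) X X
  have h := congrArg (· ▷ F.obj X) hi
  simp only [Category.assoc, F.map_comp, comp_whiskerRight] at h ⊢
  -- After the square for `i`, `a` exposes `μ F X X` beside `F.map (β_ X X).hom`, `b` moves the
  -- braiding across it, and `a'` restores the left bracketing.
  rw [reassoc_of% h, reassoc_of% a, ← μ_natural_right_assoc, ← whiskerLeft_comp_assoc, b,
    whiskerLeft_comp_assoc, reassoc_of% a', ← μ_natural_left, associator_naturality_left_assoc,
    ← whisker_exchange_assoc, associator_inv_naturality_left_assoc]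

/-! ### Tensor powers and lax monoidal functors -/

section TensorPowers

variable {C : Type w} [Category.{w'} C] [MonoidalCategory C] {E : Type w₁} [Category.{w₂} E]
  [MonoidalCategory E]

lemma powMu_powOne (F : C ⥤ E) [F.LaxMonoidal] (X : C) :
    powMu F X 1 ≫ F.map (powOne X).hom = (powOne (F.obj X)).hom :=
  (Category.assoc _ _ _).trans (left_unitality F X).symm

lemma powCast_powMu (F : C ⥤ E) [F.LaxMonoidal] (X : C) {m n : ℕ} (h : m = n) :
    (powCast (F.obj X) h).hom ≫ powMu F X n = powMu F X m ≫ F.map (powCast X h).hom := by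
  subst h
  exact id_comp_eq_comp_map_id F _

lemma powAdd_powMu (F : C ⥤ E) [F.LaxMonoidal] (X : C) (m : ℕ) : ∀ n : ℕ,
    (powAdd (F.obj X) m n).hom ≫ (powMu F X m ⊗ₘ powMu F X n) ≫ μ F (tpow X m) (tpow X n) =
      powMu F X (m + n) ≫ F.map (powAdd X m n).hom
  | 0 => rightUnitor_inv_lax F (powMu F X m)
  | n + 1 => whiskerRight_associator_lax F (powAdd_powMu F X m n)

/-- Compatibility with operadic composition: operations `powMu ≫ F.map (f i)`, tensored together,
are the operation that belongs to `f₁ ⊗ ⋯ ⊗ f_k`. It serves both for `F`, in the axioms of the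
algebra and of the module, and for `U`, in the lifting of the operad to `C`. -/
lemma tensorMaps_powMu (F : C ⥤ E) [F.LaxMonoidal] {X Y : C} : ∀ {k : ℕ} (n : Fin k → ℕ)
    (f : ∀ i, tpow X (n i) ⟶ Y),
    tensorMaps n (fun i => powMu F X (n i) ≫ F.map (f i)) ≫ powMu F Y k =
      powMu F X (∑ i, n i) ≫ F.map (tensorMaps n f)
  | 0, n, f => powCast_powMu F X (Fin.sum_univ_zero n)
  | k + 1, n, f => comp_tensorHom_lax F (f (Fin.last k)) (powCast_powMu F X _)
      (powAdd_powMu F X _ _) (tensorMaps_powMu F (fun i => n i.castSucc) fun i => f i.castSucc)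

instance isIso_powMu (F : C ⥤ E) [F.Monoidal] (X : C) : ∀ n : ℕ, IsIso (powMu F X n)
  | 0 => inferInstanceAs (IsIso (ε F))
  | n + 1 =>
    have := isIso_powMu F X n
    inferInstanceAs (IsIso ((powMu F X n ▷ F.obj X) ≫ μ F (tpow X n) X))

end TensorPowers

/-! ### Permutations of the tensor factors -/

section Permutations

variable {C : Type w} [Category.{w'} C] [MonoidalCategory C] [SymmetricCategory C]
  {E : Type w₁} [Category.{w₂} E] [MonoidalCategory E] [SymmetricCategory E]

lemma insertFactor_powMu (F : C ⥤ E) [F.LaxBraided] (X : C) : ∀ {n : ℕ} (p : Fin (n + 1)),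
    insertFactor (F.obj X) p ≫ powMu F X (n + 1) =
      ((powMu F X n ▷ F.obj X) ≫ μ F (tpow X n) X) ≫ F.map (insertFactor X p)
  | 0, _ => id_comp_eq_comp_map_id F _
  | n + 1, p => by
    induction p using Fin.lastCases with
    | last =>
      rw [insertFactor_last, insertFactor_last]
      exact id_comp_eq_comp_map_id F _
    | cast q =>
      rw [insertFactor_castSucc, insertFactor_castSucc]
      exact braiding_comp_lax F (insertFactor_powMu F X q)

lemma permPow_powMu (F : C ⥤ E) [F.LaxBraided] (X : C) : ∀ {m n : ℕ} (e : Fin m ≃ Fin n),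
    permPow (F.obj X) e ≫ powMu F X n = powMu F X m ≫ F.map (permPow X e)
  | 0, 0, _ => id_comp_eq_comp_map_id F _
  | 0, _ + 1, e => (e.symm 0).elim0
  | _ + 1, 0, e => (e 0).elim0
  | m + 1, n + 1, e => whiskerRight_comp_lax F (permPow_powMu F X (dropLast e))
      (insertFactor_powMu F X (e (Fin.last m)))

lemma extendLast_last {m n : ℕ} (e : Fin m ≃ Fin n) :
    extendLast e (Fin.last m) = Fin.last n := by
  simp [extendLast]

lemma extendLast_castSucc {m n : ℕ} (e : Fin m ≃ Fin n) (i : Fin m) :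
    extendLast e i.castSucc = (e i).castSucc := by
  simp [extendLast]

/-- By `dropLast_spec`, `dropLast` is determined by `succAbove` at the image of the last element.
That image is again the last element, where `succAbove` is `castSucc`. -/
lemma dropLast_extendLast {m n : ℕ} (e : Fin m ≃ Fin n) : dropLast (extendLast e) = e := by
  ext i : 1
  have h := CStarAlg.dropLast_spec (extendLast e) i
  rw [extendLast_last, extendLast_castSucc, Fin.succAbove_last] at h
  exact Fin.castSucc_injective _ h

lemma extendLast_refl (n : ℕ) : extendLast (Equiv.refl (Fin n)) = Equiv.refl _ := by
  ext i : 1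
  induction i using Fin.lastCases with
  | last => exact extendLast_last _
  | cast i => exact extendLast_castSucc _ i

/-- Module equivariance concerns permutations that fix the last factor, the one replaced by the
module. They act only on the remaining factors. -/
lemma permPow_extendLast (X : C) {m n : ℕ} (e : Fin m ≃ Fin n) :
    permPow X (extendLast e) = permPow X e ▷ X := by
  change (permPow X (dropLast (extendLast e)) ▷ X) ≫ insertFactor X (extendLast e (Fin.last m)) = _
  rw [dropLast_extendLast, extendLast_last, insertFactor_last]
  exact Category.comp_id _

lemma permPow_refl (X : C) : ∀ n : ℕ, permPow X (Equiv.refl (Fin n)) = 𝟙 _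
  | 0 => rfl
  | n + 1 => by
    rw [← extendLast_refl, permPow_extendLast, permPow_refl X n]
    exact id_whiskerRight _ _

/-- The operad axioms express equalities of exponents through the action of `finCongr`; on tensor
powers this action is mere transport. -/
lemma permPow_finCongr (X : C) {m n : ℕ} (h : m = n) :
    permPow X (finCongr h) = (powCast X h).hom := by
  subst h
  exact permPow_refl X m

end Permutations

/-! ### Continuity -/

/-- Continuity on a compactly generated domain is tested on maps `s` from compact Hausdorff spaces
`S`. Each composite `g ∘ s` is one of the test maps that define the `k`-ification of `Y`, hence
continuous into it, and `hf` applies. -/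
lemma KCont.comp_continuous {X Z : Type u} {Y : Type w} [TopologicalSpace X]
    [CompactlyGeneratedSpace X] [TopologicalSpace Z] [TopologicalSpace Y] {f : Y → Z}
    (hf : KCont.{u} f) {g : X → Y} (hg : Continuous g) : Continuous (f ∘ g) := by
  refine continuous_from_uCompactlyGeneratedSpace _ fun S s => ?_
  rw [Function.comp_assoc]
  refine @Continuous.comp _ _ _ _ (compactlyGenerated.{u} Y) _ _ _ hf ?_
  -- The topology of the `k`-ification is coinduced by `j`, the sum of all test maps, so `j` is
  -- continuous on each summand.
  let j : (Σ (i : (T : CompHaus.{u}) × C(T, Y)), i.fst) → Y := fun ⟨⟨_, i⟩, s⟩ ↦ i s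
  have h : ∀ i : (T : CompHaus.{u}) × C(T, Y),
      @Continuous _ _ _ (compactlyGenerated.{u} Y) fun a : i.fst => j ⟨i, a⟩ := by
    rw [← @continuous_sigma_iff]
    exact continuous_coinduced_rng
  exact h ⟨S, ⟨g ∘ s, hg.comp s.2⟩⟩

/-! ### Morphisms out of `Z₊ ∧ X` as continuous families of morphisms -/

section Pointed

variable {B : Type v} [Category.{u} B] [Limits.HasZeroMorphisms B] [PtTopCategory B]

/-- Composition in `B` is continuous only on the `k`-ified product of morphism spaces. This suffices
because the parameter space `Z` is compactly generated. -/
lemma continuous_comp_const {Z : Type u} [TopologicalSpace Z] [IsSpace Z] {X Y Y' X' : B}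
    {F : Z → (X ⟶ Y)} (hF : Continuous F) (g : X' ⟶ X) (h : Y ⟶ Y') :
    Continuous fun z => g ≫ F z ≫ h := by
  have := IsSpace.cg (X := Z)
  have h1 : Continuous fun z => F z ≫ h :=
    (PtTopCategory.comp_cont X Y Y').comp_continuous (hF.prodMk continuous_const)
  exact (PtTopCategory.comp_cont X' X Y').comp_continuous (continuous_const.prodMk h1)

/-- The morphism `Z₊ ∧ X ⟶ Y` with the values `F z`. -/
def ClosedAction.ofFamily (T : ClosedAction B) {Z : Type u} [TopologicalSpace Z] [IsSpace Z]
    {X Y : B} (F : Z → (X ⟶ Y)) (hF : Continuous F) :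
    (T.smash.obj (PtSpace.plus Z)).obj X ⟶ Y :=
  (T.adj (PtSpace.plus Z) X Y).symm
    -- The added base point has to go to the base point of `Map(X, Y)`, the zero morphism. It is
    -- isolated, so it imposes no condition on `F`.
    ⟨⟨Sum.elim F fun _ => (0 : X ⟶ Y), continuous_sum_dom.2 ⟨hF, continuous_const⟩⟩, rfl⟩

lemma ClosedAction.evalAt_ofFamily (T : ClosedAction B) {Z : Type u} [TopologicalSpace Z]
    [IsSpace Z] {X Y : B} (F : Z → (X ⟶ Y)) (hF : Continuous F) (z : Z) :
    T.evalAt (T.ofFamily F hF) z = F z := by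
  exact congrArg (fun f : PtSpace.Map (PtSpace.plus Z) (mapSpace X Y) => f.value (Sum.inl z))
    ((T.adj (PtSpace.plus Z) X Y).apply_symm_apply _)

/-- Naturality of the adjunction with the pointed space held fixed. It reduces the axioms of a
transported module to identities at points. -/
lemma ClosedAction.evalAt_map_comp (T : ClosedAction B) {Z : Type u} [TopologicalSpace Z]
    [IsSpace Z] {X X' Y Y' : B} (g : X ⟶ X')
    (φ : (T.smash.obj (PtSpace.plus Z)).obj X' ⟶ Y) (h : Y ⟶ Y') (z : Z) :
    T.evalAt ((T.smash.obj (PtSpace.plus Z)).map g ≫ φ ≫ h) z = g ≫ T.evalAt φ z ≫ h := by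
  have := T.adj_nat (𝟙 (PtSpace.plus Z)) g φ h (Sum.inl z)
  rw [T.smash.map_id, NatTrans.id_app, Category.id_comp] at this
  exact this

end Pointed

/-! ### Modules over algebras over an operad -/

section OperadModules

variable {C : Type w} [Category.{w'} C] [MonoidalCategory C]

/-- The length `p` of the last block is a variable here so that `subst` can eliminate it; in the
application it is `n (Fin.last k)`. -/
lemma powCast_comp_powAdd_tensorHom {X Y Z : C} {N m p : ℕ} (h : p = m + 1)
    (e : N + (m + 1) = N + p) (t : tpow X N ⟶ Z) (φ : tpow X p ⟶ Y) :
    (powCast X e).hom ≫ (powAdd X N p).hom ≫ (t ⊗ₘ φ) =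
      (powAdd X N (m + 1)).hom ≫ (t ⊗ₘ ((powCast X h.symm).hom ≫ φ)) := by
  subst h
  have hc (k : ℕ) : (powCast X (rfl : k = k)).hom = 𝟙 _ := rfl
  rw [hc, hc, Category.id_comp, Category.id_comp]

/-- The module axiom needs the last block in the form `m + 1`, so that its last factor can be split
off and replaced by the module. The cast in front of the whole power is therefore pushed into the
last block. -/
lemma powCast_comp_tensorMaps {X Y : C} {k m : ℕ} (n : Fin (k + 1) → ℕ)
    (h : n (Fin.last k) = m + 1) (e : (∑ i : Fin k, n i.castSucc) + (m + 1) = ∑ i, n i)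
    (f : ∀ i, tpow X (n i) ⟶ Y) :
    (powCast X e).hom ≫ tensorMaps n f = (powAdd X (∑ i : Fin k, n i.castSucc) (m + 1)).hom ≫
      (tensorMaps (fun i => n i.castSucc) (fun i => f i.castSucc) ⊗ₘ
        ((powCast X h.symm).hom ≫ f (Fin.last k))) := by
  rw [← powCast_comp_powAdd_tensorHom h (e.trans (Fin.sum_univ_castSucc n))]
  -- Two successive casts; the second is the one that `tensorMaps` begins with, so the remaining
  -- identity is its definition.
  have hc : (powCast X (e.trans (Fin.sum_univ_castSucc n))).hom =
      (powCast X e).hom ≫ (powCast X (Fin.sum_univ_castSucc n)).hom := by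
    simp [powCast]
  rw [hc, Category.assoc]
  rfl

/-- The part of module associativity that does not involve `F`: operations on `X` act on `X ⊗ A`
through the factor `X`, and composing these actions is the same as composing the operations and then
tensoring with `A`. -/
lemma associator_inv_whiskerRight_assoc {S P Q X A K : C} (a : S ⟶ P ⊗ Q) (t : P ⟶ K)
    (g : Q ⊗ X ⟶ X) (c : K ⊗ X ⟶ X) :
    ((a ▷ (X ⊗ A)) ≫ (α_ P Q (X ⊗ A)).hom) ≫ (t ⊗ₘ ((α_ Q X A).inv ≫ (g ▷ A))) ≫
        (α_ K X A).inv ≫ (c ▷ A) =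
      (α_ S X A).inv ≫ ((((a ▷ X) ≫ (α_ P Q X).hom) ≫ (t ⊗ₘ g) ≫ c) ▷ A) := by
  simp [MonoidalCategory.tensorHom_def]

/-- Module associativity in terms of the two squares on which it depends. In the application `X` is
`D`; `P`, `Q` and `K` are its powers with exponents `N`, `m` and `k`; `a` splits the power with
exponent `N + m`; `t` is the tensor product of the first `k` inner operations, `g` the last inner
operation and `c` the outer one. On the right, `c` and `g` act on `F(X ⊗ A)` separately; on the
left, their composite acts at once. -/
lemma lax_module_assoc {E : Type w₁} [Category.{w₂} E] [MonoidalCategory E] (F : C ⥤ E)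
    [F.LaxMonoidal] {S' P' Q' K' : E} {S P Q X A K : C} {a' : S' ⟶ P' ⊗ Q'} {a : S ⟶ P ⊗ Q}
    {s : S' ⟶ F.obj S} {p : P' ⟶ F.obj P} {q : Q' ⟶ F.obj Q} {y : K' ⟶ F.obj K} {t' : P' ⟶ K'}
    {t : P ⟶ K} (g : Q ⊗ X ⟶ X) (c : K ⊗ X ⟶ X)
    (ha : a' ≫ (p ⊗ₘ q) ≫ μ F P Q = s ≫ F.map a) (ht : t' ≫ y = p ≫ F.map t) :
    (s ▷ F.obj (X ⊗ A)) ≫ μ F S (X ⊗ A) ≫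
        F.map ((α_ S X A).inv ≫ ((((a ▷ X) ≫ (α_ P Q X).hom) ≫ (t ⊗ₘ g) ≫ c) ▷ A)) =
      ((a' ▷ F.obj (X ⊗ A)) ≫ (α_ P' Q' (F.obj (X ⊗ A))).hom) ≫
        (t' ⊗ₘ ((q ▷ F.obj (X ⊗ A)) ≫ μ F Q (X ⊗ A) ≫ F.map ((α_ Q X A).inv ≫ (g ▷ A)))) ≫
        (y ▷ F.obj (X ⊗ A)) ≫ μ F K (X ⊗ A) ≫ F.map ((α_ K X A).inv ≫ (c ▷ A)) := by
  have h1 := whiskerRight_associator_lax F (X := X ⊗ A) ha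
  -- The exponents already agree, so the cast `c` is an identity. The last block is `Q ⊗ (X ⊗ A)`,
  -- on which `g` acts through the factor `X`.
  have h2 := comp_tensorHom_lax F (c' := 𝟙 _) (c := 𝟙 _) ((α_ Q X A).inv ≫ (g ▷ A))
    (id_comp_eq_comp_map_id F _) h1 ht
  rw [Category.id_comp, Category.id_comp] at h2
  have h3 := congrArg (· ≫ F.map ((α_ K X A).inv ≫ (c ▷ A))) h2
  simp only [Category.assoc] at h3
  rw [← associator_inv_whiskerRight_assoc]
  simp only [Category.assoc]
  rw [h3]
  simp only [F.map_comp, Category.assoc]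

/-! ### Transport of module structures along isomorphisms -/

variable {B : Type v} [Category.{u} B] [Limits.HasZeroMorphisms B] [PtTopCategory B]
  [MonoidalCategory B] [SymmetricCategory B]

/-- The module structure on an object isomorphic to a module. -/
def OperadModule.ofIso {T : ClosedAction B} {O : TopOperad.{u}} {X : B} {alg : OperadAlgebra T O X}
    {M N : B} (L : OperadModule alg M) (i : N ≅ M) : OperadModule alg N where
  lam n := (T.smash.obj _).map (tpow X n ◁ i.hom) ≫ L.lam n ≫ i.inv
  unit := by
    rw [T.evalAt_map_comp, L.unit]
    change (𝟙_ B ◁ i.hom) ≫ (λ_ M).hom ≫ i.inv = (λ_ N).hom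
    simp
  assoc {k m} n h c d := by
    rw [T.evalAt_map_comp, T.evalAt_map_comp, T.evalAt_map_comp, L.assoc n h c d]
    -- The `i.inv` that ends the inner operation cancels against the `i.hom` that precedes the outer
    -- one.
    have key {S P Q K : B} (a : S ⟶ P ⊗ Q) (t : P ⟶ K) (l : Q ⊗ M ⟶ M) (r : K ⊗ M ⟶ M) :
        (S ◁ i.hom) ≫ (((a ▷ M) ≫ (α_ P Q M).hom) ≫ (t ⊗ₘ l) ≫ r) ≫ i.inv =
        ((a ▷ N) ≫ (α_ P Q N).hom) ≫ (t ⊗ₘ ((Q ◁ i.hom) ≫ l ≫ i.inv)) ≫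
          (K ◁ i.hom) ≫ r ≫ i.inv := by
      simp [MonoidalCategory.tensorHom_def', whisker_exchange_assoc]
    exact key _ _ _ _
  equivariant e c := by
    rw [T.evalAt_map_comp, T.evalAt_map_comp, L.equivariant, Category.assoc,
      whisker_exchange_assoc]

lemma OperadModule.evalAt_ofIso {T : ClosedAction B} {O : TopOperad.{u}} {X : B}
    {alg : OperadAlgebra T O X} {M N : B} (L : OperadModule alg M) (i : N ≅ M) (n : ℕ)
    (c : O.obj (n + 1)) :
    T.evalAt ((L.ofIso i).lam n) c = (tpow X n ◁ i.hom) ≫ T.evalAt (L.lam n) c ≫ i.inv :=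
  T.evalAt_map_comp _ _ _ _

end OperadModules

/-! ### The points of the operad as morphisms of the subcategory -/

/-- As `U` is strong monoidal, `U.map (G z ▷ A)` is `U.map (G z) ⊗ₘ 𝟙` between fixed isomorphisms,
and tensoring with an identity is continuous in the point-norm topology. -/
lemma continuous_map_comp_whiskerRight {κ : CStarTensor.{u}} {C : Type w} [Category.{w'} C]
    [MonoidalCategory C] {U : C ⥤ CStarAlg κ} [U.Monoidal] {Z : Type*} [TopologicalSpace Z]
    {P Q R : C} {G : Z → (P ⟶ Q)} (hG : Continuous fun z => U.map (G z)) (A : C) (a : R ⟶ P ⊗ A) :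
    Continuous fun z => U.map (a ≫ (G z ▷ A)) := by
  simp only [U.map_comp, Functor.Monoidal.map_whiskerRight]
  refine CStarAlg.continuous_comp continuous_const (CStarAlg.continuous_comp continuous_const
    (CStarAlg.continuous_comp ?_ continuous_const))
  simp only [← tensorHom_id]
  exact CStarAlg.continuous_tensorHom hG continuous_const

section Lift

variable {κ : CStarTensor.{u}} {C : Type w} [Category.{w'} C] [MonoidalCategory C]
  [SymmetricCategory C] {U : C ⥤ CStarAlg κ} [U.Braided] {D : C}

/-- The morphism of the subcategory given by a point of the operad. -/
def uLift (hU : ∀ (j : ℕ) (f : tpow (U.obj D) j ⟶ U.obj D), CStarAlg.UnitalHom f →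
    ∃ g : tpow D j ⟶ D, powMu U D j ≫ U.map g = f) {j : ℕ} (f : (U.obj D).UHom j) : tpow D j ⟶ D :=
  (hU j f.1 f.2).choose

variable (hU : ∀ (j : ℕ) (f : tpow (U.obj D) j ⟶ U.obj D), CStarAlg.UnitalHom f →
    ∃ g : tpow D j ⟶ D, powMu U D j ≫ U.map g = f)

lemma powMu_map_uLift {j : ℕ} (f : (U.obj D).UHom j) : powMu U D j ≫ U.map (uLift hU f) = f.1 :=
  (hU j f.1 f.2).choose_spec

lemma map_uLift {j : ℕ} (f : (U.obj D).UHom j) : U.map (uLift hU f) = inv (powMu U D j) ≫ f.1 := by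
  rw [IsIso.eq_inv_comp, powMu_map_uLift]

/-- The choice in `uLift` does no harm: by `map_uLift` its image under `U` is an explicit continuous
function of `f`, and the morphism spaces of `C` carry the topology induced along `U`. -/
lemma continuous_map_uLift (j : ℕ) : Continuous fun f : (U.obj D).UHom j => U.map (uLift hU f) := by
  simp only [map_uLift]
  exact CStarAlg.continuous_comp continuous_const continuous_subtype_val

lemma continuous_map_uLift_whiskerRight (n : ℕ) (A : C) :
    Continuous fun f : (U.obj D).UHom (n + 1) =>
      U.map ((α_ (tpow D n) D A).inv ≫ ((uLift hU f : tpow D n ⊗ D ⟶ D) ▷ A)) := by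
  exact continuous_map_comp_whiskerRight (continuous_map_uLift hU (n + 1)) A _

variable [U.Faithful]

/-- Uniqueness of lifts, from the invertibility of `powMu U D j` and the faithfulness of `U`. It
reduces every identity between lifts to one between homomorphisms of C*-algebras. -/
lemma uLift_eq {j : ℕ} {f : (U.obj D).UHom j} {g : tpow D j ⟶ D}
    (h : powMu U D j ≫ U.map g = f.1) : uLift hU f = g := by
  refine U.map_injective ?_
  rw [map_uLift, ← h, IsIso.inv_hom_id_assoc]

variable (hD : ∃ e : U.obj D, CStarAlg.IsOne e)

lemma uLift_uOne : uLift hU (CStarAlg.uOne hD) = (powOne D).hom := uLift_eq hU (powMu_powOne U D)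

lemma uLift_uAct {m n : ℕ} (e : Fin m ≃ Fin n) (f : (U.obj D).UHom n) :
    uLift hU (CStarAlg.uAct hD e f) = permPow D e ≫ uLift hU f := by
  refine uLift_eq hU ?_
  rw [U.map_comp, ← Category.assoc, ← permPow_powMu, Category.assoc, powMu_map_uLift]
  rfl

/-- The square `tensorMaps_powMu` for `U` in place of `F`. Together with `uLift_uOne` and
`uLift_uAct`, it makes `uLift` a morphism from the `D`-operad to the endomorphism operad of `D` in
`C`. -/
lemma uLift_uComp {k : ℕ} (n : Fin k → ℕ) (c : (U.obj D).UHom k)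
    (d : ∀ i, (U.obj D).UHom (n i)) :
    uLift hU (CStarAlg.uComp hD n c d) = tensorMaps n (fun i => uLift hU (d i)) ≫ uLift hU c := by
  refine uLift_eq hU ?_
  rw [U.map_comp, ← Category.assoc, ← tensorMaps_powMu, Category.assoc, powMu_map_uLift]
  simp only [powMu_map_uLift]
  rfl

/-- The lift of an operadic composite, brought to the shape of the module axiom: the last block is
separated and its length written as `m + 1`. -/
lemma uLift_uAct_uComp {k m : ℕ} (n : Fin (k + 1) → ℕ) (h : n (Fin.last k) = m + 1)
    (e : (∑ i : Fin k, n i.castSucc) + m + 1 = ∑ i, n i) (c : (U.obj D).UHom (k + 1))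
    (d : ∀ i, (U.obj D).UHom (n i)) :
    uLift hU (CStarAlg.uAct hD (finCongr e) (CStarAlg.uComp hD n c d)) =
      (powAdd D (∑ i : Fin k, n i.castSucc) (m + 1)).hom ≫
        (tensorMaps (fun i => n i.castSucc) (fun i => uLift hU (d i.castSucc)) ⊗ₘ
          uLift hU (CStarAlg.uAct hD (finCongr h.symm) (d (Fin.last k)))) ≫ uLift hU c := by
  rw [uLift_uAct, uLift_uComp, uLift_uAct, permPow_finCongr, permPow_finCongr]
  have := powCast_comp_tensorMaps n h e fun i => uLift hU (d i)
  exact (Category.assoc _ _ _).symm.trans ((congrArg (· ≫ uLift hU c) this).trans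
    (Category.assoc _ _ _))

end Lift

/-! ### The algebra and its modules -/

section DOperad

variable {κ : CStarTensor.{u}} {C : Type w} [Category.{w'} C] [MonoidalCategory C]
  [SymmetricCategory C] {U : C ⥤ CStarAlg κ} [U.Braided] {D : C}
  (hD : (U.obj D).IsStronglySelfAbsorbing)
  (hU : ∀ (j : ℕ) (f : tpow (U.obj D) j ⟶ U.obj D), CStarAlg.UnitalHom f →
    ∃ g : tpow D j ⟶ D, powMu U D j ≫ U.map g = f)
  {B : Type v} [Category.{u} B] [Limits.HasZeroMorphisms B] [PtTopCategory B]
  {F : C ⥤ B}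

/-- The enrichment gives continuity on the `k`-ification of the topology induced by `U`; for
families indexed by a compactly generated space this is ordinary continuity. -/
lemma IsEnriched.continuous_map (hF : IsEnriched U F) {Z : Type u} [TopologicalSpace Z] [IsSpace Z]
    {X Y : C} {G : Z → (X ⟶ Y)} (hG : Continuous fun z => U.map (G z)) :
    Continuous fun z => F.map (G z) := by
  have := IsSpace.cg (X := Z)
  let _ : TopologicalSpace (X ⟶ Y) :=
    .induced (fun f => U.map f) (CStarAlg.pointNorm (U.obj X) (U.obj Y))
  exact KCont.comp_continuous (f := fun f : X ⟶ Y => F.map f) (hF X Y) (continuous_induced_rng.2 hG)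

variable [MonoidalCategory B] [SymmetricCategory B] [F.LaxBraided]

lemma continuous_powMu_map_uLift (hF : IsEnriched U F) (j : ℕ) :
    Continuous fun f : ((U.obj D).dOperad hD).obj j => powMu F D j ≫ F.map (uLift hU f) := by
  have h := continuous_comp_const (hF.continuous_map
    (Z := ((U.obj D).dOperad hD).obj j) (continuous_map_uLift hU j)) (powMu F D j) (𝟙 _)
  simpa only [Category.comp_id] using h

lemma continuous_module_map (hF : IsEnriched U F) (n : ℕ) (A : C) :
    Continuous fun f : ((U.obj D).dOperad hD).obj (n + 1) =>
      (powMu F D n ▷ F.obj (D ⊗ A)) ≫ μ F (tpow D n) (D ⊗ A) ≫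
        F.map ((α_ (tpow D n) D A).inv ≫ ((uLift hU f : tpow D n ⊗ D ⟶ D) ▷ A)) := by
  have h := continuous_comp_const (hF.continuous_map
    (Z := ((U.obj D).dOperad hD).obj (n + 1)) (continuous_map_uLift_whiskerRight hU n A))
    ((powMu F D n ▷ F.obj (D ⊗ A)) ≫ μ F (tpow D n) (D ⊗ A)) (𝟙 _)
  simpa only [Category.comp_id, Category.assoc] using h

variable (hF : IsEnriched U F) [U.Faithful] (T : ClosedAction B)

/-- The algebra `F(D)` over the `D`-operad. -/
def dAlgebra : OperadAlgebra T ((U.obj D).dOperad hD) (F.obj D) where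
  θ j := T.ofFamily _ (continuous_powMu_map_uLift hD hU hF j)
  unit := by
    rw [T.evalAt_ofFamily]
    exact (congrArg (fun g => powMu F D 1 ≫ F.map g) (uLift_uOne hU hD.unital)).trans
      (powMu_powOne F D)
  assoc n c d := by
    simp only [T.evalAt_ofFamily]
    -- Both sides are now `powMu` followed by the image of a morphism of `C`, so the axiom reduces
    -- to `uLift_uComp`.
    rw [← Category.assoc, tensorMaps_powMu, Category.assoc, ← F.map_comp]
    exact congrArg (fun g => powMu F D _ ≫ F.map g) (uLift_uComp hU hD.unital n c d)
  equivariant e c := by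
    simp only [T.evalAt_ofFamily]
    rw [← Category.assoc, permPow_powMu, Category.assoc, ← F.map_comp]
    exact congrArg (fun g => powMu F D _ ≫ F.map g) (uLift_uAct hU hD.unital e c)

lemma evalAt_dAlgebra (j : ℕ) (f : ((U.obj D).dOperad hD).obj j) :
    T.evalAt ((dAlgebra hD hU hF T).θ j) f = powMu F D j ≫ F.map (uLift hU f) :=
  T.evalAt_ofFamily _ (continuous_powMu_map_uLift hD hU hF j) f

/-- The module `F(D ⊗ A)` over the algebra `F(D)`. -/
def dModule (A : C) : OperadModule (dAlgebra hD hU hF T) (F.obj (D ⊗ A)) where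
  lam n := T.ofFamily _ (continuous_module_map hD hU hF n A)
  unit := by
    rw [T.evalAt_ofFamily]
    have h : (uLift hU ((U.obj D).dOperad hD).one : tpow D 1 ⟶ D) = (λ_ D).hom :=
      uLift_uOne hU hD.unital
    -- The unit of the operad lifts to the left unitor of `D`; tensored with `A` and reassociated,
    -- this is the left unitor of `D ⊗ A`, to which left unitality of `F` applies.
    have h2 := left_unitality F (D ⊗ A)
    rw [leftUnitor_tensor_hom] at h2
    exact (congrArg (fun g : 𝟙_ C ⊗ D ⟶ D => (ε F ▷ F.obj (D ⊗ A)) ≫ μ F (𝟙_ C) (D ⊗ A) ≫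
      F.map ((α_ (𝟙_ C) D A).inv ≫ (g ▷ A))) h).trans h2.symm
  assoc {k m} n h c d := by
    simp only [T.evalAt_ofFamily]
    have e1 : (fun i : Fin k => T.evalAt ((dAlgebra hD hU hF T).θ (n i.castSucc)) (d i.castSucc)) =
        fun i : Fin k => powMu F D (n i.castSucc) ≫ F.map (uLift hU (d i.castSucc)) :=
      funext fun i => evalAt_dAlgebra hD hU hF T _ _
    rw [e1]
    -- `e2` computes the composite operation inside `C`, and `e3` distributes the lax structure maps
    -- over it.
    have e2 := uLift_uAct_uComp hU hD.unital n h
      (by rw [Fin.sum_univ_castSucc, h, add_assoc]) c d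
    have e3 := lax_module_assoc F (A := A)
      (uLift hU (CStarAlg.uAct hD.unital (finCongr h.symm) (d (Fin.last k))) : tpow D m ⊗ D ⟶ D)
      (uLift hU c : tpow D k ⊗ D ⟶ D) (powAdd_powMu F D (∑ i : Fin k, n i.castSucc) m)
      (tensorMaps_powMu F (fun i => n i.castSucc) fun i => uLift hU (d i.castSucc))
    exact (congrArg (fun g : tpow D ((∑ i : Fin k, n i.castSucc) + m) ⊗ D ⟶ D =>
      (powMu F D _ ▷ F.obj (D ⊗ A)) ≫ μ F (tpow D _) (D ⊗ A) ≫
        F.map ((α_ (tpow D _) D A).inv ≫ (g ▷ A))) e2).trans e3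
  equivariant {m n} e c := by
    simp only [T.evalAt_ofFamily]
    have h1 := uLift_uAct hU hD.unital (extendLast e) c
    rw [permPow_extendLast] at h1
    -- The permutation leaves the last factor alone. It passes through the associator and `μ` by
    -- naturality, and then through `powMu` by `permPow_powMu`.
    have h2 (g : tpow D n ⊗ D ⟶ D) : (powMu F D m ▷ F.obj (D ⊗ A)) ≫ μ F (tpow D m) (D ⊗ A) ≫
          F.map ((α_ (tpow D m) D A).inv ≫ (((permPow D e ▷ D) ≫ g) ▷ A)) =
        (permPow (F.obj D) e ▷ F.obj (D ⊗ A)) ≫ (powMu F D n ▷ F.obj (D ⊗ A)) ≫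
          μ F (tpow D n) (D ⊗ A) ≫ F.map ((α_ (tpow D n) D A).inv ≫ (g ▷ A)) := by
      rw [comp_whiskerRight, ← associator_inv_naturality_left_assoc, F.map_comp,
        ← μ_natural_left_assoc, ← comp_whiskerRight_assoc, ← permPow_powMu,
        comp_whiskerRight_assoc]
    refine (congrArg (fun g : tpow D m ⊗ D ⟶ D => (powMu F D m ▷ F.obj (D ⊗ A)) ≫
      μ F (tpow D m) (D ⊗ A) ≫ F.map ((α_ (tpow D m) D A).inv ≫ (g ▷ A))) h1).trans (h2 _)

lemma evalAt_dModule (A : C) (n : ℕ) (f : ((U.obj D).dOperad hD).obj (n + 1)) :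
    T.evalAt ((dModule hD hU hF T A).lam n) f =
      (powMu F D n ▷ F.obj (D ⊗ A)) ≫ μ F (tpow D n) (D ⊗ A) ≫
        F.map ((α_ (tpow D n) D A).inv ≫ ((uLift hU f : tpow D n ⊗ D ⟶ D) ▷ A)) :=
  T.evalAt_ofFamily _ (continuous_module_map hD hU hF n A) f

end DOperad

end

/-- A point `f` of the operad lives on the tensor powers of `U.obj D`, so the formulas refer to any
morphism `g` of `C` that represents it. By `uLift_eq` there is only one, and it is the lift used in
the construction. The last clause determines `M'` by the requirement that the image of the flip be
an isomorphism of modules. -/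
theorem theorem3p5
    -- a C*-tensor product
    (κ : CStarTensor.{u})
    -- a symmetric monoidal topological subcategory of the category of C*-algebras
    {C : Type w} [Category.{w'} C] [MonoidalCategory C] [SymmetricCategory C]
    (U : C ⥤ CStarAlg κ) [U.Faithful] [U.Braided]
    -- a strongly self-absorbing C*-algebra in it, such that the points of its operad are in it
    (D : C) (hD : (U.obj D).IsStronglySelfAbsorbing)
    (hU : ∀ (j : ℕ) (f : tpow (U.obj D) j ⟶ U.obj D), CStarAlg.UnitalHom f →
      ∃ g : tpow D j ⟶ D, powMu U D j ≫ U.map g = f)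
    -- a symmetric monoidal pointed topological category with a closed action of pointed spaces
    {B : Type v} [Category.{u} B] [Limits.HasZeroMorphisms B] [PtTopCategory B]
    [MonoidalCategory B] [SymmetricCategory B] [MonoidalPtTop B] (T : ClosedAction B)
    -- a lax symmetric monoidal enriched functor
    (F : C ⥤ B) [F.LaxBraided] (hF : IsEnriched U F) :
    ∃ alg : OperadAlgebra T ((U.obj D).dOperad hD) (F.obj D),
      (∀ (j : ℕ) (f : (U.obj D).UHom j) (g : tpow D j ⟶ D), powMu U D j ≫ U.map g = f.1 →
        T.evalAt (alg.θ j) f = powMu F D j ≫ F.map g) ∧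
      ∀ A : C, ∃ (M : OperadModule alg (F.obj (D ⊗ A))) (M' : OperadModule alg (F.obj (A ⊗ D))),
        (∀ (n : ℕ) (f : (U.obj D).UHom (n + 1)) (g : tpow D n ⊗ D ⟶ D),
          powMu U D (n + 1) ≫ U.map g = f.1 →
          T.evalAt (M.lam n) f = (powMu F D n ▷ F.obj (D ⊗ A)) ≫
            Functor.LaxMonoidal.μ F (tpow D n) (D ⊗ A) ≫
              F.map ((α_ (tpow D n) D A).inv ≫ (g ▷ A))) ∧
        ∀ (n : ℕ) (f : (U.obj D).UHom (n + 1)),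
          T.evalAt (M'.lam n) f = (tpow (F.obj D) n ◁ F.map (β_ A D).hom) ≫
            T.evalAt (M.lam n) f ≫ F.map (β_ D A).hom := by
  refine ⟨dAlgebra hD hU hF T, fun j f g h => ?_, fun A => ⟨dModule hD hU hF T A,
    (dModule hD hU hF T A).ofIso ⟨F.map (β_ A D).hom, F.map (β_ D A).hom, ?_, ?_⟩,
    fun n f g h => ?_, fun n f => ?_⟩⟩
  · exact (evalAt_dAlgebra hD hU hF T j f).trans
      (congrArg (fun g => powMu F D j ≫ F.map g) (uLift_eq hU h))
  -- The braiding is symmetric, so `F.map (β_ D A).hom` is inverse to `F.map (β_ A D).hom`.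
  · rw [← F.map_comp, SymmetricCategory.symmetry, F.map_id]
  · rw [← F.map_comp, SymmetricCategory.symmetry, F.map_id]
  · exact (evalAt_dModule hD hU hF T A n f).trans
      (congrArg (fun g : tpow D n ⊗ D ⟶ D => (powMu F D n ▷ F.obj (D ⊗ A)) ≫
        Functor.LaxMonoidal.μ F (tpow D n) (D ⊗ A) ≫ F.map ((α_ (tpow D n) D A).inv ≫ (g ▷ A)))
        (uLift_eq hU h))
  · exact OperadModule.evalAt_ofIso (O := (U.obj D).dOperad hD) _ _ n f
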